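/- **Setting.** Let $N\ge 1$, $\omega\in\mathbb C$ with $\Im\omega>0$, $\Gamma=\pi\mathbb Z+\pi\omega\mathbb Z$, $\mathsf x,\mathsf y\in\{0,1\}$, $\kappa\in\mathbb C\setminus\{0\}$, $\eta\in\mathbb C$, $\xi_1,\dots,\xi_N\in\mathbb C$. Put $$\theta(z)=-i\sum_{k\in\mathbb Z}(-1)^k e^{i\pi\omega(k+\frac12)^2+2i(k+\frac12)z},\qquad \vartheta_j(z)=\sum_{n\in\mathbb Z}e^{i\pi N\omega(n+\frac12-\frac jN)^2+2iN(n+\frac12-\frac jN)(z-\frac\pi2)}\quad(0\le j\le N-1),$$ $t_0=-\frac\eta2N+\mathsf x\frac\pi2+\mathsf y\frac\pi2\omega$ and $\epsilon_{\mathsf{xy}}=(-1)^{\mathsf x+\mathsf y+\mathsf x\mathsf y}$. Assume that $\eta\notin\Gamma$, that $t_0+k\eta\notin\Gamma$ for all $k\in\mathbb Z$ (so $(\mathsf x,\mathsf y)\ne(0,0)$ if $N$ is even), and that $\xi_a-\xi_b+\epsilon\eta\notin\Gamma$ for $a\ne b$ and $\epsilon\in\{-1,0,1\}$. *Monodromy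 matrix.* Let $a(\lambda)=\theta(\lambda+\eta)$, $b(\lambda|t)=\theta(\lambda)\theta(t+\eta)/\theta(t)$, $c(\lambda|t)=\theta(\eta)\theta(t+\lambda)/\theta(t)$ and $$R(\lambda|t)=\begin{pmatrix}a(\lambda)&0&0&0\\0&e^{i\mathsf y\eta}b(\lambda|t)&e^{i\mathsf y\lambda}c(\lambda|t)&0\\0&e^{-i\mathsf y\lambda}c(\lambda|-t)&e^{-i\mathsf y\eta}b(\lambda|-t)&0\\0&0&0&a(\lambda)\end{pmatrix}.$$ Let $\mathbb D$ be the space with basis $\otimes_{n=1}^N|n,h_n\rangle\otimes|t(a)\rangle$, $\mathbf h\in\{0,1\}^N$, $a\in\mathbb Z$, where $\sigma_n^z=1-2h_n$, $\tau|t(a)\rangle=t(a)|t(a)\rangle$ with $t(a)=t_0-\eta a$, and $\mathsf T_\tau^{\pm}|t(a)\rangle=|t(a\pm1)\rangle$. Operators act on covectors from the right. Let $\mathsf S=\sum_n\sigma_n^z$, and let $\bar{\mathbb D}^{(0,\mathcal R)}$, $\bar{\mathbb D}^{(0,\mathcal L)}$ be the spaces of vectors, resp. covectors, on which $\eta\mathsf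 S+2\tau$ has eigenvalue $\mathsf x\pi+\mathsf y\pi\omega$. Set $$\begin{pmatrix}\mathcal A&\mathcal B\\\mathcal C&\mathcal D\end{pmatrix}(\lambda)=R_{0N}\Big(\lambda-\xi_N\Big|\tau+\eta\sum_{a<N}\sigma_a^z\Big)\cdots R_{01}(\lambda-\xi_1|\tau)\,\mathsf T_\tau^{\sigma_0^z},\qquad \overline{\mathcal T}^{(\kappa)}(\lambda)=\kappa^{-1}\mathcal B(\lambda)+\kappa\,\mathcal C(\lambda).$$ *Separated basis.* Let $\mathsf a(\lambda)=\prod_n a(\lambda-\xi_n)$, $\mathsf d(\lambda)=\mathsf a(\lambda-\eta)$, $\mathsf a_{\mathsf{xy}}=\epsilon_{\mathsf{xy}}\mathsf a$, $\det_q\mathsf M(\lambda)=\mathsf a(\lambda)\mathsf d(\lambda-\eta)$, $\xi_a^{(h)}=\xi_a-\eta h$, $\bar\xi_0=\frac1N(\sum_k\xi_k+t_0)$ and $[\Theta^{(\mathbf h)}]_{ij}=\vartheta_{j-1}(\xi_i^{(h_i)}-\bar\xi_0)$. With $\mathbf 0=(0,\dots,0)$ and $\mathbf 1=(1,\dots,1)$,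 let $$\langle\mathbf h|=\tfrac1{\mathsf n}\big(\otimes_n\langle n,0|\big)\otimes\langle t(0)|\prod_n\Big(\tfrac{\mathcal C(\xi_n)}{\mathsf d(\xi_n-\eta)}\Big)^{h_n},\qquad |\mathbf h\rangle=\prod_n\Big(\tfrac{\mathcal C(\xi_n-\eta)}{\mathsf d(\xi_n-\eta)}\Big)^{1-h_n}\tfrac1{\mathsf n}\big(\otimes_n|n,1\rangle\big)\otimes|t(-N)\rangle,$$ with the constant $\mathsf n$ fixed, up to sign, by $\langle\mathbf 1|\mathbf 1\rangle=e^{-i\mathsf y\eta N}/\det\Theta^{(\mathbf 1)}$. **Theorem.** Let $\langle\Psi_{\bar{\mathsf t}}|\in\bar{\mathbb D}^{(0,\mathcal L)}$ and $|\Psi_{\bar{\mathsf t}'}\rangle\in\bar{\mathbb D}^{(0,\mathcal R)}$ be any nonzero left and right eigenstates of $\overline{\mathcal T}^{(\kappa)}(\lambda)$ (for all $\lambda$), with eigenvalue functions $\bar{\mathsf t}(\lambda)$ and $\bar{\mathsf t}'(\lambda)$. Then $$\langle\Psi_{\bar{\mathsf t}}|=\sum_{\mathbf h}\prod_a\Big[(\kappa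 e^{i\mathsf y\eta})^{h_a}\mathsf q_a^{(h_a)}\Big]\det\Theta^{(\mathbf h)}\langle\mathbf h|,\qquad |\Psi_{\bar{\mathsf t}'}\rangle=\sum_{\mathbf h}\prod_a\Big[\Big(\kappa^{-1}e^{i\mathsf y\eta}\tfrac{\mathsf a_{\mathsf{xy}}(\xi_a)}{\mathsf d(\xi_a-\eta)}\Big)^{h_a}\mathsf q_a'^{(h_a)}\Big]\det\Theta^{(\mathbf h)}|\mathbf h\rangle$$ for some $\mathsf q=\mathsf q_{\bar{\mathsf t}}$ and $\mathsf q'=\mathsf q_{\bar{\mathsf t}'}$, where $\mathsf q_{\bar{\mathsf t}}$ stands for numbers $\mathsf q_a^{(h)}$ ($1\le a\le N$, $h\in\{0,1\}$) such that $\mathsf q_a^{(0)}\neq0$ and $$\frac{\mathsf q_a^{(1)}}{\mathsf q_a^{(0)}}=\frac{\mathsf d(\xi_a-\eta)}{\bar{\mathsf t}(\xi_a-\eta)}=\frac{\bar{\mathsf t}(\xi_a)}{\mathsf a_{\mathsf{xy}}(\xi_a)},$$ and similarly for $\mathsf q_{\bar{\mathsf t}'}$ with $\bar{\mathsf t}'$.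 For all such $\mathsf q,\mathsf q'$ and $1\le n\le N$, the projectors $E_n^{++}$, $E_n^{--}$ on $h_n=0$, $h_n=1$ satisfy $$\langle\Psi_{\bar{\mathsf t}}|E_n^{++}|\Psi_{\bar{\mathsf t}'}\rangle=\frac{\prod_{b=1}^{n-1}\bar{\mathsf t}(\xi_b)}{\prod_{b=1}^{n}\bar{\mathsf t}'(\xi_b)}\det\mathcal S_{\mathsf q,\mathsf q'}(\xi_n)=\epsilon_{\mathsf{xy}}\frac{\prod_{b=1}^{n}\bar{\mathsf t}(\xi_b)}{\prod_{b=1}^{n-1}\bar{\mathsf t}'(\xi_b)}\,\frac{\det\mathcal S_{\mathsf q',\mathsf q}(\xi_n-\eta)}{\det_q\mathsf M(\xi_n)},$$ $$\langle\Psi_{\bar{\mathsf t}}|E_n^{--}|\Psi_{\bar{\mathsf t}'}\rangle=\frac{\prod_{b=1}^{n-1}\bar{\mathsf t}(\xi_b)}{\prod_{b=1}^{n}\bar{\mathsf t}'(\xi_b)}\det\mathcal S_{\mathsf q',\mathsf q}(\xi_n)=\epsilon_{\mathsf{xy}}\frac{\prod_{b=1}^{n}\bar{\mathsf t}(\xi_b)}{\prod_{b=1}^{n-1}\bar{\mathsf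 t}'(\xi_b)}\,\frac{\det\mathcal S_{\mathsf q,\mathsf q'}(\xi_n-\eta)}{\det_q\mathsf M(\xi_n)},$$ where $\mathcal S_{\mathsf q,\mathsf q'}(u)$ is the $(N+1)\times(N+1)$ matrix with, for $1\le a,b\le N$, $$[\mathcal S]_{a,b}=\sum_{h=0}^1\Big(e^{i\mathsf y\eta}\tfrac{\mathsf a_{\mathsf{xy}}(\xi_a)}{\mathsf d(\xi_a-\eta)}\Big)^{h}\mathsf q_a^{(h)}\mathsf q_a'^{(h)}\,\vartheta_{b-1}(\xi_a^{(h)}-\bar\xi_0),\qquad [\mathcal S]_{a,N+1}=e^{i\mathsf y\xi_a}\mathsf a_{\mathsf{xy}}(\xi_a)\,\mathsf q_a^{(0)}\mathsf q_a'^{(1)},$$ $$[\mathcal S]_{N+1,b}=-e^{-i\mathsf yu}\,\vartheta_{b-1}(u-\bar\xi_0),\qquad [\mathcal S]_{N+1,N+1}=0.$$ -/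

import Mathlib

noncomputable section

open Complex

namespace DynSixVertex

/-! ### Theta functions -/

/-- The theta function with quasi-periods `π` and `π ω`. -/
def theta (ω z : ℂ) : ℂ :=
  -I * ∑' k : ℤ, (-1 : ℂ) ^ k *
    exp (I * Real.pi * ω * ((k : ℂ) + 1 / 2) ^ 2 + 2 * I * ((k : ℂ) + 1 / 2) * z)

/-- The functions `ϑ_j`, `0 ≤ j ≤ N - 1`: a basis of theta functions of order `N` and norm `0`. -/
def vartheta (N : ℕ) (ω : ℂ) (j : ℕ) (z : ℂ) : ℂ :=
  ∑' n : ℤ,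
    exp (I * Real.pi * N * ω * ((n : ℂ) + 1 / 2 - (j : ℂ) / N) ^ 2
      + 2 * I * N * ((n : ℂ) + 1 / 2 - (j : ℂ) / N) * (z - Real.pi / 2))

/-- The period lattice `Γ = π ℤ + π ω ℤ`. -/
def periodLattice (ω : ℂ) : Set ℂ :=
  {z | ∃ m n : ℤ, z = m * Real.pi + n * (Real.pi * ω)}

/-! ### The model -/

/-- The parameters of a chain of `N` sites: the modulus `ω`, the crossing parameter `η`, the two
labels `x, y ∈ {0, 1}` and the inhomogeneities `ξ_1, …, ξ_N` (indexed from `0`). -/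
structure Model (N : ℕ) where
  ω : ℂ
  η : ℂ
  x : Fin 2
  y : Fin 2
  ξ : Fin N → ℂ

variable {N : ℕ}

namespace Model

/-- The label `x` as a complex number. -/
def xc (P : Model N) : ℂ := ((P.x : ℕ) : ℂ)

/-- The label `y` as a complex number. -/
def yc (P : Model N) : ℂ := ((P.y : ℕ) : ℂ)

/-- The sign `(-1)^{x + y + x y}`. -/
def sgn (P : Model N) : ℂ := (-1) ^ ((P.x : ℕ) + (P.y : ℕ) + (P.x : ℕ) * (P.y : ℕ))

/-- `θ(z) = θ_1(z | ω)`. -/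
def th (P : Model N) (z : ℂ) : ℂ := theta P.ω z

/-- The reference height `t_0`. -/
def t0 (P : Model N) : ℂ :=
  -(P.η / 2) * N + P.xc * (Real.pi / 2) + P.yc * (Real.pi / 2) * P.ω

/-- The standing assumptions: `Im ω > 0`, `η` is generic (no lattice point, and no dynamical weight
on the heights `t_0 + η ℤ` is singular; the latter excludes `(x, y) = (0, 0)` with `N` even), and
the inhomogeneities are in general position. -/
structure Generic (P : Model N) : Prop where
  im_pos : 0 < P.ω.im
  eta_notMem : P.η ∉ periodLattice P.ω
  height_notMem : ∀ k : ℤ, P.t0 + k * P.η ∉ periodLattice P.ω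
  inhom : ∀ a b : Fin N, a ≠ b →
    P.ξ a - P.ξ b - P.η ∉ periodLattice P.ω ∧
    P.ξ a - P.ξ b ∉ periodLattice P.ω ∧
    P.ξ a - P.ξ b + P.η ∉ periodLattice P.ω

/-! ### The dynamical R-matrix -/

/-- The weight `a(λ)`. -/
def wa (P : Model N) (u : ℂ) : ℂ := P.th (u + P.η)

/-- The weight `b(λ | t)`. -/
def wb (P : Model N) (u t : ℂ) : ℂ := P.th u * P.th (t + P.η) / P.th t

/-- The weight `c(λ | t)`. -/
def wc (P : Model N) (u t : ℂ) : ℂ := P.th P.η * P.th (t + u) / P.th t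

/-- The dynamical R-matrix `R(λ | t)` on `ℂ² ⊗ ℂ²`; the index `0` stands for spin `+`, the
index `1` for spin `-`. -/
def R (P : Model N) (u t : ℂ) : Matrix (Fin 2 × Fin 2) (Fin 2 × Fin 2) ℂ :=
  Matrix.of fun p q =>
    match p, q with
    | (0, 0), (0, 0) => P.wa u
    | (0, 1), (0, 1) => exp (I * P.yc * P.η) * P.wb u t
    | (0, 1), (1, 0) => exp (I * P.yc * u) * P.wc u t
    | (1, 0), (0, 1) => exp (-(I * P.yc * u)) * P.wc u (-t)
    | (1, 0), (1, 0) => exp (-(I * P.yc * P.η)) * P.wb u (-t)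
    | (1, 1), (1, 1) => P.wa u
    | _, _ => 0

end Model

/-! ### The representation space -/

/-- Labels of the dynamical-spin basis `(⊗_n |n, h_n⟩) ⊗ |t(a)⟩`, with `h ∈ {0, 1}^N`, `a ∈ ℤ`. -/
abbrev Label (N : ℕ) : Type := (Fin N → Fin 2) × ℤ

/-- The ket space, with the dynamical-spin basis as its basis. -/
abbrev Ket (N : ℕ) : Type := Label N →₀ ℂ

/-- Covectors; an operator acts on them to the left by `⟨φ| O = φ ∘ O`. -/
abbrev Bra (N : ℕ) : Type := Module.Dual ℂ (Ket N)

/-- The tensor product of the auxiliary space `V_0 = ℂ²` and the ket space. -/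
abbrev AuxKet (N : ℕ) : Type := (Fin 2 × Label N) →₀ ℂ

/-- The spin `1 - 2 h` of the basis vector with label `h ∈ {0, 1}`. -/
def spin (h : Fin 2) : ℤ := 1 - 2 * ((h : ℕ) : ℤ)

/-- The total spin `s_h`. -/
def totalSpin (h : Fin N → Fin 2) : ℤ := ∑ k, spin (h k)

namespace Model

/-- The heights `t(a) = - η a + t_0`. -/
def height (P : Model N) (a : ℤ) : ℂ := -P.η * a + P.t0

/-- The dynamical operator `τ`. -/
def tauOp (P : Model N) : Module.End ℂ (Ket N) :=
  Finsupp.linearCombination ℂ fun c : Label N => Finsupp.single c (P.height c.2)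

/-- The total spin operator `S`. -/
def spinOp (N : ℕ) : Module.End ℂ (Ket N) :=
  Finsupp.linearCombination ℂ fun c : Label N => Finsupp.single c (totalSpin c.1 : ℂ)

/-- The operator `S_τ = η S + 2 τ`. -/
def Stau (P : Model N) : Module.End ℂ (Ket N) := P.η • spinOp N + (2 : ℂ) • P.tauOp

/-- The eigenvalue `2 r η + x π + y π ω` of `S_τ`. -/
def StauValue (P : Model N) (r : ℤ) : ℂ :=
  2 * r * P.η + P.xc * Real.pi + P.yc * (Real.pi * P.ω)

/-- The ket sector: the eigenspace of `S_τ` for the eigenvalue `2 r η + x π + y π ω`. -/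
def ketSector (P : Model N) (r : ℤ) : Submodule ℂ (Ket N) :=
  Module.End.eigenspace P.Stau (P.StauValue r)

/-- The bra sector: the eigenspace of the left action of `S_τ` for the same eigenvalue. When
`η ≠ 0`, its elements are finite combinations of the dual dynamical-spin basis. -/
def braSector (P : Model N) (r : ℤ) : Submodule ℂ (Bra N) :=
  Module.End.eigenspace (LinearMap.dualMap P.Stau) (P.StauValue r)

/-- The local spin operator `E_n^{ij}` (`0` stands for `+`, `1` for `-`). -/
def E (n : Fin N) (i j : Fin 2) : Module.End ℂ (Ket N) :=
  Finsupp.linearCombination ℂ fun c : Label N =>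
    if c.1 n = j then Finsupp.single (Function.update c.1 n i, c.2) (1 : ℂ) else 0

/-! ### Monodromy matrix and antiperiodic transfer matrix -/

/-- The operator `R_{0,n}(u | τ + η ∑_{b < n} σ_b^z)`. -/
def Rop (P : Model N) (n : Fin N) (u : ℂ) : Module.End ℂ (AuxKet N) :=
  Finsupp.linearCombination ℂ fun c : Fin 2 × Label N =>
    ∑ p : Fin 2 × Fin 2,
      Finsupp.single (p.1, Function.update c.2.1 n p.2, c.2.2)
        (P.R u (P.height c.2.2 + P.η * ∑ b ∈ Finset.Iio n, (spin (c.2.1 b) : ℂ))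
          p (c.1, c.2.1 n))

/-- The operator `T_τ^{σ_0^z}`, where `T_τ^{±} |t(a)⟩ = |t(a ± 1)⟩`. -/
def shiftOp (N : ℕ) : Module.End ℂ (AuxKet N) :=
  Finsupp.linearCombination ℂ fun c : Fin 2 × Label N =>
    Finsupp.single (c.1, c.2.1, c.2.2 + spin c.1) (1 : ℂ)

/-- The monodromy matrix
`R_{0,N}(λ - ξ_N | τ + η ∑_{b < N} σ_b^z) ⋯ R_{0,1}(λ - ξ_1 | τ) T_τ^{σ_0^z}`. -/
def monodromy (P : Model N) (u : ℂ) : Module.End ℂ (AuxKet N) :=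
  ((List.finRange N).reverse.map fun n => P.Rop n (u - P.ξ n)).prod * shiftOp N

/-- The entries of the monodromy matrix with respect to the auxiliary space. -/
def entry (P : Model N) (i j : Fin 2) (u : ℂ) : Module.End ℂ (Ket N) :=
  (Finsupp.linearCombination ℂ fun c : Fin 2 × Label N =>
      if c.1 = i then Finsupp.single c.2 (1 : ℂ) else 0) ∘ₗ
    P.monodromy u ∘ₗ
    (Finsupp.linearCombination ℂ fun c : Label N => Finsupp.single (j, c) (1 : ℂ))

/-- The operator `𝓑(λ)`. -/
def opB (P : Model N) (u : ℂ) : Module.End ℂ (Ket N) := P.entry 0 1 u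

/-- The operator `𝓒(λ)`. -/
def opC (P : Model N) (u : ℂ) : Module.End ℂ (Ket N) := P.entry 1 0 u

/-- The `κ`-twisted antiperiodic transfer matrix `κ⁻¹ 𝓑(λ) + κ 𝓒(λ)`. -/
def transfer (P : Model N) (κ u : ℂ) : Module.End ℂ (Ket N) :=
  κ⁻¹ • P.opB u + κ • P.opC u

/-- `ψ` is a left eigenstate, in the sector `r = 0`, of the antiperiodic transfer matrix with
eigenvalue function `t`. -/
structure IsLeftEigenstate (P : Model N) (κ : ℂ) (t : ℂ → ℂ) (ψ : Bra N) : Prop where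
  mem : ψ ∈ P.braSector 0
  ne_zero : ψ ≠ 0
  eigen : ∀ u : ℂ, ψ ∘ₗ P.transfer κ u = t u • ψ

/-- `ψ` is a right eigenstate, in the sector `r = 0`, of the antiperiodic transfer matrix with
eigenvalue function `t`. -/
structure IsRightEigenstate (P : Model N) (κ : ℂ) (t : ℂ → ℂ) (ψ : Ket N) : Prop where
  mem : ψ ∈ P.ketSector 0
  ne_zero : ψ ≠ 0
  eigen : ∀ u : ℂ, P.transfer κ u ψ = t u • ψ

/-! ### The separated basis -/

/-- The function `a(λ) = ∏_n a(λ - ξ_n)`. -/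
def ca (P : Model N) (u : ℂ) : ℂ := ∏ n, P.wa (u - P.ξ n)

/-- The function `d(λ) = a(λ - η)`. -/
def cd (P : Model N) (u : ℂ) : ℂ := P.ca (u - P.η)

/-- The function `a_{x,y}(λ) = (-1)^{x + y + x y} a(λ)`. -/
def caxy (P : Model N) (u : ℂ) : ℂ := P.sgn * P.ca u

/-- The quantum determinant `a(λ) d(λ - η)`. -/
def qdet (P : Model N) (u : ℂ) : ℂ := P.ca u * P.cd (u - P.η)

/-- The label `a` of the height `t(a) = t_{r,h}`. -/
def heightLabel (r : ℤ) (h : Fin N → Fin 2) : ℤ := -(∑ k, ((h k : ℕ) : ℤ)) - r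

/-- `t_{r,h}`. -/
def trh (P : Model N) (r : ℤ) (h : Fin N → Fin 2) : ℂ :=
  -(P.η / 2) * totalSpin h + P.xc * (Real.pi / 2) + P.yc * (Real.pi / 2) * P.ω + r * P.η

/-- The covector `⟨r, h|` of the separated basis, with normalization constant `c`. -/
def leftState (P : Model N) (c : ℂ) (r : ℤ) (h : Fin N → Fin 2) : Bra N :=
  ((1 / c) • (Finsupp.lapply ((fun _ => 0), heightLabel r (fun _ : Fin N => 0)) : Bra N)) ∘ₗ
    ((List.finRange N).map fun n =>
      ((1 / P.cd (P.ξ n - P.η)) • P.opC (P.ξ n)) ^ (h n : ℕ)).prod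

/-- The vector `|h, r⟩` of the separated basis, with normalization constant `c`. -/
def rightState (P : Model N) (c : ℂ) (r : ℤ) (h : Fin N → Fin 2) : Ket N :=
  ((List.finRange N).map fun n =>
      ((1 / P.cd (P.ξ n - P.η)) • P.opC (P.ξ n - P.η)) ^ (1 - (h n : ℕ))).prod
    (Finsupp.single ((fun _ => 1), heightLabel r (fun _ : Fin N => 1)) (1 / c))

/-- The shifted inhomogeneity `ξ_a^{(h)} = ξ_a - η h`. -/
def xi (P : Model N) (a : Fin N) (h : Fin 2) : ℂ := P.ξ a - P.η * ((h : ℕ) : ℂ)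

/-- `ξ̄_r = (∑_k ξ_k + t_{r,0}) / N`. -/
def xibar (P : Model N) (r : ℤ) : ℂ := 1 / (N : ℂ) * (∑ k, P.ξ k + P.trh r fun _ => 0)

/-- The matrix `Θ^{(r,h)}`. -/
def Thmat (P : Model N) (r : ℤ) (h : Fin N → Fin 2) : Matrix (Fin N) (Fin N) ℂ :=
  Matrix.of fun i j => vartheta N P.ω (j : ℕ) (P.xi i (h i) - P.xibar r)

/-- The square of the normalization constant of the reference states: it is the value for which
`⟨0, 1| 1, 0⟩ = e^{- i y η N} / det Θ^{(0,1)}`, with `1 = (1, …, 1)`. -/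
def normSq (P : Model N) : ℂ :=
  P.leftState 1 0 (fun _ => 1) (P.rightState 1 0 fun _ => 1) *
    (P.Thmat 0 fun _ => 1).det * exp (I * P.yc * P.η * N)

/-! ### Separate states and determinants -/

/-- The coefficients `q_a^{(0)}, q_a^{(1)}` attached to an eigenvalue function `t`; they are
determined up to the normalization of `q_a^{(0)}`. -/
structure IsCoeff (P : Model N) (t : ℂ → ℂ) (q : Fin N → Fin 2 → ℂ) : Prop where
  ne_zero : ∀ a, q a 0 ≠ 0
  ratio_d : ∀ a, q a 1 / q a 0 = P.cd (P.ξ a - P.η) / t (P.ξ a - P.η)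
  ratio_a : ∀ a, q a 1 / q a 0 = t (P.ξ a) / P.caxy (P.ξ a)

/-- The right separate state with coefficients `q`. -/
def rightSeparate (P : Model N) (κ c : ℂ) (q : Fin N → Fin 2 → ℂ) : Ket N :=
  ∑ h : Fin N → Fin 2,
    ((∏ a, (κ⁻¹ * exp (I * P.yc * P.η) *
        (P.caxy (P.ξ a) / P.cd (P.ξ a - P.η))) ^ (h a : ℕ) * q a (h a)) *
      (P.Thmat 0 h).det) • P.rightState c 0 h

/-- The left separate state with coefficients `q`. -/
def leftSeparate (P : Model N) (κ c : ℂ) (q : Fin N → Fin 2 → ℂ) : Bra N :=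
  ∑ h : Fin N → Fin 2,
    ((∏ a, (κ * exp (I * P.yc * P.η)) ^ (h a : ℕ) * q a (h a)) *
      (P.Thmat 0 h).det) • P.leftState c 0 h

/-- The matrix `𝓕` of the scalar product of two separate states. -/
def Fmat (P : Model N) (q q' : Fin N → Fin 2 → ℂ) : Matrix (Fin N) (Fin N) ℂ :=
  Matrix.of fun a b =>
    ∑ h : Fin 2,
      (exp (I * P.yc * P.η) * (P.caxy (P.ξ a) / P.cd (P.ξ a - P.η))) ^ (h : ℕ) *
        q a h * q' a h * vartheta N P.ω (b : ℕ) (P.xi a h - P.xibar 0)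

/-- The `(N + 1) × (N + 1)` matrix `𝓢(u)`: the matrix `𝓕` with one more row and column. -/
def Smat (P : Model N) (q q' : Fin N → Fin 2 → ℂ) (u : ℂ) :
    Matrix (Fin N ⊕ Fin 1) (Fin N ⊕ Fin 1) ℂ :=
  Matrix.fromBlocks (P.Fmat q q')
    (Matrix.of fun a _ => exp (I * P.yc * P.ξ a) * P.caxy (P.ξ a) * q a 0 * q' a 1)
    (Matrix.of fun _ b => -(exp (-(I * P.yc * u)) * vartheta N P.ω (b : ℕ) (u - P.xibar 0)))
    0

end Model

end DynSixVertex

end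

noncomputable section

open Complex

namespace DynSixVertex

/-! ### The theta series -/

/-! In the sector r = 0 the height of a basis vector is determined by its number of down spins, so
𝓑(u) and 𝓒(u) become 2^N × 2^N matrices B(u) = `Generic.B`, C(u) = `Generic.C`, and T(u) = κ⁻¹B(u) +
κC(u). Three facts about them prove the theorem.

Algebra at the inhomogeneities. With ph(z) = e^{iyz}θ(z) the R-matrix is governed by the three-term
theta identity (`R_eq_wt`), which gives the dynamical Yang-Baxter equation, the exchange relations
and fusion: B(ξ_a)B(ξ_a−η) = C(ξ_a)C(ξ_a−η) = 0 and B(ξ_a)C(ξ_a−η) + C(ξ_a)B(ξ_a−η) = ε_xy det_q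
M(ξ_a). The last expression is a scalar because opposite heights of the sector add up to xπ + yπω
(`weights_ph_div_ph`). Hence the separated vectors K h and covectors L h are orthogonal for
different labels, and at ξ_a, ξ_a−η the matrices B, C either kill K h or flip its label h_a.

Interpolation. The entries of e^{iyu}B(u) and e^{iyu}C(u) are theta functions of order N in the span
of the ϑ_j(u−ξ̄_0) (`isThetaFn_chain`, `IsThetaFn.exists_eq_sum_vartheta`), and Θ^{(h)} is
invertible (`Generic.det_Thmat_ne_zero`), so N values determine them. This yields the pairing of L h
with K h, proportional to e^{−iyη|h|}/det Θ^{(h)} with |h| = ∑_a h_a, and the action of B(u), C(u)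
for all u. Moreover T(ξ_a)T(ξ_a−η) = ε_xy det_q M(ξ_a), and the overlaps of an eigenstate with the
separated bases satisfy one-site recursions. They therefore factorise over the sites: eigenstates
are separate states.

Reconstruction. Since R(0) is a multiple of the permutation, T(ξ_1) rotates the chain by one site
and flips a spin. Iterating on a right eigenvector v gives ∏_{b≤n} t'(ξ_b) E_n^{++}v =
T(ξ_1)⋯T(ξ_{n−1}) κC(ξ_n)v, with κ⁻¹B(ξ_n) for E_n^{−−} (`Weights.prod_smul_proj`). A left
eigenstate absorbs the factors T. By interpolation and multilinearity, the remaining matrix element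
is a sum of determinants with one row replaced, that is, the bordered determinant det 𝓢. The second
form of each identity comes from C(ξ_n)T(ξ_n−η) = κ⁻¹C(ξ_n)B(ξ_n−η) and its analogue for B
(`Generic.B_mulVec_right`). -/

lemma exp_eq_jacobiTheta₂_term (ω z : ℂ) (k : ℤ) :
    exp (I * Real.pi * ω * ((k : ℂ) + 1 / 2) ^ 2 + 2 * I * ((k : ℂ) + 1 / 2) * z) =
      exp (I * Real.pi * ω / 4 + I * z) * jacobiTheta₂_term k (z / Real.pi + ω / 2) ω := by
  have hpi : (Real.pi : ℂ) ≠ 0 := by exact_mod_cast Real.pi_ne_zero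
  rw [jacobiTheta₂_term, ← exp_add]
  congr 1
  field_simp
  ring

lemma summable_norm_theta_term {ω : ℂ} (hω : 0 < ω.im) (z : ℂ) :
    Summable fun k : ℤ => ‖exp (I * Real.pi * ω * ((k : ℂ) + 1 / 2) ^ 2
      + 2 * I * ((k : ℂ) + 1 / 2) * z)‖ := by
  simp_rw [exp_eq_jacobiTheta₂_term, norm_mul]
  exact ((summable_jacobiTheta₂_term_iff _ _).2 hω).norm.mul_left _

/-- Shifting the argument by π/2 produces both the sign (-1)^k and the prefactor -i of θ; the series
then has the same shape as that of ϑ_j. -/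
lemma exp_half_period (k : ℤ) :
    exp (-(2 * I * ((k : ℂ) + 1 / 2) * (Real.pi / 2))) = -I * (-1 : ℂ) ^ k := by
  have h1 : -(2 * I * ((k : ℂ) + 1 / 2) * (Real.pi / 2)) =
      -(Real.pi / 2 * I) + (k : ℂ) * (-(Real.pi * I)) := by ring
  rw [h1, exp_add, exp_int_mul, exp_neg (Real.pi * I), exp_pi_mul_I, exp_neg, exp_pi_div_two_mul_I]
  norm_num

lemma theta_eq_tsum (ω z : ℂ) :
    theta ω z = ∑' k : ℤ, exp (I * Real.pi * ω * ((k : ℂ) + 1 / 2) ^ 2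
      + 2 * I * ((k : ℂ) + 1 / 2) * (z - Real.pi / 2)) := by
  rw [theta, ← tsum_mul_left]
  refine tsum_congr fun k => ?_
  have h : I * Real.pi * ω * ((k : ℂ) + 1 / 2) ^ 2 + 2 * I * ((k : ℂ) + 1 / 2) * (z - Real.pi / 2) =
    -(2 * I * ((k : ℂ) + 1 / 2) * (Real.pi / 2)) +
      (I * Real.pi * ω * ((k : ℂ) + 1 / 2) ^ 2 + 2 * I * ((k : ℂ) + 1 / 2) * z) := by ring
  rw [h, exp_add (-_), exp_half_period]
  ring

lemma theta_neg (ω z : ℂ) : theta ω (-z) = -theta ω z := by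
  -- The reindexing k ↦ -k - 1 changes the sign of k + 1/2 and of (-1)^k.
  rw [theta, theta, ← mul_neg, ← tsum_neg, ← ((Equiv.neg ℤ).trans (Equiv.subRight 1)).tsum_eq]
  congr 1
  refine tsum_congr fun k => ?_
  have : (-1 : ℂ) ^ (-k - 1) = -(-1) ^ k := by
    rw [zpow_sub₀ (by norm_num), zpow_neg, ← inv_zpow]
    norm_num [div_neg]
  simp only [Equiv.trans_apply, Equiv.neg_apply, Equiv.subRight_apply, this]
  rw [neg_mul]
  congr 3
  push_cast
  ring

lemma theta_zero (ω : ℂ) : theta ω 0 = 0 := by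
  have := theta_neg ω 0
  rw [neg_zero] at this
  exact self_eq_neg.mp this

lemma theta_add_pi (ω z : ℂ) : theta ω (z + Real.pi) = -theta ω z := by
  rw [theta_eq_tsum, theta_eq_tsum, ← tsum_neg]
  refine tsum_congr fun k => ?_
  have h : I * Real.pi * ω * ((k : ℂ) + 1 / 2) ^ 2
      + 2 * I * ((k : ℂ) + 1 / 2) * (z + Real.pi - Real.pi / 2) =
    I * Real.pi * ω * ((k : ℂ) + 1 / 2) ^ 2 + 2 * I * ((k : ℂ) + 1 / 2) * (z - Real.pi / 2)
      + Real.pi * I + (k : ℂ) * (2 * Real.pi * I) := by ring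
  rw [h, exp_add, exp_add, exp_pi_mul_I, exp_int_mul, exp_two_pi_mul_I, one_zpow]
  ring

lemma theta_add_pi_mul (ω z : ℂ) :
    theta ω (z + Real.pi * ω) = -exp (-(2 * I * z) - I * Real.pi * ω) * theta ω z := by
  rw [theta, theta, ← (Equiv.addRight (1 : ℤ)).tsum_eq fun k : ℤ => (-1 : ℂ) ^ k *
    exp (I * Real.pi * ω * ((k : ℂ) + 1 / 2) ^ 2 + 2 * I * ((k : ℂ) + 1 / 2) * z),
    mul_left_comm (-exp _)]
  refine congrArg (-I * ·) ?_
  rw [← tsum_mul_left]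
  refine tsum_congr fun k => ?_
  rw [Equiv.coe_addRight, zpow_add_one₀ (by norm_num)]
  have h : I * Real.pi * ω * ((k : ℂ) + 1 / 2) ^ 2 + 2 * I * ((k : ℂ) + 1 / 2) * (z + Real.pi * ω) =
    (-(2 * I * z) - I * Real.pi * ω) + (I * Real.pi * ω * (((k + 1 : ℤ) : ℂ) + 1 / 2) ^ 2
      + 2 * I * (((k + 1 : ℤ) : ℂ) + 1 / 2) * z) := by push_cast; ring
  rw [h, exp_add]
  ring

lemma differentiable_theta {ω : ℂ} (hω : 0 < ω.im) : Differentiable ℂ (theta ω) := by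
  have h : theta ω = fun z => exp (I * Real.pi * ω / 4 + I * (z - Real.pi / 2)) *
      jacobiTheta₂ ((z - Real.pi / 2) / Real.pi + ω / 2) ω := by
    funext z
    rw [theta_eq_tsum, jacobiTheta₂]
    exact (tsum_congr fun k => exp_eq_jacobiTheta₂_term _ _ _).trans tsum_mul_left
  rw [h]
  refine Differentiable.mul (by fun_prop) fun z => ?_
  exact (differentiableAt_jacobiTheta₂_fst _ hω).comp z (by fun_prop)

/-! ### The addition formula -/

/-- The even part of the series attached to the doubled modulus. -/
def thetaEven (ω z : ℂ) : ℂ :=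
  ∑' a : ℤ, exp (I * Real.pi * ω * (2 * a : ℂ) ^ 2 / 2 + 2 * I * (2 * a) * z)

/-- The odd part of the series attached to the doubled modulus. -/
def thetaOdd (ω z : ℂ) : ℂ :=
  ∑' a : ℤ, exp (I * Real.pi * ω * (2 * a + 1 : ℂ) ^ 2 / 2 + 2 * I * (2 * a + 1) * z)

lemma summable_norm_thetaEven {ω : ℂ} (hω : 0 < ω.im) (z : ℂ) :
    Summable fun a : ℤ => ‖exp (I * Real.pi * ω * (2 * a : ℂ) ^ 2 / 2 + 2 * I * (2 * a) * z)‖ := by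
  have hpi : (Real.pi : ℂ) ≠ 0 := by exact_mod_cast Real.pi_ne_zero
  have h2 : 0 < (2 * ω).im := by simpa using hω
  refine ((summable_jacobiTheta₂_term_iff (2 * z / Real.pi) (2 * ω)).2 h2).norm.congr fun a => ?_
  rw [jacobiTheta₂_term]
  congr 2
  field_simp
  ring

lemma summable_norm_thetaOdd {ω : ℂ} (hω : 0 < ω.im) (z : ℂ) :
    Summable fun a : ℤ =>
      ‖exp (I * Real.pi * ω * (2 * a + 1 : ℂ) ^ 2 / 2 + 2 * I * (2 * a + 1) * z)‖ := by
  have h2 : 0 < (2 * ω).im := by simpa using hω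
  refine (summable_norm_theta_term h2 (2 * z)).congr fun a => ?_
  congr 2
  ring

/-- Pairs of integers, split according to the parity of their difference. -/
def parityEquiv : (ℤ × ℤ) ⊕ (ℤ × ℤ) ≃ ℤ × ℤ :=
  Equiv.ofBijective
    (Sum.elim (fun p => (p.1 + p.2, p.1 - p.2 - 1)) fun p => (p.1 + p.2, p.1 - p.2)) <| by
    constructor
    · rintro (⟨a, b⟩ | ⟨a, b⟩) (⟨c, d⟩ | ⟨c, d⟩) h <;>
        simp only [Sum.elim_inl, Sum.elim_inr, Prod.mk.injEq] at h <;>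
        first
        | (simp only [Sum.inl.injEq, Sum.inr.injEq, Prod.mk.injEq]; omega)
        | (exfalso; omega)
    · rintro ⟨k, l⟩
      rcases Int.even_or_odd' (k - l) with ⟨b, hb | hb⟩
      · exact ⟨Sum.inr (l + b, b), by simp only [Sum.elim_inr, Prod.mk.injEq]; omega⟩
      · exact ⟨Sum.inl (l + b + 1, b), by simp only [Sum.elim_inl, Prod.mk.injEq]; omega⟩

lemma parityEquiv_inl (p : ℤ × ℤ) : parityEquiv (Sum.inl p) = (p.1 + p.2, p.1 - p.2 - 1) := rfl

lemma parityEquiv_inr (p : ℤ × ℤ) : parityEquiv (Sum.inr p) = (p.1 + p.2, p.1 - p.2) := rfl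

/-- In the double series over (k, l), the quadratic form is diagonal in k + l + 1 and k - l, two
integers of opposite parity coupled to u and v respectively. The two choices of parity give the two
products on the right. -/
lemma theta_add_mul_theta_sub {ω : ℂ} (hω : 0 < ω.im) (u v : ℂ) :
    theta ω (u + v) * theta ω (u - v) =
      thetaEven ω u * thetaOdd ω v - thetaOdd ω u * thetaEven ω v := by
  have hs := summable_norm_theta_term hω
  have hE := summable_norm_thetaEven hω
  have hO := summable_norm_thetaOdd hω
  rw [theta_eq_tsum, theta_eq_tsum, tsum_mul_tsum_of_summable_norm (hs _) (hs _),
    thetaEven, thetaOdd, thetaOdd, thetaEven, tsum_mul_tsum_of_summable_norm (hE u) (hO v),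
    tsum_mul_tsum_of_summable_norm (hO u) (hE v)]
  have s1 := summable_mul_of_summable_norm (hE u) (hO v)
  have s2 := (summable_mul_of_summable_norm (hO u) (hE v)).neg
  have key := HasSum.sum (f := fun q => exp (I * Real.pi * ω * (((parityEquiv q).1 : ℂ) + 1 / 2) ^ 2
      + 2 * I * (((parityEquiv q).1 : ℂ) + 1 / 2) * (u + v - Real.pi / 2)) *
      exp (I * Real.pi * ω * (((parityEquiv q).2 : ℂ) + 1 / 2) ^ 2
      + 2 * I * (((parityEquiv q).2 : ℂ) + 1 / 2) * (u - v - Real.pi / 2)))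
    (by
      refine Eq.mp (congrArg (HasSum · _) (funext fun p => ?_)) s1.hasSum
      simp only [Function.comp, parityEquiv_inl]
      rw [← exp_add, ← exp_add, exp_eq_exp_iff_exists_int]
      -- The two shifts by π/2 contribute -iπ(k + l + 1), here -2πi times `p.1`. In the other parity
      -- class the sum is odd, whence the minus sign and the witness `p.1 + 1`.
      refine ⟨p.1, ?_⟩
      push_cast
      ring) (by
      refine Eq.mp (congrArg (HasSum · _) (funext fun p => ?_)) s2.hasSum
      simp only [Function.comp, parityEquiv_inr]
      rw [← exp_add, ← exp_add, ← mul_neg_one, ← exp_pi_mul_I, ← exp_add,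
        exp_eq_exp_iff_exists_int]
      refine ⟨p.1 + 1, ?_⟩
      push_cast
      ring)
  rw [tsum_neg, ← sub_eq_add_neg] at key
  rw [← parityEquiv.tsum_eq]
  exact key.tsum_eq

/-- The three-term identity. -/
lemma theta_three_term {ω : ℂ} (hω : 0 < ω.im) (x y z w : ℂ) :
    theta ω (x + z) * theta ω (x - z) * (theta ω (y + w) * theta ω (y - w))
      - theta ω (x + w) * theta ω (x - w) * (theta ω (y + z) * theta ω (y - z))
      = theta ω (x + y) * theta ω (x - y) * (theta ω (z + w) * theta ω (z - w)) := by
  -- Each product θ(a+b)θ(a-b) is now a 2 × 2 determinant of (even, odd) values at a and b, and the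
  -- identity is the Plücker relation for four vectors of the plane.
  simp only [theta_add_mul_theta_sub hω]
  ring

/-! ### The zeros of the theta function -/

-- On the line z = πx + π/2, up to the factor e^{iπx}, the series is a Fourier series of period 1 in
-- x. Were θ zero, integration over a period would kill the constant coefficient e^{iπω/4}.
open Filter Topology in
lemma exists_theta_ne_zero {ω : ℂ} (hω : 0 < ω.im) : ∃ z, theta ω z ≠ 0 := by
  by_contra! h
  set f : ℤ → ℝ → ℂ := fun k x =>
    exp (I * Real.pi * ω * ((k : ℂ) + 1 / 2) ^ 2 + 2 * I * k * (x * Real.pi)) with hf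
  have hnorm : ∀ k : ℤ, ∀ x : ℝ, ‖f k x‖ =
      ‖exp (I * Real.pi * ω * ((k : ℂ) + 1 / 2) ^ 2 + 2 * I * ((k : ℂ) + 1 / 2) * 0)‖ := by
    intro k x
    rw [hf]
    simp only [norm_exp]
    congr 1
    simp
  have hsum : ∀ x : ℝ, ∑' k, f k x = 0 := by
    intro x
    have h1 := h (x * Real.pi + Real.pi / 2)
    rw [theta_eq_tsum, add_sub_cancel_right] at h1
    have h2 : ∀ k : ℤ, f k x = exp (-(I * (x * Real.pi))) *
        exp (I * Real.pi * ω * ((k : ℂ) + 1 / 2) ^ 2 + 2 * I * ((k : ℂ) + 1 / 2) * (x * Real.pi)) := by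
      intro k
      simp only [hf, ← exp_add]
      congr 1
      ring
    rw [tsum_congr h2, tsum_mul_left, h1, mul_zero]
  have hint : ∀ k : ℤ, k ≠ 0 → ∫ x in (0 : ℝ)..1, f k x = 0 := by
    intro k hk
    have h3 : ∀ x : ℝ, f k x = exp (I * Real.pi * ω * ((k : ℂ) + 1 / 2) ^ 2) *
        exp ((2 * Real.pi * I * k) * x) := by
      intro x
      simp only [hf, ← exp_add]
      congr 1
      ring
    have h4 : (2 * Real.pi * I * k : ℂ) ≠ 0 := by
      simp [hk, Real.pi_ne_zero]
    simp_rw [h3]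
    rw [intervalIntegral.integral_const_mul, integral_exp_mul_complex h4]
    have h5 : exp (2 * Real.pi * I * k * ((1 : ℝ) : ℂ)) = 1 := by
      rw [exp_eq_one_iff]
      exact ⟨k, by push_cast; ring⟩
    rw [h5]
    simp
  have hcont : ∀ k, Continuous (f k) := fun k => by
    rw [hf]
    fun_prop
  have key := intervalIntegral.hasSum_intervalIntegral_of_summable_norm
    (a := 0) (b := 1) (f := fun k => ⟨f k, hcont k⟩) ?_
  · simp only [ContinuousMap.coe_mk, hsum, intervalIntegral.integral_zero] at key
    have h6 := key.unique (hasSum_single (0 : ℤ) fun k hk => hint k hk)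
    have h7 : ∀ x : ℝ, f 0 x = exp (I * Real.pi * ω * (1 / 2) ^ 2) := by
      intro x
      rw [hf]
      simp
    simp only [h7, intervalIntegral.integral_const] at h6
    rw [sub_zero, one_smul] at h6
    exact exp_ne_zero _ h6.symm
  · refine Summable.of_nonneg_of_le (fun _ => norm_nonneg _) (fun k => ?_)
      (summable_norm_theta_term hω 0)
    refine (ContinuousMap.norm_le _ (norm_nonneg _)).2 fun x => ?_
    exact (hnorm k x).le

/-- The three-term identity with its variables chosen so that the right-hand side contains the
factor θ(z₀) = 0. -/
lemma theta_product_shift {ω : ℂ} (hω : 0 < ω.im) {z₀ : ℂ} (h0 : theta ω z₀ = 0) {s t s' t' : ℂ}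
    (h : s + t = s' + t') :
    theta ω s * theta ω t * (theta ω (s' - z₀) * theta ω (t' - z₀)) =
      theta ω s' * theta ω t' * (theta ω (s - z₀) * theta ω (t - z₀)) := by
  have key := theta_three_term hω ((s + t) / 2) (z₀ - (s + t) / 2) ((s - t) / 2) ((s' - t') / 2)
  have e1 : (s + t) / 2 + (s - t) / 2 = s := by ring
  have e2 : (s + t) / 2 - (s - t) / 2 = t := by ring
  have e3 : (s + t) / 2 + (s' - t') / 2 = s' := by linear_combination h / 2
  have e4 : (s + t) / 2 - (s' - t') / 2 = t' := by linear_combination h / 2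
  have e5 : z₀ - (s + t) / 2 + (s' - t') / 2 = -(t' - z₀) := by linear_combination -h / 2
  have e6 : z₀ - (s + t) / 2 - (s' - t') / 2 = -(s' - z₀) := by linear_combination -h / 2
  have e7 : z₀ - (s + t) / 2 + (s - t) / 2 = -(t - z₀) := by ring
  have e8 : z₀ - (s + t) / 2 - (s - t) / 2 = -(s - z₀) := by ring
  have e9 : (s + t) / 2 + (z₀ - (s + t) / 2) = z₀ := by ring
  rw [e1, e2, e3, e4, e5, e6, e7, e8, e9, h0] at key
  simp only [theta_neg] at key
  linear_combination key

/-- A shift of `θ` by one of its zeros multiplies it by an exponential. -/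
lemma exists_theta_sub_eq_exp_mul {ω : ℂ} (hω : 0 < ω.im) {z₀ : ℂ} (h0 : theta ω z₀ = 0) :
    ∃ B C : ℂ, C ≠ 0 ∧ ∀ s, theta ω (s - z₀) = C * exp (B * s) * theta ω s := by
  have hd := differentiable_theta hω
  set g : ℂ → ℂ := fun s => theta ω (s - z₀) with hg
  have hgd : Differentiable ℂ g := hd.comp (by fun_prop)
  have hθa : AnalyticOnNhd ℂ (theta ω) Set.univ := fun z _ => hd.analyticAt z
  have hga : AnalyticOnNhd ℂ g Set.univ := fun z _ => hgd.analyticAt z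
  obtain ⟨z₁, hz₁⟩ := exists_theta_ne_zero hω
  obtain ⟨t, ht⟩ : ∃ t, theta ω t * g t ≠ 0 := by
    by_contra! h
    rcases AnalyticOnNhd.eq_zero_or_eq_zero_of_mul_eq_zero hθa hga (fun z _ => h z)
      isPreconnected_univ with h1 | h1
    · exact hz₁ (h1 z₁ trivial)
    · exact hz₁ (by simpa [hg] using h1 (z₁ + z₀) trivial)
  -- Differentiating the relation for the pair s + δ, t - δ at δ = 0 shows that g'/g - θ'/θ takes
  -- the same value at s and at t; so it is a constant, called `B` below.
  have hL : ∀ s, (deriv g s * theta ω s - deriv (theta ω) s * g s) * (theta ω t * g t) =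
      (deriv g t * theta ω t - deriv (theta ω) t * g t) * (theta ω s * g s) := by
    intro s
    have h1 : ∀ δ, theta ω s * theta ω t * (g (s + δ) * g (t - δ)) =
        theta ω (s + δ) * theta ω (t - δ) * (g s * g t) := fun δ =>
      theta_product_shift hω h0 (by ring)
    have a1 : ∀ f : ℂ → ℂ, Differentiable ℂ f →
        HasDerivAt (fun δ => f (s + δ)) (deriv f s) 0 := fun f hf => by
      have := (hf (s + 0)).hasDerivAt.comp_const_add s 0
      simpa using this
    have a2 : ∀ f : ℂ → ℂ, Differentiable ℂ f →
        HasDerivAt (fun δ => f (t - δ)) (-deriv f t) 0 := fun f hf => by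
      have := (hf (t - 0)).hasDerivAt.comp_const_sub t 0
      simpa using this
    have d1 := ((a1 g hgd).mul (a2 g hgd)).const_mul (theta ω s * theta ω t)
    have d2 := ((a1 _ hd).mul (a2 _ hd)).mul_const (g s * g t)
    have := d1.unique (d2.congr_of_eventuallyEq (Filter.Eventually.of_forall h1))
    simp only [add_zero, sub_zero] at this
    linear_combination this
  set B := (deriv g t * theta ω t - deriv (theta ω) t * g t) / (theta ω t * g t) with hB
  have hL' : ∀ s, deriv g s * theta ω s - deriv (theta ω) s * g s = B * (theta ω s * g s) := by
    intro s
    rw [hB, div_mul_eq_mul_div, eq_div_iff ht]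
    exact hL s
  have htθ : theta ω t ≠ 0 := left_ne_zero_of_mul ht
  set U := {z | theta ω z ≠ 0} with hU
  have hUo : IsOpen U := isOpen_ne_fun hd.continuous continuous_const
  obtain ⟨ε, hε, hball⟩ := Metric.isOpen_iff.1 hUo t htθ
  -- The quotient has derivative zero near `t`, where θ does not vanish; the identity theorem then
  -- extends the resulting formula to the whole plane.
  set q : ℂ → ℂ := fun s => g s * exp (-(B * s)) / theta ω s with hq
  have hqd : ∀ s ∈ Metric.ball t ε, HasDerivAt q 0 s := by
    intro s hs
    have h2 : theta ω s ≠ 0 := hball hs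
    have h3 : HasDerivAt (fun s => exp (-(B * s))) (exp (-(B * s)) * -(B * 1)) s :=
      (((hasDerivAt_id s).const_mul B).neg).cexp
    have h4 := ((hgd s).hasDerivAt.mul h3).div (hd s).hasDerivAt h2
    refine h4.congr_deriv ?_
    rw [div_eq_zero_iff, Pi.mul_apply]
    left
    linear_combination exp (-(B * s)) * hL' s
  have hconst : ∀ s ∈ Metric.ball t ε, q s = q t := fun s hs =>
    Metric.isOpen_ball.is_const_of_deriv_eq_zero (convex_ball t ε).isPreconnected
      (fun z hz => (hqd z hz).differentiableAt.differentiableWithinAt)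
      (fun z hz => (hqd z hz).deriv) hs (Metric.mem_ball_self hε)
  refine ⟨B, q t, ?_, ?_⟩
  · rw [hq]
    exact div_ne_zero (mul_ne_zero (right_ne_zero_of_mul ht) (exp_ne_zero _)) htθ
  · have ha : AnalyticOnNhd ℂ (fun s => q t * exp (B * s) * theta ω s) Set.univ := fun z _ => by
      have : Differentiable ℂ (fun s => q t * exp (B * s) * theta ω s) := by fun_prop
      exact this.analyticAt z
    refine fun s => congrFun (hga.eq_of_eventuallyEq ha (z₀ := t) ?_) s
    filter_upwards [Metric.ball_mem_nhds t hε] with s hs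
    rw [← hconst s hs, hq]
    have h2 : theta ω s ≠ 0 := hball hs
    simp only
    rw [exp_neg]
    field_simp [exp_ne_zero]

/-- `θ` vanishes on the period lattice only. -/
lemma theta_ne_zero {ω : ℂ} (hω : 0 < ω.im) {z : ℂ} (hz : z ∉ periodLattice ω) :
    theta ω z ≠ 0 := by
  intro h0
  obtain ⟨B, C, hC, h⟩ := exists_theta_sub_eq_exp_mul hω h0
  obtain ⟨s, hs⟩ := exists_theta_ne_zero hω
  -- The quasi-periods are compared on both sides of θ(s - z) = C e^{Bs} θ(s): π forces B ∈ 2iℤ, and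
  -- πω forces e^{Bπω} = e^{2iz}. Together these put z in the lattice.
  have h1 : exp (B * Real.pi) = 1 := by
    have h2 := h (s + Real.pi)
    rw [add_sub_right_comm, theta_add_pi, theta_add_pi, h, mul_add, exp_add] at h2
    have h3 : C * exp (B * s) * theta ω s ≠ 0 := by simp [hC, hs, exp_ne_zero]
    refine mul_left_cancel₀ h3 ?_
    linear_combination h2
  have h2 : exp (B * (Real.pi * ω)) = exp (2 * I * z) := by
    have h2 := h (s + Real.pi * ω)
    rw [add_sub_right_comm, theta_add_pi_mul, theta_add_pi_mul, h, mul_add, exp_add] at h2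
    have h3 : C * exp (B * s) * theta ω s * exp (-(2 * I * s) - I * Real.pi * ω) ≠ 0 := by
      simp [hC, hs, exp_ne_zero]
    have h4 : exp (-(2 * I * (s - z)) - I * Real.pi * ω) =
        exp (2 * I * z) * exp (-(2 * I * s) - I * Real.pi * ω) := by
      rw [← exp_add]
      congr 1
      ring
    rw [h4] at h2
    refine mul_left_cancel₀ h3 ?_
    linear_combination h2
  obtain ⟨k, hk⟩ := exp_eq_one_iff.1 h1
  obtain ⟨m, hm⟩ := exp_eq_exp_iff_exists_int.1 h2
  have hpi : (Real.pi : ℂ) ≠ 0 := by exact_mod_cast Real.pi_ne_zero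
  have hB : B = k * (2 * I) := by
    refine mul_right_cancel₀ hpi ?_
    rw [hk]
    ring
  refine hz ⟨-m, k, ?_⟩
  rw [hB] at hm
  have h2I : (2 * I : ℂ) ≠ 0 := by simp
  refine mul_left_cancel₀ h2I ?_
  push_cast
  linear_combination -hm

/-! ### Theta functions of order `N` -/

/-- Theta functions of order `N` with norm `s`, given by their series. -/
def IsThetaFn (ω : ℂ) (N : ℕ) (s : ℂ) (f : ℂ → ℂ) : Prop :=
  ∃ c : ℤ → ℂ, (∀ m, c (m + N) = c m * exp (I * Real.pi * ω * (2 * m + 2 * N) - 2 * I * s)) ∧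
    ∀ u, (Summable fun m : ℤ => ‖c m * exp (2 * I * ((m : ℂ) + N / 2) * (u - Real.pi / 2))‖) ∧
      f u = ∑' m : ℤ, c m * exp (2 * I * ((m : ℂ) + N / 2) * (u - Real.pi / 2))

namespace IsThetaFn

variable {ω s : ℂ} {N : ℕ} {f g : ℂ → ℂ}

lemma one (ω : ℂ) : IsThetaFn ω 0 0 fun _ => 1 := by
  refine ⟨Pi.single 0 1, fun m => ?_, fun u => ⟨?_, ?_⟩⟩
  · rcases eq_or_ne m 0 with rfl | hm
    · simp
    · simp [hm]
  · refine summable_of_ne_finset_zero (s := {0}) fun m hm => ?_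
    have : m ≠ 0 := by simpa using hm
    simp [this]
  · rw [tsum_eq_single 0 fun m hm => by simp [hm]]
    simp

lemma zero (ω : ℂ) (N : ℕ) (s : ℂ) : IsThetaFn ω N s fun _ => 0 :=
  ⟨0, by simp, fun u => by simp⟩

lemma add (hf : IsThetaFn ω N s f) (hg : IsThetaFn ω N s g) :
    IsThetaFn ω N s fun u => f u + g u := by
  obtain ⟨c, hc, hc'⟩ := hf
  obtain ⟨d, hd, hd'⟩ := hg
  refine ⟨c + d, fun m => ?_, fun u => ⟨?_, ?_⟩⟩
  · simp only [Pi.add_apply, hc, hd, add_mul]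
  · simp only [Pi.add_apply, add_mul]
    exact Summable.of_nonneg_of_le (fun _ => norm_nonneg _) (fun _ => norm_add_le _ _)
      ((hc' u).1.add (hd' u).1)
  · simp only [Pi.add_apply, add_mul]
    rw [(hc' u).2, (hd' u).2, (hc' u).1.of_norm.tsum_add (hd' u).1.of_norm]

lemma const_mul (hf : IsThetaFn ω N s f) (a : ℂ) : IsThetaFn ω N s fun u => a * f u := by
  obtain ⟨c, hc, hc'⟩ := hf
  refine ⟨fun m => a * c m, fun m => ?_, fun u => ⟨?_, ?_⟩⟩
  · beta_reduce
    rw [hc]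
    ring
  · refine ((hc' u).1.mul_left ‖a‖).congr fun m => ?_
    beta_reduce
    rw [← norm_mul, ← mul_assoc a]
  · beta_reduce
    rw [(hc' u).2, ← tsum_mul_left]
    exact tsum_congr fun m => (mul_assoc _ _ _).symm

lemma sum {ι : Type*} (t : Finset ι) {F : ι → ℂ → ℂ} (h : ∀ i ∈ t, IsThetaFn ω N s (F i)) :
    IsThetaFn ω N s fun u => ∑ i ∈ t, F i u := by
  classical
  induction t using Finset.induction_on with
  | empty => simpa using zero ω N s
  | insert a t ha ih =>
    simp only [Finset.sum_insert ha]
    exact (h a (Finset.mem_insert_self _ _)).add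
      (ih fun i hi => h i (Finset.mem_insert_of_mem hi))

/-- The coefficients of the product are the convolution of those of f and of θ(u - x). Shifting the
index of f by N and that of θ by 1 shifts their sum by N + 1, so the two recursions multiply and the
norms add. -/
lemma mul_theta (hω : 0 < ω.im) (hf : IsThetaFn ω N s f) (x : ℂ) :
    IsThetaFn ω (N + 1) (s + x) fun u => f u * theta ω (u - x) := by
  obtain ⟨c, hc, hc'⟩ := hf
  set g : ℤ → ℂ := fun k => exp (I * Real.pi * ω * ((k : ℂ) + 1 / 2) ^ 2
    - 2 * I * ((k : ℂ) + 1 / 2) * x) with hg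
  have hg1 : ∀ k, g (k + 1) = g k * exp (I * Real.pi * ω * (2 * k + 2) - 2 * I * x) := by
    intro k
    simp only [hg, ← exp_add]
    congr 1
    push_cast
    ring
  have hgu : ∀ u (k : ℤ), g k * exp (2 * I * ((k : ℂ) + 1 / 2) * (u - Real.pi / 2)) =
      exp (I * Real.pi * ω * ((k : ℂ) + 1 / 2) ^ 2
        + 2 * I * ((k : ℂ) + 1 / 2) * (u - x - Real.pi / 2)) := by
    intro u k
    simp only [hg, ← exp_add]
    congr 1
    ring
  set e : ℤ × ℤ ≃ ℤ × ℤ := ⟨fun p => (p.1 - p.2, p.2), fun p => (p.1 + p.2, p.2),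
    fun p => by simp, fun p => by simp⟩ with he
  set T : ℂ → ℤ × ℤ → ℂ := fun u p => c (p.1 - p.2) * g p.2 *
    exp (2 * I * ((p.1 : ℂ) + (N + 1 : ℕ) / 2) * (u - Real.pi / 2)) with hT
  have hsg : ∀ u, Summable fun k : ℤ =>
      ‖g k * exp (2 * I * ((k : ℂ) + 1 / 2) * (u - Real.pi / 2))‖ := fun u => by
    simp only [hgu]
    exact summable_norm_theta_term hω _
  have hTe : ∀ u p, (c (e p).1 * exp (2 * I * (((e p).1 : ℂ) + N / 2) * (u - Real.pi / 2))) *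
      (g (e p).2 * exp (2 * I * (((e p).2 : ℂ) + 1 / 2) * (u - Real.pi / 2))) = T u p := by
    intro u p
    simp only [he, hT, Equiv.coe_fn_mk]
    rw [mul_mul_mul_comm, ← exp_add]
    congr 2
    push_cast
    ring
  have hTs : ∀ u, Summable fun p => ‖T u p‖ := fun u => by
    simp only [← hTe]
    exact e.summable_iff.2 ((hc' u).1.mul_norm (hsg u))
  have hTt : ∀ u m, ∑' k, T u (m, k) = (∑' k, c (m - k) * g k) *
      exp (2 * I * ((m : ℂ) + (N + 1 : ℕ) / 2) * (u - Real.pi / 2)) := fun u m => by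
    simp only [hT, tsum_mul_right]
  refine ⟨fun m => ∑' k, c (m - k) * g k, fun m => ?_, fun u => ⟨?_, ?_⟩⟩
  · beta_reduce
    rw [← (Equiv.addRight (1 : ℤ)).tsum_eq, ← tsum_mul_right]
    refine tsum_congr fun k => ?_
    have h1 : m + ((N + 1 : ℕ) : ℤ) - (k + 1) = m - k + N := by push_cast; ring
    simp only [Equiv.coe_addRight]
    rw [h1, hc, hg1, mul_mul_mul_comm, ← exp_add]
    congr 2
    push_cast
    ring
  · simp only [← hTt]
    have h2 := (hTs u).prod
    refine Summable.of_nonneg_of_le (fun _ => norm_nonneg _) (fun m => ?_) h2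
    exact norm_tsum_le_tsum_norm ((hTs u).prod_factor m)
  · simp only [← hTt]
    rw [← (hTs u).of_norm.tsum_prod, (hc' u).2]
    have h3 : theta ω (u - x) =
        ∑' k : ℤ, g k * exp (2 * I * ((k : ℂ) + 1 / 2) * (u - Real.pi / 2)) := by
      rw [theta_eq_tsum]
      exact tsum_congr fun k => (hgu u k).symm
    rw [h3, tsum_mul_tsum_of_summable_norm (hc' u).1 (hsg u), ← e.tsum_eq]
    exact tsum_congr fun p => hTe u p

/-- Multiplication by e^{2iu} shifts the coefficients by one. For y = 1 this turns the factor
e^{-iu} natural for 𝓑(u) into the factor e^{iu} natural for 𝓒(u). -/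
lemma exp_mul (hf : IsThetaFn ω N s f) :
    IsThetaFn ω N (s + Real.pi * ω) fun u => exp (2 * I * u) * f u := by
  obtain ⟨c, hc, hc'⟩ := hf
  have hterm : ∀ u (m : ℤ), exp (2 * I * u) *
      (c m * exp (2 * I * ((m : ℂ) + N / 2) * (u - Real.pi / 2))) =
      -c m * exp (2 * I * (((m + 1 : ℤ) : ℂ) + N / 2) * (u - Real.pi / 2)) := by
    intro u m
    have : 2 * I * (((m + 1 : ℤ) : ℂ) + N / 2) * (u - Real.pi / 2) =
      2 * I * u + 2 * I * ((m : ℂ) + N / 2) * (u - Real.pi / 2) - Real.pi * I := by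
      push_cast
      ring
    rw [this, exp_sub, exp_add, exp_pi_mul_I]
    ring
  refine ⟨fun m => -c (m - 1), fun m => ?_, fun u => ?_⟩
  · have h1 : m + (N : ℤ) - 1 = m - 1 + N := by ring
    beta_reduce
    rw [h1, hc, ← neg_mul]
    congr 2
    push_cast
    ring
  have h2 : (fun m : ℤ => -c (m - 1) * exp (2 * I * ((m : ℂ) + N / 2) * (u - Real.pi / 2))) ∘
      Equiv.addRight (1 : ℤ) = fun m => exp (2 * I * u) *
      (c m * exp (2 * I * ((m : ℂ) + N / 2) * (u - Real.pi / 2))) := by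
    funext m
    simp only [Function.comp, Equiv.coe_addRight, add_sub_cancel_right, hterm]
  constructor
  · rw [← (Equiv.addRight (1 : ℤ)).summable_iff]
    have h3 := (hc' u).1.mul_left ‖exp (2 * I * u)‖
    refine h3.congr fun m => ?_
    rw [← norm_mul, hterm]
    simp [Function.comp]
  · rw [← (Equiv.addRight (1 : ℤ)).tsum_eq]
    change _ = ∑' m, ((fun m : ℤ => -c (m - 1) *
      exp (2 * I * ((m : ℂ) + N / 2) * (u - Real.pi / 2))) ∘ Equiv.addRight (1 : ℤ)) m
    rw [h2, tsum_mul_left, ← (hc' u).2]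

/-- The norm enters the recursion only through e^{-2is}. -/
lemma shift_norm_pi (hf : IsThetaFn ω N s f) (k : ℤ) : IsThetaFn ω N (s + k * Real.pi) f := by
  obtain ⟨c, hc, hc'⟩ := hf
  refine ⟨c, fun m => ?_, hc'⟩
  rw [hc]
  congr 1
  rw [exp_eq_exp_iff_exists_int]
  exact ⟨k, by ring⟩

/-- Theta functions of order `N ≥ 1` are spanned by the functions `ϑ_j`. -/
lemma exists_eq_sum_vartheta [NeZero N] (hf : IsThetaFn ω N s f) :
    ∃ b : Fin N → ℂ, ∀ u, f u = ∑ j : Fin N, b j * vartheta N ω (j : ℕ) (u - s / N) := by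
  obtain ⟨c, hc, hc'⟩ := hf
  have hN : (N : ℂ) ≠ 0 := by exact_mod_cast NeZero.ne N
  -- An explicit nonvanishing solution of the recursion: c / e is N-periodic, so f is determined by
  -- one coefficient for each residue class modulo N.
  set e : ℤ → ℂ := fun m => exp (I * Real.pi * ω / N * ((m : ℂ) + N / 2) ^ 2
    - 2 * I * ((m : ℂ) + N / 2) * s / N) with he
  have he1 : ∀ m, e (m + N) = e m * exp (I * Real.pi * ω * (2 * m + 2 * N) - 2 * I * s) := by
    intro m
    simp only [he, ← exp_add]
    congr 1
    push_cast
    field_simp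
    ring
  have hper : ∀ m n : ℤ, c (m + n * N) * e m = c m * e (m + n * N) := by
    intro m n
    induction n using Int.induction_on with
    | zero => simp
    | succ n ih =>
      have h1 : m + ((n : ℤ) + 1) * N = m + n * N + N := by ring
      rw [h1, hc, he1]
      linear_combination ih * exp (I * Real.pi * ω * (2 * (m + n * N : ℤ) + 2 * N) - 2 * I * s)
    | pred n ih =>
      have h1 : m + -(n : ℤ) * N = m + (-(n : ℤ) - 1) * N + N := by ring
      rw [h1, hc, he1] at ih
      refine mul_right_cancel₀ (exp_ne_zero
        (I * Real.pi * ω * (2 * (m + (-(n : ℤ) - 1) * N : ℤ) + 2 * N) - 2 * I * s)) ?_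
      linear_combination ih
  refine ⟨fun j => c (-j) / e (-j), fun u => ?_⟩
  -- The frequencies of ϑ_j are N(n + 1/2 - j/N) = (-j + nN) + N/2, hence the negated Euclidean
  -- division, followed by the change of sign of the quotient.
  set E : ℤ × Fin N ≃ ℤ := (Int.divModEquiv N).symm.trans (Equiv.neg ℤ) with hE
  set T : ℤ → ℂ := fun m => c m * exp (2 * I * ((m : ℂ) + N / 2) * (u - Real.pi / 2)) with hT
  have hsum : Summable fun p => T (E p) := E.summable_iff.2 (hc' u).1.of_norm
  have hsum' := ((Equiv.prodComm _ _).summable_iff.2 hsum).tsum_prod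
  rw [(hc' u).2]
  change ∑' m, T m = _
  rw [← E.tsum_eq, ← (Equiv.prodComm _ _).tsum_eq]
  refine hsum'.trans ?_
  rw [tsum_fintype]
  refine Finset.sum_congr rfl fun j _ => ?_
  rw [vartheta, ← tsum_mul_left, ← (Equiv.neg ℤ).tsum_eq]
  refine tsum_congr fun n => ?_
  have hEp : E (Equiv.prodComm _ _ (j, Equiv.neg ℤ n)) = -(j : ℤ) + n * N := by
    simp [hE]
  have hej : e (-j) ≠ 0 := exp_ne_zero _
  change T (E (Equiv.prodComm _ _ (j, Equiv.neg ℤ n))) = _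
  have hv : exp (I * Real.pi * N * ω * ((n : ℂ) + 1 / 2 - ((j : ℕ) : ℂ) / N) ^ 2
      + 2 * I * N * ((n : ℂ) + 1 / 2 - ((j : ℕ) : ℂ) / N) * (u - s / N - Real.pi / 2)) =
      e (-(j : ℤ) + n * N) *
        exp (2 * I * (((-(j : ℤ) + n * N : ℤ) : ℂ) + N / 2) * (u - Real.pi / 2)) := by
    simp only [he, ← exp_add]
    congr 1
    push_cast
    field_simp
    ring
  rw [hEp, hv, hT, div_mul_eq_mul_div, eq_div_iff hej]
  linear_combination exp (2 * I * (((-(j : ℤ) + n * N : ℤ) : ℂ) + N / 2) * (u - Real.pi / 2)) *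
    hper (-(j : ℤ)) n

end IsThetaFn

/-! ### Dynamical six-vertex weights -/

/-- An odd function `th` and a function `ph` subject to the three-term identity, which are the
building blocks of the dynamical six-vertex weights with crossing parameter `η`. -/
structure Weights where
  th : ℂ → ℂ
  ph : ℂ → ℂ
  η : ℂ
  th_neg : ∀ z, th (-z) = -th z
  th_add : ∀ a b, th a = 0 → th b = 0 → th (a + b) = 0
  three_term : ∀ x y z w, ph (x + z) * ph (x - z) * (th (y + w) * th (y - w))
      - ph (x + w) * ph (x - w) * (th (y + z) * th (y - z))
      = ph (x + y) * ph (x - y) * (th (z + w) * th (z - w))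

namespace Weights

variable (D : Weights)

/-- The weight with outgoing auxiliary and quantum labels `i`, `z'` and incoming labels `j`, `z`. -/
def wt (u t : ℂ) : Fin 2 → Fin 2 → Fin 2 → Fin 2 → ℂ
  | 0, 0, 0, 0 => D.th (u + D.η)
  | 0, 1, 0, 1 => D.th u * D.ph (t + D.η) / D.ph t
  | 0, 1, 1, 0 => D.th D.η * D.ph (t + u) / D.ph t
  | 1, 0, 0, 1 => D.th D.η * D.ph (t - u) / D.ph t
  | 1, 0, 1, 0 => D.th u * D.ph (t - D.η) / D.ph t
  | 1, 1, 1, 1 => D.th (u + D.η)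
  | _, _, _, _ => 0

lemma wt_0000 (u t : ℂ) : D.wt u t 0 0 0 0 = D.th (u + D.η) := rfl

lemma wt_0001 (u t : ℂ) : D.wt u t 0 0 0 1 = 0 := rfl

lemma wt_0010 (u t : ℂ) : D.wt u t 0 0 1 0 = 0 := rfl

lemma wt_0011 (u t : ℂ) : D.wt u t 0 0 1 1 = 0 := rfl

lemma wt_0100 (u t : ℂ) : D.wt u t 0 1 0 0 = 0 := rfl

lemma wt_0101 (u t : ℂ) : D.wt u t 0 1 0 1 = D.th u * D.ph (t + D.η) / D.ph t := rfl

lemma wt_0110 (u t : ℂ) : D.wt u t 0 1 1 0 = D.th D.η * D.ph (t + u) / D.ph t := rfl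

lemma wt_0111 (u t : ℂ) : D.wt u t 0 1 1 1 = 0 := rfl

lemma wt_1000 (u t : ℂ) : D.wt u t 1 0 0 0 = 0 := rfl

lemma wt_1001 (u t : ℂ) : D.wt u t 1 0 0 1 = D.th D.η * D.ph (t - u) / D.ph t := rfl

lemma wt_1010 (u t : ℂ) : D.wt u t 1 0 1 0 = D.th u * D.ph (t - D.η) / D.ph t := rfl

lemma wt_1011 (u t : ℂ) : D.wt u t 1 0 1 1 = 0 := rfl

lemma wt_1100 (u t : ℂ) : D.wt u t 1 1 0 0 = 0 := rfl

lemma wt_1101 (u t : ℂ) : D.wt u t 1 1 0 1 = 0 := rfl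

lemma wt_1110 (u t : ℂ) : D.wt u t 1 1 1 0 = 0 := rfl

lemma wt_1111 (u t : ℂ) : D.wt u t 1 1 1 1 = D.th (u + D.η) := rfl

/-- The product of two weights along a quantum line. -/
def wt₂ (u v t : ℂ) (i i' z'' k k' z : Fin 2) : ℂ :=
  ∑ z', D.wt u t i z'' k z' * D.wt v (t + D.η * spin k) i' z' k' z

lemma spin_zero : spin 0 = 1 := rfl

lemma spin_one : spin 1 = -1 := rfl

lemma th_zero : D.th 0 = 0 := by
  have := D.th_neg 0
  rw [neg_zero] at this
  exact self_eq_neg.mp this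

/-- The three-term identity in terms of the arguments of the factors. -/
lemma three_term' (A A' B B' C C' p p' q q' r r' : ℂ) (hB : A + A' = B + B' := by ring)
    (hC : A + A' = C + C' := by ring) (hp : p = C - B' := by ring) (hp' : p' = C - B := by ring)
    (hq : q = C - A' := by ring) (hq' : q' = C - A := by ring) (hr : r = A - B' := by ring)
    (hr' : r' = A - B := by ring) :
    D.ph A * D.ph A' * (D.th p * D.th p') - D.ph B * D.ph B' * (D.th q * D.th q') =
      D.ph C * D.ph C' * (D.th r * D.th r') := by
  have key := D.three_term ((A + A') / 2) ((C - C') / 2) ((A - A') / 2) ((B - B') / 2)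
  have e1 : (A + A') / 2 + (A - A') / 2 = A := by ring
  have e2 : (A + A') / 2 - (A - A') / 2 = A' := by ring
  have e3 : (A + A') / 2 + (B - B') / 2 = B := by linear_combination hB / 2
  have e4 : (A + A') / 2 - (B - B') / 2 = B' := by linear_combination hB / 2
  have e5 : (A + A') / 2 + (C - C') / 2 = C := by linear_combination hC / 2
  have e6 : (A + A') / 2 - (C - C') / 2 = C' := by linear_combination hC / 2
  have e7 : (C - C') / 2 + (B - B') / 2 = p := by linear_combination hC / 2 - hp - hB / 2
  have e8 : (C - C') / 2 - (B - B') / 2 = p' := by linear_combination hC / 2 - hp' - hB / 2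
  have e9 : (C - C') / 2 + (A - A') / 2 = q := by linear_combination hC / 2 - hq
  have e10 : (C - C') / 2 - (A - A') / 2 = q' := by linear_combination hC / 2 - hq'
  have e11 : (A - A') / 2 + (B - B') / 2 = r := by linear_combination -hB / 2 - hr
  have e12 : (A - A') / 2 - (B - B') / 2 = r' := by linear_combination -hB / 2 - hr'
  rw [e1, e2, e3, e4, e5, e6, e7, e8, e9, e10, e11, e12] at key
  exact key

/-- The three-term identity with all differences reversed. -/
lemma three_term_rev (A A' B B' C C' p p' q q' r r' : ℂ) (hB : A + A' = B + B' := by ring)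
    (hC : A + A' = C + C' := by ring) (hp : p = B' - C := by ring) (hp' : p' = B - C := by ring)
    (hq : q = A' - C := by ring) (hq' : q' = A - C := by ring) (hr : r = B' - A := by ring)
    (hr' : r' = B - A := by ring) :
    D.ph A * D.ph A' * (D.th p * D.th p') - D.ph B * D.ph B' * (D.th q * D.th q') =
      D.ph C * D.ph C' * (D.th r * D.th r') := by
  have key := D.three_term' A A' B B' C C' (-p) (-p') (-q) (-q') (-r) (-r') hB hC
    (by rw [hp]; ring) (by rw [hp']; ring) (by rw [hq]; ring) (by rw [hq']; ring)
    (by rw [hr]; ring) (by rw [hr']; ring)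
  simp only [D.th_neg, neg_mul_neg] at key
  exact key

/-- This relation is not a single three-term identity. Once multiplied by th v it is a combination
of four of them; the extra factor is then cancelled. -/
lemma four_term_aux (v w t : ℂ) (hv : D.th v ≠ 0) :
    D.th w * D.th (v + w + D.η) * D.th v * D.ph (t + D.η + D.η) * D.ph t ^ 3 +
        D.th D.η ^ 3 * D.ph (t + D.η + w) * D.ph (t - (v + w)) * D.ph (t + D.η + v) * D.ph t =
      D.th v * D.th w * D.th (v + w + D.η) * D.ph (t - D.η) * D.ph (t + D.η) ^ 3 +
        D.th D.η ^ 3 * D.ph (t - v) * D.ph (t + D.η + (v + w)) * D.ph (t - w) *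
          D.ph (t + D.η) := by
  refine mul_left_cancel₀ hv ?_
  have h1 := D.three_term' (t + D.η) (t - v) t (t + D.η - v) (t + D.η + w) (t - (v + w))
    (v + w) (w + D.η) (v + w + D.η) w v D.η
  have h2 := D.three_term' (t + D.η + v) t (t + D.η) (t + v) (t + D.η + (v + w)) (t - w)
    (w + D.η) (v + w) (v + w + D.η) w D.η v
  have h3 := D.three_term' (t + D.η + D.η) t (t + D.η + v) (t + D.η - v) (t + D.η) (t + D.η)
    v (-v) D.η (-D.η) (D.η + v) (D.η - v)
  have h4 := D.three_term' (t + D.η) (t - D.η) (t + v) (t - v) t t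
    v (-v) D.η (-D.η) (D.η + v) (D.η - v)
  simp only [D.th_neg] at h3 h4
  linear_combination -D.th D.η ^ 2 * D.ph (t + D.η + v) * D.ph t * h1
    + D.th D.η ^ 2 * D.ph (t - v) * D.ph (t + D.η) * h2
    - D.th w * D.th (v + w + D.η) * D.ph t ^ 2 * h3
    + D.th w * D.th (v + w + D.η) * D.ph (t + D.η) ^ 2 * h4

/-- The relation is symmetric in v and w, so either th v or th w may be the cancelled factor. If
both vanish, th (v + w + η) plays that role; if this vanishes as well, then so does th η, by
`th_add`, and every term is zero. -/
lemma four_term (v w t : ℂ) :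
    D.th w * D.th (v + w + D.η) * D.th v * D.ph (t + D.η + D.η) * D.ph t ^ 3 +
        D.th D.η ^ 3 * D.ph (t + D.η + w) * D.ph (t - (v + w)) * D.ph (t + D.η + v) * D.ph t =
      D.th v * D.th w * D.th (v + w + D.η) * D.ph (t - D.η) * D.ph (t + D.η) ^ 3 +
        D.th D.η ^ 3 * D.ph (t - v) * D.ph (t + D.η + (v + w)) * D.ph (t - w) *
          D.ph (t + D.η) := by
  by_cases hv : D.th v = 0
  swap
  · exact D.four_term_aux v w t hv
  by_cases hw : D.th w = 0
  swap
  · have := D.four_term_aux w v t hw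
    rw [add_comm w v] at this
    linear_combination this
  by_cases hu : D.th (v + w + D.η) = 0
  · have hη : D.th D.η = 0 := by
      have := D.th_add _ _ hu (by rw [D.th_neg, D.th_add v w hv hw, neg_zero] : D.th (-(v + w)) = 0)
      rwa [show v + w + D.η + -(v + w) = D.η by ring] at this
    rw [hv, hw, hη]
    ring
  refine mul_left_cancel₀ hu ?_
  have h1 := D.three_term' (t + D.η + (v + w)) (t + D.η) (t + D.η + v) (t + D.η + w)
    (t + D.η + D.η + (v + w)) t (v + D.η) (w + D.η) (v + w + D.η) D.η v w
  have h2 := D.three_term_rev (t - (v + w)) t (t - v) (t - w)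
    (t - D.η - (v + w)) (t + D.η) (v + D.η) (w + D.η) (v + w + D.η) D.η v w
  rw [hv, hw] at h1 h2 ⊢
  linear_combination -D.th D.η ^ 2 * D.ph (t - (v + w)) * D.ph t * h1
    + D.th D.η ^ 2 * D.ph (t + D.η + (v + w)) * D.ph (t + D.η) * h2

lemma four_term_heights {u v w s t : ℂ} (hu : u = v + w) (hs : s = t + D.η) :
    D.th w * D.th (u + D.η) * D.th v * D.ph (s + D.η) * D.ph t ^ 3 +
        D.th D.η ^ 3 * D.ph (s + w) * D.ph (t - u) * D.ph (s + v) * D.ph t =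
      D.th v * D.th w * D.th (u + D.η) * D.ph (t - D.η) * D.ph s ^ 3 +
        D.th D.η ^ 3 * D.ph (t - v) * D.ph (s + u) * D.ph (t - w) * D.ph s := by
  subst hu hs
  exact D.four_term v w t

/-- The dynamical Yang-Baxter equation. -/
lemma yang_baxter (u v t : ℂ) (h0 : D.ph t ≠ 0) (h1 : D.ph (t + D.η) ≠ 0)
    (h2 : D.ph (t - D.η) ≠ 0) : ∀ i i' z'' m m' z : Fin 2,
    ∑ k, ∑ l, D.wt (u - v) (t + D.η * spin z'') i i' k l * D.wt₂ u v t k l z'' m m' z =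
      ∑ k, ∑ l, D.wt₂ v u t i' i z'' l k z * D.wt (u - v) t k l m m' := by
  simp only [Fin.forall_fin_two, Fin.sum_univ_two]
  -- Of the 64 components, the 20 that conserve spin remain. Those that are not immediate are
  -- three-term identities divided by values of ph, except for two which need the four-term
  -- identity.
  constructorm* _ ∧ _ <;>
    simp only [wt₂, Fin.sum_univ_two, wt_0000, wt_0001, wt_0010, wt_0011, wt_0100,
      wt_0101, wt_0110, wt_0111, wt_1000, wt_1001, wt_1010, wt_1011, wt_1100, wt_1101, wt_1110, wt_1111,
      spin_zero, spin_one, mul_zero, zero_mul, add_zero,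
      zero_add, Int.cast_one, Int.cast_neg, mul_one, mul_neg, ← sub_eq_add_neg]
  · ring
  · field_simp
  · linear_combination (norm := (field_simp; ring_nf)) D.th D.η / D.ph t ^ 2 *
      D.three_term' (t + D.η + v) t (t + D.η) (t + v) (t + D.η + u) (t - (u - v)) (u - v + D.η) u (u + D.η) (u - v) D.η v
  · linear_combination (norm := (field_simp; ring_nf)) D.th D.η / D.ph t ^ 2 *
      D.three_term' (t + u) t (t + v) (t + (u - v)) (t + D.η + u) (t - D.η) (v + D.η) (u - v + D.η) (u + D.η) D.η v (u - v)
  · linear_combination (norm := (field_simp; ring_nf)) -(D.th D.η * D.ph (t + D.η + D.η) / (D.ph (t + D.η) ^ 2 * D.ph t)) *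
      D.three_term' (t + D.η) (t - v) t (t + D.η - v) (t + D.η + (u - v)) (t - u) u (u - v + D.η) (u + D.η) (u - v) v D.η
  · linear_combination (norm := (field_simp; ring_nf)) 1 / (D.ph (t + D.η) ^ 2 * D.ph t ^ 2) *
      D.four_term_heights (t := t) (show u = v + (u - v) by ring) rfl
  · linear_combination (norm := (field_simp; ring_nf)) D.th D.η * D.ph (t - D.η) / (D.ph t ^ 2 * D.ph (t + D.η)) *
      D.three_term' (t + D.η + (u - v)) t (t + D.η) (t + (u - v)) (t + D.η + u) (t - v) (v + D.η) u (u + D.η) v D.η (u - v)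
  · field_simp
  · linear_combination (norm := (field_simp; ring_nf)) -(D.th D.η / D.ph (t - D.η) ^ 2) *
      D.three_term' (t + (u - v)) (t - D.η) t (t - D.η + (u - v)) (t + u) (t - D.η - v) (v + D.η) u (u + D.η) v D.η (u - v)
  · linear_combination (norm := (field_simp; ring_nf)) -(D.th D.η / D.ph (t - D.η) ^ 2) *
      D.three_term' (t - D.η + u) (t - D.η) (t - D.η + v) (t - D.η + (u - v)) (t + u) (t - D.η - D.η) (v + D.η) (u - v + D.η) (u + D.η) D.η v (u - v)
  · linear_combination (norm := (field_simp; ring_nf)) -(D.th D.η / D.ph (t + D.η) ^ 2) *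
      D.three_term_rev (t + D.η - u) (t + D.η) (t + D.η - v) (t + D.η - (u - v)) (t - u) (t + D.η + D.η) (v + D.η) (u - v + D.η) (u + D.η) D.η v (u - v)
  · linear_combination (norm := (field_simp; ring_nf)) -(D.th D.η / D.ph (t + D.η) ^ 2) *
      D.three_term_rev (t - (u - v)) (t + D.η) t (t + D.η - (u - v)) (t - u) (t + D.η + v) (v + D.η) u (u + D.η) v D.η (u - v)
  · field_simp
  · linear_combination (norm := (field_simp; ring_nf)) D.th D.η * D.ph (t + D.η) / (D.ph t ^ 2 * D.ph (t - D.η)) *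
      D.three_term_rev (t - D.η - (u - v)) t (t - D.η) (t - (u - v)) (t - D.η - u) (t + v) (v + D.η) u (u + D.η) v D.η (u - v)
  · linear_combination (norm := (field_simp; ring_nf)) -(1 / (D.ph t ^ 2 * D.ph (t - D.η) ^ 2)) *
      D.four_term_heights (show u = v + (u - v) by ring) (show t = t - D.η + D.η by ring)
  · linear_combination (norm := (field_simp; ring_nf)) -(D.th D.η * D.ph (t - D.η - D.η) / (D.ph (t - D.η) ^ 2 * D.ph t)) *
      D.three_term' (t + v) (t - D.η) t (t - D.η + v) (t + u) (t - D.η - (u - v)) (u - v + D.η) u (u + D.η) (u - v) D.η v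
  · linear_combination (norm := (field_simp; ring_nf)) D.th D.η / D.ph t ^ 2 *
      D.three_term_rev (t - u) t (t - v) (t - (u - v)) (t - D.η - u) (t + D.η) (v + D.η) (u - v + D.η) (u + D.η) D.η v (u - v)
  · linear_combination (norm := (field_simp; ring_nf)) D.th D.η / D.ph t ^ 2 *
      D.three_term_rev (t - D.η - v) t (t - D.η) (t - v) (t - D.η - u) (t + (u - v)) (u - v + D.η) u (u + D.η) (u - v) D.η v
  · field_simp
  · ring

end Weights

namespace Weights

variable (D : Weights)

/-! ### The chain -/

/-- The antisymmetric tensor on `ℂ² ⊗ ℂ²`. -/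
def eps (i i' : Fin 2) : ℂ := ((i' : ℕ) : ℂ) - ((i : ℕ) : ℂ)

/-- The dynamical parameter `t` is regular: no height on `t + η ℤ` is singular. -/
def Reg (t : ℂ) : Prop := ∀ k : ℤ, D.ph (t + D.η * k) ≠ 0

variable {D}

lemma Reg.add {t : ℂ} (ht : D.Reg t) (m : ℤ) : D.Reg (t + D.η * m) := fun k => by
  have := ht (m + k)
  push_cast at this
  rwa [mul_add, ← add_assoc] at this

lemma Reg.ne_zero {t : ℂ} (ht : D.Reg t) : D.ph t ≠ 0 := by simpa using ht 0

lemma Reg.add_eta_ne_zero {t : ℂ} (ht : D.Reg t) : D.ph (t + D.η) ≠ 0 := by simpa using ht 1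

lemma Reg.sub_eta_ne_zero {t : ℂ} (ht : D.Reg t) : D.ph (t - D.η) ≠ 0 := by
  simpa [sub_eq_add_neg] using ht (-1)

variable (D)

lemma wt_conserved {u t : ℂ} : ∀ {i z' j z : Fin 2}, D.wt u t i z' j z ≠ 0 →
    spin i + spin z' = spin j + spin z := by
  simp only [Fin.forall_fin_two, wt_0000, wt_0001, wt_0010, wt_0011, wt_0100, wt_0101, wt_0110,
    wt_0111, wt_1000, wt_1001, wt_1010, wt_1011, wt_1100, wt_1101, wt_1110, wt_1111, spin_zero,
    spin_one]
  norm_num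

/-- The local pair of weights at spectral parameters `u`, `u - η` preserves the singlet. -/
lemma wt₂_singlet (u t : ℂ) (ht : D.Reg t) : ∀ i i' z' z : Fin 2,
    D.wt₂ u (u - D.η) t i i' z' 0 1 z - D.wt₂ u (u - D.η) t i i' z' 1 0 z =
      eps i i' * (if z' = z then D.th (u + D.η) * D.th (u - D.η) *
        (D.ph t / D.ph (t + D.η * spin z)) else 0) := by
  have h0 := ht.ne_zero
  have h1 := ht.add_eta_ne_zero
  have h2 := ht.sub_eta_ne_zero
  simp only [Fin.forall_fin_two]
  constructorm* _ ∧ _ <;>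
    simp only [wt₂, Fin.sum_univ_two, wt_0000, wt_0001, wt_0010, wt_0011, wt_0100, wt_0101,
      wt_0110, wt_0111, wt_1000, wt_1001, wt_1010, wt_1011, wt_1100, wt_1101, wt_1110, wt_1111,
      spin_zero, spin_one, mul_zero, zero_mul, add_zero, zero_add, Int.cast_one, Int.cast_neg,
      mul_one, mul_neg, ← sub_eq_add_neg, eps, sub_add_cancel, sub_self, zero_ne_one, one_ne_zero,
      if_true, if_false, Fin.val_zero, Fin.val_one, Nat.cast_zero, Nat.cast_one, sub_zero,
      zero_sub, one_mul, add_sub_cancel_right]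
  · rw [show t + D.η + (u - D.η) = t + u by ring]
    field_simp
    ring
  · ring
  · have key := D.three_term' (t + D.η) (t - D.η) (t + u) (t - u) t t u (-u) D.η (-D.η) (u + D.η)
      (-(u - D.η))
    simp only [D.th_neg] at key
    rw [show t - D.η - (u - D.η) = t - u by ring]
    linear_combination (norm := (field_simp; ring_nf)) -(1 / (D.ph t * D.ph (t - D.η))) * key
  · have key := D.three_term' (t + D.η) (t - D.η) (t + u) (t - u) t t u (-u) D.η (-D.η) (u + D.η)
      (-(u - D.η))
    simp only [D.th_neg] at key
    rw [show t + D.η + (u - D.η) = t + u by ring]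
    linear_combination (norm := (field_simp; ring_nf)) (1 / (D.ph t * D.ph (t + D.η))) * key
  · ring
  · rw [show t - D.η - (u - D.η) = t - u by ring]
    field_simp
    ring

/-- The local pair of weights at spectral parameters `0`, `-η` creates the singlet. -/
lemma wt₂_creation (t : ℂ) (ht : D.Reg t) : ∀ i i' z' k k' z : Fin 2,
    D.wt₂ 0 (-D.η) t i i' z' k k' z = eps i i' * D.wt₂ 0 (-D.η) t 0 1 z' k k' z := by
  have h0 := ht.ne_zero
  have h1 := ht.add_eta_ne_zero
  have h2 := ht.sub_eta_ne_zero
  have e1 : t + D.η + -D.η = t := by ring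
  have e2 : t - D.η - -D.η = t := by ring
  simp only [Fin.forall_fin_two]
  constructorm* _ ∧ _ <;>
    simp only [wt₂, Fin.sum_univ_two, wt_0000, wt_0001, wt_0010, wt_0011, wt_0100, wt_0101,
      wt_0110, wt_0111, wt_1000, wt_1001, wt_1010, wt_1011, wt_1100, wt_1101, wt_1110, wt_1111,
      spin_zero, spin_one, mul_zero, zero_mul, add_zero, zero_add, Int.cast_one, Int.cast_neg,
      mul_one, mul_neg, ← sub_eq_add_neg, eps, sub_self, Fin.val_zero, Fin.val_one,
      Nat.cast_zero, Nat.cast_one, sub_zero, zero_sub, one_mul, D.th_zero, D.th_neg,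
      neg_add_cancel, e1, e2, zero_div, neg_mul]
  all_goals field_simp
  all_goals ring_nf

variable (xs : ℕ → ℂ)

/-- The matrix elements of the monodromy matrix of the chain with the first `n` inhomogeneities in
the sequence `xs`. -/
def chain (u t : ℂ) : (n : ℕ) → Fin 2 → Fin 2 → (Fin n → Fin 2) → (Fin n → Fin 2) → ℂ
  | 0, i, j, _, _ => if i = j then 1 else 0
  | n + 1, i, j, h', h => ∑ k, D.wt (u - xs n) (t + D.η * totalSpin (Fin.init h')) i
      (h' (Fin.last n)) k (h (Fin.last n)) * chain u t n k j (Fin.init h') (Fin.init h)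

lemma chain_zero (u t : ℂ) (i j : Fin 2) (h' h : Fin 0 → Fin 2) :
    D.chain xs u t 0 i j h' h = if i = j then 1 else 0 := rfl

lemma chain_succ (u t : ℂ) (n : ℕ) (i j : Fin 2) (h' h : Fin (n + 1) → Fin 2) :
    D.chain xs u t (n + 1) i j h' h =
      ∑ k, D.wt (u - xs n) (t + D.η * totalSpin (Fin.init h')) i (h' (Fin.last n)) k
        (h (Fin.last n)) * D.chain xs u t n k j (Fin.init h') (Fin.init h) := rfl

lemma totalSpin_init {n : ℕ} (h : Fin (n + 1) → Fin 2) :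
    totalSpin h = totalSpin (Fin.init h) + spin (h (Fin.last n)) :=
  Fin.sum_univ_castSucc _

lemma totalSpin_cons {n : ℕ} (l : Fin 2) (g : Fin n → Fin 2) :
    totalSpin (Fin.cons l g : Fin (n + 1) → Fin 2) = spin l + totalSpin g := by
  simp [totalSpin, Fin.sum_univ_succ]

lemma chain_conserved {u t : ℂ} : ∀ {n : ℕ} {i j : Fin 2} {h' h : Fin n → Fin 2},
    D.chain xs u t n i j h' h ≠ 0 → spin i + totalSpin h' = spin j + totalSpin h
  | 0, i, j, h', h, hne => by
    rw [chain_zero] at hne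
    have hij : i = j := by
      by_contra hij
      exact hne (if_neg hij)
    rw [hij, Subsingleton.elim h' h]
  | n + 1, i, j, h', h, hne => by
    rw [chain_succ] at hne
    obtain ⟨k, -, hk⟩ := Finset.exists_ne_zero_of_sum_ne_zero hne
    have h1 := D.wt_conserved (left_ne_zero_of_mul hk)
    have h2 := chain_conserved (right_ne_zero_of_mul hk)
    rw [totalSpin_init h', totalSpin_init h]
    omega

/-- The matrix elements of the product of two entries of the monodromy matrix. -/
def chain₂ (u v t : ℂ) (n : ℕ) (i i' j j' : Fin 2) (h'' h : Fin n → Fin 2) : ℂ :=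
  ∑ h', D.chain xs u t n i j h'' h' * D.chain xs v (t + D.η * spin j) n i' j' h' h

lemma sum_snoc {M : Type*} [AddCommMonoid M] {n : ℕ} (f : (Fin (n + 1) → Fin 2) → M) :
    ∑ h, f h = ∑ z, ∑ g : Fin n → Fin 2, f (Fin.snoc g z) := by
  rw [← (Fin.snocEquiv fun _ : Fin (n + 1) => Fin 2).sum_comp f, Fintype.sum_prod_type]
  rfl

lemma sum_cons {M : Type*} [AddCommMonoid M] {n : ℕ} (f : (Fin (n + 1) → Fin 2) → M) :
    ∑ h, f h = ∑ z, ∑ g : Fin n → Fin 2, f (Fin.cons z g) := by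
  rw [← (Fin.consEquiv fun _ : Fin (n + 1) => Fin 2).sum_comp f, Fintype.sum_prod_type]
  rfl

lemma chain₂_zero (u v t : ℂ) (i i' j j' : Fin 2) (h'' h : Fin 0 → Fin 2) :
    D.chain₂ xs u v t 0 i i' j j' h'' h = if i = j ∧ i' = j' then 1 else 0 := by
  rw [chain₂, Fintype.sum_unique, chain_zero, chain_zero, ite_and]
  split_ifs <;> simp

/-- By spin conservation, the parameter of the second line at the last site equals the one of the
first line plus η times the spin on the auxiliary link, as `wt₂` requires. A product of two
monodromy entries is thus a chain of local pairs. -/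
lemma chain₂_succ (u v t : ℂ) (n : ℕ) (i i' j j' : Fin 2) (h'' h : Fin (n + 1) → Fin 2) :
    D.chain₂ xs u v t (n + 1) i i' j j' h'' h =
      ∑ k, ∑ k', D.wt₂ (u - xs n) (v - xs n) (t + D.η * totalSpin (Fin.init h'')) i i'
        (h'' (Fin.last n)) k k' (h (Fin.last n)) *
          D.chain₂ xs u v t n k k' j j' (Fin.init h'') (Fin.init h) := by
  have key : ∀ (z' : Fin 2) (g' : Fin n → Fin 2) (k k' : Fin 2),
      D.wt (u - xs n) (t + D.η * totalSpin (Fin.init h'')) i (h'' (Fin.last n)) k z' *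
        D.chain xs u t n k j (Fin.init h'') g' *
      (D.wt (v - xs n) (t + D.η * spin j + D.η * totalSpin g') i' z' k' (h (Fin.last n)) *
        D.chain xs v (t + D.η * spin j) n k' j' g' (Fin.init h)) =
      D.wt (u - xs n) (t + D.η * totalSpin (Fin.init h'')) i (h'' (Fin.last n)) k z' *
        D.wt (v - xs n) (t + D.η * totalSpin (Fin.init h'') + D.η * spin k) i' z' k'
          (h (Fin.last n)) *
      (D.chain xs u t n k j (Fin.init h'') g' *
        D.chain xs v (t + D.η * spin j) n k' j' g' (Fin.init h)) := by
    intro z' g' k k'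
    by_cases hne : D.chain xs u t n k j (Fin.init h'') g' = 0
    · rw [hne]
      ring
    have hc := D.chain_conserved xs hne
    have : (spin k : ℂ) + totalSpin (Fin.init h'') = spin j + totalSpin g' := by exact_mod_cast hc
    rw [show t + D.η * spin j + D.η * totalSpin g' =
      t + D.η * totalSpin (Fin.init h'') + D.η * spin k by linear_combination -D.η * this]
    ring
  rw [chain₂, sum_snoc]
  simp only [chain_succ, Fin.init_snoc, Fin.snoc_last, chain₂, wt₂,
    Fin.sum_univ_two, Finset.mul_sum, ← Finset.sum_add_distrib]
  refine Finset.sum_congr rfl fun g _ => ?_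
  linear_combination key 0 g 0 0 + key 0 g 0 1 + key 0 g 1 0 + key 0 g 1 1 + key 1 g 0 0 +
    key 1 g 0 1 + key 1 g 1 0 + key 1 g 1 1

/-- The exchange relation of the monodromy matrix. -/
lemma chain₂_exchange (u v t : ℂ) (ht : D.Reg t) : ∀ (n : ℕ) (i i' j j' : Fin 2)
    (h'' h : Fin n → Fin 2),
    ∑ k, ∑ l, D.wt (u - v) (t + D.η * totalSpin h'') i i' k l *
        D.chain₂ xs u v t n k l j j' h'' h =
      ∑ k, ∑ l, D.chain₂ xs v u t n i' i l k h'' h * D.wt (u - v) t k l j j'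
  | 0, i, i', j, j', h'', h => by
    have : totalSpin h'' = 0 := by simp [totalSpin]
    simp only [chain₂_zero, this, Int.cast_zero, mul_zero, add_zero]
    revert i i' j j'
    simp only [Fin.forall_fin_two, Fin.sum_univ_two]
    simp
  | n + 1, i, i', j, j', h'', h => by
    have hr := ht.add (totalSpin (Fin.init h''))
    have Y := D.yang_baxter (u - xs n) (v - xs n) _ hr.ne_zero hr.add_eta_ne_zero
      hr.sub_eta_ne_zero i i' (h'' (Fin.last n))
    have IH := fun i i' => chain₂_exchange u v t ht n i i' j j' (Fin.init h'') (Fin.init h)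
    rw [totalSpin_init h'', Int.cast_add, mul_add, ← add_assoc]
    simp only [chain₂_succ, Fin.sum_univ_two, sub_sub_sub_cancel_right] at Y IH ⊢
    set z := h (Fin.last n)
    set z'' := h'' (Fin.last n)
    -- The R-matrix is moved through the last site by the Yang-Baxter equation `Y`, then through the
    -- remaining sites by induction.
    linear_combination D.chain₂ xs u v t n 0 0 j j' (Fin.init h'') (Fin.init h) * Y 0 0 z +
      D.chain₂ xs u v t n 0 1 j j' (Fin.init h'') (Fin.init h) * Y 0 1 z +
      D.chain₂ xs u v t n 1 0 j j' (Fin.init h'') (Fin.init h) * Y 1 0 z +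
      D.chain₂ xs u v t n 1 1 j j' (Fin.init h'') (Fin.init h) * Y 1 1 z +
      D.wt₂ (v - xs n) (u - xs n) (t + D.η * totalSpin (Fin.init h'')) i' i z'' 0 0 z * IH 0 0 +
      D.wt₂ (v - xs n) (u - xs n) (t + D.η * totalSpin (Fin.init h'')) i' i z'' 1 0 z * IH 0 1 +
      D.wt₂ (v - xs n) (u - xs n) (t + D.η * totalSpin (Fin.init h'')) i' i z'' 0 1 z * IH 1 0 +
      D.wt₂ (v - xs n) (u - xs n) (t + D.η * totalSpin (Fin.init h'')) i' i z'' 1 1 z * IH 1 1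

lemma eps_self (i : Fin 2) : eps i i = 0 := sub_self _

lemma eps_zero_one : eps 0 1 = 1 := by simp [eps]

lemma eps_one_zero : eps 1 0 = -1 := by simp [eps]

/-- The quantum determinant of the chain. -/
lemma chain₂_singlet (u t : ℂ) (ht : D.Reg t) : ∀ (n : ℕ) (i i' : Fin 2) (h'' h : Fin n → Fin 2),
    D.chain₂ xs u (u - D.η) t n i i' 0 1 h'' h - D.chain₂ xs u (u - D.η) t n i i' 1 0 h'' h =
      eps i i' * (if h'' = h then (∏ m : Fin n, D.th (u - xs m + D.η) * D.th (u - xs m - D.η)) *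
        (D.ph t / D.ph (t + D.η * totalSpin h)) else 0)
  | 0, i, i', h'', h => by
    have : totalSpin h = 0 := by simp [totalSpin]
    rw [if_pos (Subsingleton.elim _ _), this]
    simp only [chain₂_zero, Int.cast_zero, mul_zero, add_zero, div_self ht.ne_zero]
    revert i i'
    simp only [Fin.forall_fin_two]
    simp [eps]
  | n + 1, i, i', h'', h => by
    have hr := ht.add (totalSpin (Fin.init h''))
    have Y := D.wt₂_singlet (u - xs n) _ hr i i' (h'' (Fin.last n)) (h (Fin.last n))
    have IH := fun i i' => chain₂_singlet u t ht n i i' (Fin.init h'') (Fin.init h)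
    have hsp : (∏ m : Fin (n + 1), D.th (u - xs m + D.η) * D.th (u - xs m - D.η)) =
        (∏ m : Fin n, D.th (u - xs m + D.η) * D.th (u - xs m - D.η)) *
          (D.th (u - xs n + D.η) * D.th (u - xs n - D.η)) := by
      rw [Fin.prod_univ_castSucc]
      rfl
    have hh : h'' = h ↔ Fin.init h'' = Fin.init h ∧ h'' (Fin.last n) = h (Fin.last n) := by
      refine ⟨fun e => by rw [e]; exact ⟨rfl, rfl⟩, fun ⟨e1, e2⟩ => ?_⟩
      rw [← Fin.snoc_init_self h'', ← Fin.snoc_init_self h, e1, e2]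
    rw [hsp, totalSpin_init h, Int.cast_add, mul_add, ← add_assoc, if_congr hh rfl rfl]
    simp only [chain₂_succ, Fin.sum_univ_two, show u - D.η - xs n = u - xs n - D.η by ring]
    set z := h (Fin.last n)
    set z'' := h'' (Fin.last n)
    set τ := t + D.η * totalSpin (Fin.init h'') with hτ
    have I00 := IH 0 0
    have I01 := IH 0 1
    have I10 := IH 1 0
    have I11 := IH 1 1
    rw [eps_self] at I00 I11
    rw [eps_zero_one] at I01
    rw [eps_one_zero] at I10
    have main : D.wt₂ (u - xs n) (u - xs n - D.η) τ i i' z'' 0 1 z -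
        D.wt₂ (u - xs n) (u - xs n - D.η) τ i i' z'' 1 0 z = _ := Y
    rw [ite_and]
    split_ifs with e1 e2
    -- On equal configurations the ratio of ph values from the last site telescopes with the ratio
    -- from the first n sites.
    · rw [if_pos e1] at I00 I01 I10 I11
      rw [if_pos e2] at main
      rw [← e1, ← hτ] at I00 I01 I10 I11
      rw [← e1, ← hτ]
      have hne := hr.ne_zero
      linear_combination (norm := (field_simp; ring_nf))
        D.wt₂ (u - xs n) (u - xs n - D.η) τ i i' z'' 0 0 z * I00 +
        D.wt₂ (u - xs n) (u - xs n - D.η) τ i i' z'' 0 1 z * I01 +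
        D.wt₂ (u - xs n) (u - xs n - D.η) τ i i' z'' 1 0 z * I10 +
        D.wt₂ (u - xs n) (u - xs n - D.η) τ i i' z'' 1 1 z * I11 +
        (∏ m : Fin n, D.th (u - xs m + D.η) * D.th (u - xs m - D.η)) * (D.ph t / D.ph τ) * main
    · rw [if_pos e1] at I00 I01 I10 I11
      rw [if_neg e2] at main
      linear_combination D.wt₂ (u - xs n) (u - xs n - D.η) τ i i' z'' 0 0 z * I00 +
        D.wt₂ (u - xs n) (u - xs n - D.η) τ i i' z'' 0 1 z * I01 +
        D.wt₂ (u - xs n) (u - xs n - D.η) τ i i' z'' 1 0 z * I10 +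
        D.wt₂ (u - xs n) (u - xs n - D.η) τ i i' z'' 1 1 z * I11 +
        (∏ m : Fin n, D.th (u - xs m + D.η) * D.th (u - xs m - D.η)) *
          (D.ph t / D.ph (t + D.η * totalSpin (Fin.init h))) * main
    · rw [if_neg e1] at I00 I01 I10 I11
      linear_combination D.wt₂ (u - xs n) (u - xs n - D.η) τ i i' z'' 0 0 z * I00 +
        D.wt₂ (u - xs n) (u - xs n - D.η) τ i i' z'' 0 1 z * I01 +
        D.wt₂ (u - xs n) (u - xs n - D.η) τ i i' z'' 1 0 z * I10 +
        D.wt₂ (u - xs n) (u - xs n - D.η) τ i i' z'' 1 1 z * I11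

/-- At an inhomogeneity, the product of two entries of the monodromy matrix is antisymmetric in the
row indices. -/
lemma chain₂_creation (u t : ℂ) (ht : D.Reg t) : ∀ (n m : ℕ) (_ : m < n) (_ : xs m = u)
    (i i' j j' : Fin 2) (h'' h : Fin n → Fin 2),
    D.chain₂ xs u (u - D.η) t n i i' j j' h'' h =
      eps i i' * D.chain₂ xs u (u - D.η) t n 0 1 j j' h'' h
  | n + 1, m, hm, hx, i, i', j, j', h'', h => by
    have hr := ht.add (totalSpin (Fin.init h''))
    simp only [chain₂_succ, Fin.sum_univ_two, show u - D.η - xs n = u - xs n - D.η by ring]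
    -- The antisymmetry is created at the site whose inhomogeneity is u and is preserved by all
    -- later sites, because a local pair at u, u - η maps the singlet to a multiple of itself.
    rcases Nat.lt_succ_iff_lt_or_eq.mp hm with hlt | rfl
    · have IH := fun i i' => chain₂_creation u t ht n m hlt hx i i' j j' (Fin.init h'')
        (Fin.init h)
      have Y := fun i i' => D.wt₂_singlet (u - xs n) _ hr i i' (h'' (Fin.last n))
        (h (Fin.last n))
      rw [IH 0 0, IH 1 0, IH 1 1, eps_self, eps_self, eps_one_zero]
      have Y1 := Y i i'
      have Y2 := Y 0 1
      rw [eps_zero_one] at Y2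
      linear_combination D.chain₂ xs u (u - D.η) t n 0 1 j j' (Fin.init h'') (Fin.init h) *
        (Y1 - eps i i' * Y2)
    · rw [hx, sub_self, zero_sub]
      have Y := D.wt₂_creation _ hr i i' (h'' (Fin.last m))
      rw [Y 0 0, Y 0 1, Y 1 0, Y 1 1]
      ring

/-- The chain with the first site split off. -/
lemma chain_cons (u t : ℂ) : ∀ (n : ℕ) (i j l x : Fin 2) (g' g : Fin n → Fin 2),
    D.chain xs u t (n + 1) i j (Fin.cons l g') (Fin.cons x g) =
      ∑ k, D.chain (fun m => xs (m + 1)) u (t + D.η * spin l) n i k g' g *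
        D.wt (u - xs 0) t k l j x
  | 0, i, j, l, x, g', g => by
    have h0 : ∀ f : Fin 0 → Fin 2, totalSpin f = 0 := fun f => by simp [totalSpin]
    simp only [chain_succ, chain_zero, h0, Int.cast_zero, mul_zero, add_zero, mul_ite, mul_one,
      ite_mul, one_mul, zero_mul, Finset.sum_ite_eq, Finset.sum_ite_eq', Finset.mem_univ, if_true]
    rfl
  | n + 1, i, j, l, x, g', g => by
    have hi : ∀ (a : Fin 2) (f : Fin (n + 1) → Fin 2),
        Fin.init (Fin.cons a f : Fin (n + 2) → Fin 2) = Fin.cons a (Fin.init f) := by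
      intro a f
      conv_lhs => rw [← Fin.snoc_init_self f, Fin.cons_snoc_eq_snoc_cons, Fin.init_snoc]
    have hl : ∀ (a : Fin 2) (f : Fin (n + 1) → Fin 2),
        (Fin.cons a f : Fin (n + 2) → Fin 2) (Fin.last (n + 1)) = f (Fin.last n) := fun a f => rfl
    rw [chain_succ]
    simp only [hi, hl, totalSpin_cons, chain_cons u t n, chain_succ _ _ _ _ n, Int.cast_add,
      mul_add, ← add_assoc, Fin.sum_univ_two]
    ring

end Weights

/-! ### The zeros of the theta function -/

lemma theta_eq_zero_of_mem {ω z : ℂ} (hz : z ∈ periodLattice ω) : theta ω z = 0 := by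
  obtain ⟨m, n, rfl⟩ := hz
  have h1 : ∀ w, theta ω (w + Real.pi) = 0 ↔ theta ω w = 0 := fun w => by
    rw [theta_add_pi, neg_eq_zero]
  have h2 : ∀ w, theta ω (w + Real.pi * ω) = 0 ↔ theta ω w = 0 := fun w => by
    rw [theta_add_pi_mul, mul_eq_zero, or_iff_right (neg_ne_zero.mpr (exp_ne_zero _))]
  have h3 : ∀ w, theta ω (w + m * Real.pi) = 0 ↔ theta ω w = 0 := by
    intro w
    induction m using Int.induction_on with
    | zero => simp
    | succ k ih =>
      rw [← ih, ← h1 (w + (k : ℤ) * Real.pi)]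
      push_cast
      ring_nf
    | pred k ih =>
      rw [← ih, ← h1 (w + _)]
      push_cast
      ring_nf
  rw [add_comm, h3]
  induction n using Int.induction_on with
  | zero => simp [theta_zero]
  | succ k ih =>
    rw [← h2] at ih
    rw [← ih]
    push_cast
    ring_nf
  | pred k ih =>
    rw [← h2, ← ih]
    push_cast
    ring_nf

lemma theta_eq_zero_iff {ω : ℂ} (hω : 0 < ω.im) {z : ℂ} :
    theta ω z = 0 ↔ z ∈ periodLattice ω :=
  ⟨fun h => by_contra fun hz => theta_ne_zero hω hz h, theta_eq_zero_of_mem⟩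

lemma add_mem_periodLattice {ω a b : ℂ} (ha : a ∈ periodLattice ω) (hb : b ∈ periodLattice ω) :
    a + b ∈ periodLattice ω := by
  obtain ⟨m, n, rfl⟩ := ha
  obtain ⟨m', n', rfl⟩ := hb
  exact ⟨m + m', n + n', by push_cast; ring⟩

namespace Model

variable {N : ℕ} (P : Model N)

/-! ### The weights of the model -/

/-- The weights of the dynamical R-matrix of the model. -/
def weights (hω : 0 < P.ω.im) : Weights where
  th := theta P.ω
  ph z := exp (I * P.yc * z) * theta P.ω z
  η := P.η
  th_neg := theta_neg P.ω
  th_add a b ha hb := by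
    rw [theta_eq_zero_iff hω] at ha hb ⊢
    exact add_mem_periodLattice ha hb
  three_term x y z w := by
    have e : ∀ a, exp (I * P.yc * (x + a)) * exp (I * P.yc * (x - a)) = exp (2 * (I * P.yc * x)) :=
      fun a => by
        rw [← exp_add]
        ring_nf
    linear_combination exp (2 * (I * P.yc * x)) * theta_three_term hω x y z w +
      theta P.ω (x + z) * theta P.ω (x - z) * (theta P.ω (y + w) * theta P.ω (y - w)) * e z -
      theta P.ω (x + w) * theta P.ω (x - w) * (theta P.ω (y + z) * theta P.ω (y - z)) * e w -
      theta P.ω (x + y) * theta P.ω (x - y) * (theta P.ω (z + w) * theta P.ω (z - w)) * e y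

variable (hω : 0 < P.ω.im)

lemma weights_th (z : ℂ) : (P.weights hω).th z = theta P.ω z := rfl

lemma weights_ph (z : ℂ) : (P.weights hω).ph z = exp (I * P.yc * z) * theta P.ω z := rfl

lemma weights_eta : (P.weights hω).η = P.η := rfl

/-- The exponentials of the R-matrix are exactly the ratios of the factors e^{iyz} carried by ph,
and oddness of θ turns the weights at -t into weights at t. -/
lemma R_eq_wt (u t : ℂ) : ∀ i z' j z : Fin 2,
    P.R u t (i, z') (j, z) = (P.weights hω).wt u t i z' j z := by
  have e1 : ∀ a b, exp (I * P.yc * (a + b)) = exp (I * P.yc * a) * exp (I * P.yc * b) :=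
    fun a b => by rw [← exp_add, mul_add]
  have e2 : ∀ a b, exp (I * P.yc * (a - b)) = exp (I * P.yc * a) * exp (-(I * P.yc * b)) :=
    fun a b => by rw [← exp_add, mul_sub, sub_eq_add_neg]
  have hne := exp_ne_zero (I * P.yc * t)
  have hn : ∀ a, theta P.ω (-t + a) = -theta P.ω (t - a) := fun a => by
    rw [← theta_neg]
    ring_nf
  simp only [Fin.forall_fin_two]
  constructorm* _ ∧ _ <;> try rfl
  · change exp (I * P.yc * P.η) * P.wb u t = theta P.ω u * (exp (I * P.yc * (t + P.η)) *
      theta P.ω (t + P.η)) / (exp (I * P.yc * t) * theta P.ω t)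
    rw [wb, th, th, th, e1, mul_assoc (exp _) (exp _), mul_left_comm _ (exp (I * P.yc * t)),
      mul_div_mul_left _ _ hne]
    ring
  · change exp (I * P.yc * u) * P.wc u t = theta P.ω P.η * (exp (I * P.yc * (t + u)) *
      theta P.ω (t + u)) / (exp (I * P.yc * t) * theta P.ω t)
    rw [wc, th, th, th, e1, mul_assoc (exp _) (exp _), mul_left_comm _ (exp (I * P.yc * t)),
      mul_div_mul_left _ _ hne]
    ring
  · change exp (-(I * P.yc * u)) * P.wc u (-t) = theta P.ω P.η * (exp (I * P.yc * (t - u)) *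
      theta P.ω (t - u)) / (exp (I * P.yc * t) * theta P.ω t)
    rw [wc, th, th, th, e2, mul_assoc (exp _) (exp _), mul_left_comm _ (exp (I * P.yc * t)),
      mul_div_mul_left _ _ hne, hn, theta_neg, mul_neg, neg_div_neg_eq]
    ring
  · change exp (-(I * P.yc * P.η)) * P.wb u (-t) = theta P.ω u * (exp (I * P.yc * (t - P.η)) *
      theta P.ω (t - P.η)) / (exp (I * P.yc * t) * theta P.ω t)
    rw [wb, th, th, th, e2, mul_assoc (exp _) (exp _), mul_left_comm _ (exp (I * P.yc * t)),
      mul_div_mul_left _ _ hne, hn, theta_neg, mul_neg, neg_div_neg_eq]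
    ring

lemma Generic.reg_t0 {P : Model N} (hP : P.Generic) : (P.weights hP.im_pos).Reg P.t0 := fun k => by
  rw [weights_ph, weights_eta, mul_comm P.η]
  exact mul_ne_zero (exp_ne_zero _) (theta_ne_zero hP.im_pos (hP.height_notMem k))

/-- As a function of the spectral parameter, a weight is a multiple of a shifted theta function, up
to an exponential factor. -/
lemma exists_wt_eq_theta (ξ t : ℂ) : ∀ i z' j z : Fin 2, ∃ C : ℂ, ∀ u,
    exp (I * P.yc * Weights.eps j i * u) * (P.weights hω).wt (u - ξ) t i z' j z =
      C * theta P.ω (u - (ξ - P.η / 2 - spin i * (t + P.η * spin z') / 2 + spin j * t / 2)) := by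
  simp only [Fin.forall_fin_two]
  constructorm* _ ∧ _
  any_goals
    refine ⟨0, fun u => ?_⟩
    rw [zero_mul]
    exact mul_zero (exp _)
  all_goals
    simp only [Weights.wt_0000, Weights.wt_0101, Weights.wt_0110, Weights.wt_1001, Weights.wt_1010,
      Weights.wt_1111, Weights.eps, sub_self, mul_zero, zero_mul, exp_zero, one_mul, weights_th,
      weights_eta, Weights.spin_zero, Weights.spin_one, Int.cast_one, Int.cast_neg]
  · exact ⟨1, fun u => by ring_nf⟩
  · refine ⟨(P.weights hω).ph (t + P.η) / (P.weights hω).ph t, fun u => ?_⟩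
    rw [mul_comm (theta _ _), mul_div_right_comm]
    ring_nf
  · refine ⟨theta P.ω P.η * exp (I * P.yc * (t - ξ)) / (P.weights hω).ph t, fun u => ?_⟩
    rw [show I * P.yc * (t - ξ) = I * P.yc * (((0 : Fin 2) : ℕ) - ((1 : Fin 2) : ℕ)) * u +
      I * P.yc * (t + (u - ξ)) by simp; ring, exp_add, weights_ph _ _ (t + (u - ξ))]
    ring_nf
  · refine ⟨-theta P.ω P.η * exp (I * P.yc * (t + ξ)) / (P.weights hω).ph t, fun u => ?_⟩
    rw [show I * P.yc * (t + ξ) = I * P.yc * (((1 : Fin 2) : ℕ) - ((0 : Fin 2) : ℕ)) * u +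
      I * P.yc * (t - (u - ξ)) by simp; ring, exp_add, weights_ph _ _ (t - (u - ξ)),
      show t - (u - ξ) = -(u - (ξ - P.η / 2 - -1 * (t + P.η * 1) / 2 + 1 * t / 2)) by ring,
      theta_neg]
    ring_nf
  · refine ⟨(P.weights hω).ph (t - P.η) / (P.weights hω).ph t, fun u => ?_⟩
    rw [mul_comm (theta _ _), mul_div_right_comm]
    ring_nf
  · exact ⟨1, fun u => by ring_nf⟩

/-- Each site contributes one shifted theta function. The shifts telescope along the auxiliary line,
so the norm does not depend on the intermediate auxiliary labels and all terms of the sum lie in one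
space. -/
lemma isThetaFn_chain (xs : ℕ → ℂ) (t : ℂ) : ∀ (n : ℕ) (i j : Fin 2) (h' h : Fin n → Fin 2),
    IsThetaFn P.ω n (∑ m ∈ Finset.range n, xs m - n * P.η / 2 -
        spin i * (t + P.η * totalSpin h') / 2 + spin j * t / 2)
      fun u => exp (I * P.yc * Weights.eps j i * u) * (P.weights hω).chain xs u t n i j h' h
  | 0, i, j, h', h => by
    have h0 : totalSpin h' = 0 := by simp [totalSpin]
    simp only [Weights.chain_zero]
    split_ifs with hij
    · subst hij
      simpa [Weights.eps_self, h0] using IsThetaFn.one P.ω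
    · simpa using IsThetaFn.zero P.ω 0 _
  | n + 1, i, j, h', h => by
    have key : ∀ k, IsThetaFn P.ω (n + 1) (∑ m ∈ Finset.range (n + 1), xs m -
        (n + 1 : ℕ) * P.η / 2 - spin i * (t + P.η * totalSpin h') / 2 + spin j * t / 2)
        fun u => exp (I * P.yc * Weights.eps j i * u) * ((P.weights hω).wt (u - xs n)
          (t + P.η * totalSpin (Fin.init h')) i (h' (Fin.last n)) k (h (Fin.last n)) *
            (P.weights hω).chain xs u t n k j (Fin.init h') (Fin.init h)) := by
      intro k
      obtain ⟨C, hC⟩ := P.exists_wt_eq_theta hω (xs n) (t + P.η * totalSpin (Fin.init h')) i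
        (h' (Fin.last n)) k (h (Fin.last n))
      convert ((isThetaFn_chain xs t n k j (Fin.init h') (Fin.init h)).mul_theta hω
        (xs n - P.η / 2 - spin i * (t + P.η * totalSpin (Fin.init h') +
          P.η * spin (h' (Fin.last n))) / 2 + spin k * (t + P.η * totalSpin (Fin.init h')) / 2)
          ).const_mul C using 1
      · rw [Weights.totalSpin_init h', Finset.sum_range_succ]
        push_cast
        ring
      · funext u
        rw [show I * P.yc * Weights.eps j i * u = I * P.yc * Weights.eps j k * u +
          I * P.yc * Weights.eps k i * u by rw [Weights.eps, Weights.eps, Weights.eps]; ring,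
          exp_add]
        linear_combination exp (I * P.yc * Weights.eps j k * u) *
          (P.weights hω).chain xs u t n k j (Fin.init h') (Fin.init h) * hC u
    simp only [Weights.chain_succ, Finset.mul_sum]
    exact IsThetaFn.sum _ fun k _ => key k

lemma xibar_zero : P.xibar 0 = (∑ a, P.ξ a + P.t0) / N := by
  have : trh P 0 (fun _ => 0) = P.t0 := by
    simp [trh, t0, totalSpin, Weights.spin_zero]
  rw [xibar, this]
  ring

variable [NeZero N]

/-- The inhomogeneities as a periodic sequence. -/
def seq (m : ℕ) : ℂ := P.ξ (Fin.ofNat N m)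

lemma seq_val (a : Fin N) : P.seq a = P.ξ a := by simp [seq]

lemma sum_range_seq : ∑ m ∈ Finset.range N, P.seq m = ∑ a, P.ξ a := by
  rw [Finset.sum_range]
  exact Finset.sum_congr rfl fun a _ => P.seq_val a

lemma seq_add (m : ℕ) : P.seq (m + N) = P.seq m := by
  simp [seq, Fin.ofNat]

/-- The condition `ht`, valid throughout the sector, makes the norm equal to ∑ξ + t_0 = N ξ̄_0,
whatever the configurations. -/
lemma exists_chain_one_zero (t : ℂ) (h' h : Fin N → Fin 2)
    (ht : t + P.η * totalSpin h' / 2 = P.t0 + N * P.η / 2) : ∃ b : Fin N → ℂ, ∀ u,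
    exp (I * P.yc * u) * (P.weights hω).chain P.seq u t N 1 0 h' h =
      ∑ j : Fin N, b j * vartheta N P.ω j (u - P.xibar 0) := by
  have key := P.isThetaFn_chain hω P.seq t N 1 0 h' h
  obtain ⟨b, hb⟩ := key.exists_eq_sum_vartheta
  refine ⟨b, fun u => ?_⟩
  rw [Weights.eps, Weights.spin_zero, Weights.spin_one, sum_range_seq] at hb
  rw [xibar_zero, ← show ∑ a, P.ξ a - N * P.η / 2 - ((-1 : ℤ) : ℂ) *
    (t + P.η * totalSpin h') / 2 + ((1 : ℤ) : ℂ) * t / 2 = ∑ a, P.ξ a + P.t0 by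
      push_cast; linear_combination ht, ← hb]
  simp

/-- Here the norm differs from ∑ξ + t_0 by xπ + yπω: the first part is immaterial, and for y = 1 the
second is supplied by the factor e^{2iu}. Thus 𝓑 and 𝓒 share one interpolation space. -/
lemma exists_chain_zero_one (t : ℂ) (h' h : Fin N → Fin 2)
    (ht : t + P.η * totalSpin h' / 2 = P.t0 + N * P.η / 2) : ∃ b : Fin N → ℂ, ∀ u,
    exp (I * P.yc * u) * (P.weights hω).chain P.seq u t N 0 1 h' h =
      ∑ j : Fin N, b j * vartheta N P.ω j (u - P.xibar 0) := by
  have key := P.isThetaFn_chain hω P.seq t N 0 1 h' h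
  set s := ∑ m ∈ Finset.range N, P.seq m - N * P.η / 2 -
        spin 0 * (t + P.η * totalSpin h') / 2 + spin 1 * t / 2 with hs
  have key2 : IsThetaFn P.ω N (∑ a, P.ξ a + P.t0) fun u =>
      exp (I * P.yc * u) * (P.weights hω).chain P.seq u t N 0 1 h' h := by
    have e1 : ∑ a, P.ξ a + P.t0 = s + P.xc * Real.pi + P.yc * (Real.pi * P.ω) := by
      rw [hs, sum_range_seq, Weights.spin_zero, Weights.spin_one]
      rw [t0] at ht ⊢
      push_cast
      linear_combination ht
    have e2 : P.xc = ((P.x : ℕ) : ℤ) := by simp [xc]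
    rw [e1, e2]
    have hy : P.yc = 0 ∨ P.yc = 1 := by
      rw [yc]
      rcases P.y with ⟨y, hy⟩
      interval_cases y <;> simp
    rcases hy with hy | hy
    · convert key.shift_norm_pi ((P.x : ℕ) : ℤ) using 1
      · rw [hy]; ring
      · funext u
        rw [hy]; ring_nf
    · convert (key.shift_norm_pi ((P.x : ℕ) : ℤ)).exp_mul using 1
      · rw [hy]; ring
      · funext u
        rw [hy, ← mul_assoc, ← exp_add]
        simp only [Weights.eps, Fin.val_zero, Fin.val_one]
        push_cast
        ring_nf
  obtain ⟨b, hb⟩ := key2.exists_eq_sum_vartheta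
  refine ⟨b, fun u => ?_⟩
  rw [hb, xibar_zero]

end Model

/-! ### Operators on a sector of the representation space -/

/-- The number of down spins. -/
def downs {n : ℕ} (h : Fin n → Fin 2) : ℤ := ∑ k, ((h k : ℕ) : ℤ)

lemma totalSpin_eq_downs {n : ℕ} (h : Fin n → Fin 2) : totalSpin h = n - 2 * downs h := by
  simp [totalSpin, downs, spin, Finset.sum_sub_distrib, Finset.mul_sum]

namespace Weights

variable (D : Weights) (xs : ℕ → ℂ) (n : ℕ)

/-- An entry of the monodromy matrix, acting between sectors of the representation space whose
basis vector with label `h` has height `s + η * downs h`. -/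
def op (i j : Fin 2) (u s : ℂ) : Matrix (Fin n → Fin 2) (Fin n → Fin 2) ℂ :=
  Matrix.of fun h' h => D.chain xs u (s + D.η * downs h') n i j h' h

variable {D xs n}

lemma op_apply {i j : Fin 2} {u s : ℂ} {h' h : Fin n → Fin 2} :
    D.op xs n i j u s h' h = D.chain xs u (s + D.η * downs h') n i j h' h := rfl

lemma chain_downs {u t : ℂ} {i j : Fin 2} {h' h : Fin n → Fin 2}
    (hne : D.chain xs u t n i j h' h ≠ 0) :
    ((i : ℕ) : ℤ) + downs h' = ((j : ℕ) : ℤ) + downs h := by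
  have := D.chain_conserved xs hne
  rw [totalSpin_eq_downs, totalSpin_eq_downs, spin, spin] at this
  omega

lemma op_downs {i j : Fin 2} {u s : ℂ} {h' h : Fin n → Fin 2} (hne : D.op xs n i j u s h' h ≠ 0) :
    ((i : ℕ) : ℤ) + downs h' = ((j : ℕ) : ℤ) + downs h :=
  chain_downs hne

/-- The offset of `s'` is the difference between the height shift from T_τ and the change in the
number of down spins, so that consecutive operators see matching heights. -/
lemma op_mul_op {i i' j j' : Fin 2} {u v s s' : ℂ}
    (hs : s' = s + D.η * (1 - ((i : ℕ) : ℂ) - ((j : ℕ) : ℂ))) (h'' h : Fin n → Fin 2) :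
    (D.op xs n i j u s * D.op xs n i' j' v s') h'' h =
      D.chain₂ xs u v (s + D.η * downs h'') n i i' j j' h'' h := by
  rw [Matrix.mul_apply, chain₂]
  refine Finset.sum_congr rfl fun h' _ => ?_
  by_cases hne : D.op xs n i j u s h'' h' = 0
  · rw [hne, zero_mul, ← op_apply, hne, zero_mul]
  rw [op_apply, op_apply]
  have hc : (((i : ℕ) : ℤ) : ℂ) + downs h'' = ((j : ℕ) : ℤ) + downs h' := by
    exact_mod_cast op_downs hne
  congr 2
  rw [hs, spin]
  push_cast at hc ⊢
  linear_combination -D.η * hc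

variable {s : ℂ} (hs : D.Reg s) {u v : ℂ}
include hs

/-- Antisymmetry in the row indices makes products with equal rows vanish; this covers both 𝓑𝓑 and
𝓒𝓒. -/
lemma op_mul_op_creation {m : ℕ} (hm : m < n) (hx : xs m = u) (i j j' : Fin 2) {s' : ℂ}
    (hs' : s' = s + D.η * (1 - ((i : ℕ) : ℂ) - ((j : ℕ) : ℂ))) :
    D.op xs n i j u s * D.op xs n i j' (u - D.η) s' = 0 := by
  ext h'' h
  rw [op_mul_op hs', D.chain₂_creation xs u _ (hs.add _) n m hm hx, eps_self, zero_mul]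
  rfl

/-- Antisymmetry exchanges the rows of the 𝓒𝓑 term at the cost of a sign; the sum is then minus the
singlet combination, which is the quantum determinant. -/
lemma op_mul_op_quantum_det {m : ℕ} (hm : m < n) (hx : xs m = u) :
    D.op xs n 0 1 u s * D.op xs n 1 0 (u - D.η) s +
        D.op xs n 1 0 u s * D.op xs n 0 1 (u - D.η) s =
      Matrix.diagonal fun h => -((∏ k : Fin n, D.th (u - xs k + D.η) * D.th (u - xs k - D.η)) *
        (D.ph (s + D.η * downs h) / D.ph (s + D.η * (n - downs h)))) := by
  ext h'' h
  have hr := hs.add (downs h'')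
  have h1 := D.chain₂_creation xs u _ hr n m hm hx 1 0 0 1 h'' h
  have h2 := D.chain₂_singlet xs u _ hr n 0 1 h'' h
  rw [eps_one_zero] at h1
  rw [eps_zero_one, one_mul] at h2
  rw [Matrix.add_apply, op_mul_op (by simp), op_mul_op (by simp), h1, Matrix.diagonal_apply]
  split_ifs at h2 ⊢ with heq
  · subst heq
    rw [show s + D.η * (n - downs h'') = s + D.η * downs h'' + D.η * totalSpin h'' by
      rw [totalSpin_eq_downs]; push_cast; ring]
    linear_combination -h2
  · linear_combination -h2

lemma op_one_zero_comm (hne : D.th (u - v + D.η) ≠ 0) :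
    D.op xs n 1 0 u s * D.op xs n 1 0 v s = D.op xs n 1 0 v s * D.op xs n 1 0 u s := by
  ext h'' h
  have key := D.chain₂_exchange xs u v _ (hs.add (downs h'')) n 1 1 0 0 h'' h
  simp only [Fin.sum_univ_two, wt_1100, wt_1101, wt_1110, wt_1111, wt_0000, wt_0100, wt_1000,
    zero_mul, mul_zero, zero_add, add_zero] at key
  rw [op_mul_op (by simp), op_mul_op (by simp)]
  exact mul_left_cancel₀ hne (key.trans (mul_comm _ _))

open Matrix

/-- One component of the exchange relation expresses D(v)C(u) through C(u)D(v) and C(v)D(u), and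
both of these kill k. -/
lemma op_one_one_mulVec_op_one_zero {k : (Fin n → Fin 2) → ℂ} (hne : D.th (u - v) ≠ 0)
    (hu : D.op xs n 1 1 u s *ᵥ k = 0) (hv : D.op xs n 1 1 v s *ᵥ k = 0) :
    D.op xs n 1 1 v s *ᵥ (D.op xs n 1 0 u (s - D.η) *ᵥ k) = 0 := by
  have h1 : (D.op xs n 1 0 u s * D.op xs n 1 1 v s) *ᵥ k = 0 := by
    rw [← Matrix.mulVec_mulVec, hv, Matrix.mulVec_zero]
  have h2 : (D.op xs n 1 0 v s * D.op xs n 1 1 u s) *ᵥ k = 0 := by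
    rw [← Matrix.mulVec_mulVec, hu, Matrix.mulVec_zero]
  rw [Matrix.mulVec_mulVec]
  funext h''
  have hr := hs.add (downs h'')
  have hb : D.wt (u - v) (s + D.η * downs h'') 0 1 0 1 ≠ 0 :=
    div_ne_zero (mul_ne_zero hne hr.add_eta_ne_zero) hr.ne_zero
  refine mul_left_cancel₀ hb ?_
  have h1' := congrFun h1 h''
  have h2' := congrFun h2 h''
  simp only [Matrix.mulVec, dotProduct, Pi.zero_apply] at h1' h2' ⊢
  rw [mul_zero, Finset.mul_sum]
  have key : ∀ h, D.wt (u - v) (s + D.η * downs h'') 0 1 0 1 *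
      ((D.op xs n 1 1 v s * D.op xs n 1 0 u (s - D.η)) h'' h * k h) =
      D.th (u - v + D.η) * ((D.op xs n 1 0 u s * D.op xs n 1 1 v s) h'' h * k h) -
      D.wt (u - v) (s + D.η * downs h'') 1 0 0 1 *
        ((D.op xs n 1 0 v s * D.op xs n 1 1 u s) h'' h * k h) := by
    intro h
    have key := D.chain₂_exchange xs u v _ hr n 1 1 0 1 h'' h
    simp only [Fin.sum_univ_two, wt_1100, wt_1101, wt_1110, wt_1111, wt_0001, wt_1101,
      zero_mul, mul_zero, zero_add, add_zero] at key
    rw [op_mul_op (by simp [sub_eq_add_neg]), op_mul_op (by simp), op_mul_op (by simp)]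
    linear_combination -k h * key
  rw [Finset.sum_congr rfl fun h _ => key h, Finset.sum_sub_distrib, ← Finset.mul_sum,
    ← Finset.mul_sum, h1', h2']
  ring

/-- The exchange relation writes B(v)C(u) through C(u)B(v), A(u)D(v) and A(v)D(u); in each product
the right factor kills k. -/
lemma op_zero_one_mulVec_op_one_zero {k : (Fin n → Fin 2) → ℂ} (hne : D.th (u - v) ≠ 0)
    (hB : D.op xs n 0 1 v s *ᵥ k = 0) (hu : D.op xs n 1 1 u (s + D.η) *ᵥ k = 0)
    (hv : D.op xs n 1 1 v (s + D.η) *ᵥ k = 0) :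
    D.op xs n 0 1 v s *ᵥ (D.op xs n 1 0 u s *ᵥ k) = 0 := by
  have h1 : (D.op xs n 1 0 u s * D.op xs n 0 1 v s) *ᵥ k = 0 := by
    rw [← Matrix.mulVec_mulVec, hB, Matrix.mulVec_zero]
  have h2 : (D.op xs n 0 0 u s * D.op xs n 1 1 v (s + D.η)) *ᵥ k = 0 := by
    rw [← Matrix.mulVec_mulVec, hv, Matrix.mulVec_zero]
  have h3 : (D.op xs n 0 0 v s * D.op xs n 1 1 u (s + D.η)) *ᵥ k = 0 := by
    rw [← Matrix.mulVec_mulVec, hu, Matrix.mulVec_zero]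
  rw [Matrix.mulVec_mulVec]
  funext h''
  have hr := hs.add (downs h'')
  have hb : D.wt (u - v) (s + D.η * downs h'') 0 1 0 1 ≠ 0 :=
    div_ne_zero (mul_ne_zero hne hr.add_eta_ne_zero) hr.ne_zero
  refine mul_left_cancel₀ hb ?_
  have h1' := congrFun h1 h''
  have h2' := congrFun h2 h''
  have h3' := congrFun h3 h''
  simp only [Matrix.mulVec, dotProduct, Pi.zero_apply] at h1' h2' h3' ⊢
  rw [mul_zero, Finset.mul_sum]
  have key : ∀ h, D.wt (u - v) (s + D.η * downs h'') 0 1 0 1 *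
      ((D.op xs n 0 1 v s * D.op xs n 1 0 u s) h'' h * k h) =
      D.wt (u - v) (s + D.η * downs h'' + D.η * totalSpin h'') 1 0 1 0 *
        ((D.op xs n 1 0 u s * D.op xs n 0 1 v s) h'' h * k h) +
      D.wt (u - v) (s + D.η * downs h'' + D.η * totalSpin h'') 1 0 0 1 *
        ((D.op xs n 0 0 u s * D.op xs n 1 1 v (s + D.η)) h'' h * k h) -
      D.wt (u - v) (s + D.η * downs h'') 1 0 0 1 *
        ((D.op xs n 0 0 v s * D.op xs n 1 1 u (s + D.η)) h'' h * k h) := by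
    intro h
    have key := D.chain₂_exchange xs u v _ hr n 1 0 0 1 h'' h
    simp only [Fin.sum_univ_two, wt_1000, wt_1011, wt_0001, wt_1101,
      zero_mul, mul_zero, zero_add, add_zero] at key
    rw [op_mul_op (by simp), op_mul_op (by simp), op_mul_op (by simp), op_mul_op (by simp)]
    linear_combination -k h * key
  rw [Finset.sum_congr rfl fun h _ => key h, Finset.sum_sub_distrib, Finset.sum_add_distrib,
    ← Finset.mul_sum, ← Finset.mul_sum, ← Finset.mul_sum, h1', h2', h3']
  ring

end Weights

open Matrix

/-! ### Ordered products of commuting elements -/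

/-- The ordered product of powers of the elements of a family. -/
def orderedProd {M : Type*} [Monoid M] {n : ℕ} (f : Fin n → M) (e : Fin n → ℕ) : M :=
  ((List.finRange n).map fun k => f k ^ e k).prod

section orderedProd

variable {M : Type*} [Monoid M] {n : ℕ} {f : Fin n → M}

lemma mul_list_prod_update (hf : ∀ a b, Commute (f a) (f b)) (a : Fin n) (e : Fin n → ℕ) :
    ∀ l : List (Fin n), l.Nodup → a ∈ l → f a * (l.map fun k => f k ^ e k).prod =
      (l.map fun k => f k ^ Function.update e a (e a + 1) k).prod
  | b :: l, hn, hl => by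
    rw [List.nodup_cons] at hn
    rw [List.map_cons, List.map_cons, List.prod_cons, List.prod_cons]
    by_cases hab : b = a
    · subst hab
      rw [Function.update_self, pow_succ', mul_assoc]
      have : (l.map fun k => f k ^ e k) =
          l.map fun k => f k ^ Function.update e b (e b + 1) k :=
        List.map_congr_left fun k hk => by
          rw [Function.update_of_ne]
          rintro rfl
          exact hn.1 hk
      rw [this]
    · rw [Function.update_of_ne hab, ← mul_assoc, ((hf a b).pow_right (e b)).eq, mul_assoc,
        mul_list_prod_update hf a e l hn.2 ((List.mem_cons.mp hl).resolve_left (Ne.symm hab))]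

lemma mul_orderedProd (hf : ∀ a b, Commute (f a) (f b)) (a : Fin n) (e : Fin n → ℕ) :
    f a * orderedProd f e = orderedProd f (Function.update e a (e a + 1)) :=
  mul_list_prod_update hf a e _ (List.nodup_finRange n) (List.mem_finRange a)

lemma orderedProd_mul (hf : ∀ a b, Commute (f a) (f b)) (a : Fin n) (e : Fin n → ℕ) :
    orderedProd f e * f a = orderedProd f (Function.update e a (e a + 1)) := by
  rw [← mul_orderedProd hf]
  refine (Commute.list_prod_right _ _ fun x hx => ?_).eq.symm
  obtain ⟨k, -, rfl⟩ := List.mem_map.mp hx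
  exact (hf a k).pow_right _

lemma orderedProd_zero : orderedProd f (fun _ => 0) = 1 := by
  simp [orderedProd]

end orderedProd

/-! ### Spin configurations -/

section configurations

variable {n : ℕ}

lemma fin_two_eq_one_of_ne {a : Fin 2} (h : a ≠ 0) : a = 1 := by
  revert h
  revert a
  decide

lemma fin_two_eq_zero_of_ne {a : Fin 2} (h : a ≠ 1) : a = 0 := by
  revert h
  revert a
  decide

/-- Induction on spin configurations, by raising one spin at a time. -/
lemma config_induction_down {p : (Fin n → Fin 2) → Prop} (h1 : p fun _ => 1)
    (step : ∀ h a, h a = 1 → p h → p (Function.update h a 0)) (h : Fin n → Fin 2) : p h := by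
  have key : ∀ s : Finset (Fin n), p fun k => if k ∈ s then 0 else 1 := by
    intro s
    induction s using Finset.induction_on with
    | empty => simpa using h1
    | insert a s ha ih =>
      convert step _ a (by simp [ha]) ih using 1
      funext k
      by_cases hk : k = a
      · subst hk; simp
      · simp [hk]
  convert key (Finset.univ.filter fun k => h k = 0) using 1
  funext k
  by_cases hk : h k = 0
  · simp [hk]
  · simp [fin_two_eq_one_of_ne hk]

/-- Induction on spin configurations, by lowering one spin at a time. -/
lemma config_induction_up {p : (Fin n → Fin 2) → Prop} (h0 : p fun _ => 0)
    (step : ∀ h a, h a = 0 → p h → p (Function.update h a 1)) (h : Fin n → Fin 2) : p h := by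
  have key : ∀ s : Finset (Fin n), p fun k => if k ∈ s then 1 else 0 := by
    intro s
    induction s using Finset.induction_on with
    | empty => simpa using h0
    | insert a s ha ih =>
      convert step _ a (by simp [ha]) ih using 1
      funext k
      by_cases hk : k = a
      · subst hk; simp
      · simp [hk]
  convert key (Finset.univ.filter fun k => h k = 1) using 1
  funext k
  by_cases hk : h k = 1
  · simp [hk]
  · simp [fin_two_eq_zero_of_ne hk]

lemma downs_update (h : Fin n → Fin 2) (a : Fin n) (z : Fin 2) :
    downs (Function.update h a z) = downs h - ((h a : ℕ) : ℤ) + ((z : ℕ) : ℤ) := by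
  have e1 : ∀ g : Fin n → Fin 2, downs g = ((g a : ℕ) : ℤ) + ∑ k ∈ Finset.univ.erase a,
      ((g k : ℕ) : ℤ) := fun g => (Finset.add_sum_erase _ _ (Finset.mem_univ a)).symm
  have e2 : ∑ k ∈ Finset.univ.erase a, ((Function.update h a z k : ℕ) : ℤ) =
      ∑ k ∈ Finset.univ.erase a, ((h k : ℕ) : ℤ) :=
    Finset.sum_congr rfl fun k hk => by rw [Function.update_of_ne (Finset.ne_of_mem_erase hk)]
  rw [e1 h, e1 (Function.update h a z), e2, Function.update_self]
  ring

lemma downs_le (h : Fin n → Fin 2) : downs h ≤ n := by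
  refine (Finset.sum_le_card_nsmul _ _ 1 fun k _ => ?_).trans (by simp)
  have := (h k).isLt
  omega

lemma downs_one : downs (fun _ : Fin n => 1) = n := by simp [downs]

lemma downs_lt_of_le_of_ne {h k : Fin n → Fin 2} (hle : ∀ a, h a = 1 → k a = 1) (hne : h ≠ k) :
    downs h < downs k := by
  obtain ⟨a, ha⟩ := Function.ne_iff.mp hne
  have hle' : ∀ b, ((h b : ℕ) : ℤ) ≤ ((k b : ℕ) : ℤ) := by
    intro b
    by_cases hb : h b = 1
    · rw [hb, hle b hb]
    · rw [fin_two_eq_zero_of_ne hb]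
      simp
  refine Finset.sum_lt_sum (fun b _ => hle' b) ⟨a, Finset.mem_univ a, ?_⟩
  refine lt_of_le_of_ne (hle' a) fun heq => ha (Fin.ext ?_)
  exact_mod_cast heq

lemma eq_one_of_downs_eq {h : Fin n → Fin 2} (hd : downs h = n) : h = fun _ => 1 := by
  by_contra hne
  have := downs_lt_of_le_of_ne (k := fun _ => 1) (fun _ _ => rfl) hne
  rw [downs_one] at this
  omega

end configurations

/-! ### The separated basis -/

namespace Weights

variable (D : Weights) (xs : ℕ → ℂ) (n : ℕ)

/-- The inhomogeneities are in general position. -/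
def InhomGeneric : Prop :=
  ∀ a b : Fin n, a ≠ b → D.th (xs a - xs b) ≠ 0 ∧ D.th (xs a - xs b + D.η) ≠ 0

/-- The vectors of the separated basis, up to normalization. -/
def sepKet (s : ℂ) (h : Fin n → Fin 2) : (Fin n → Fin 2) → ℂ :=
  orderedProd (fun a => D.op xs n 1 0 (xs a - D.η) s) (fun a => 1 - (h a : ℕ)) *ᵥ
    Pi.single (fun _ => 1) 1

/-- The covectors of the separated basis, up to normalization. -/
def sepBra (s : ℂ) (h : Fin n → Fin 2) : (Fin n → Fin 2) → ℂ :=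
  Pi.single (fun _ => 0) 1 ᵥ* orderedProd (fun a => D.op xs n 1 0 (xs a) s) (fun a => (h a : ℕ))

variable {D xs n}

lemma InhomGeneric.comm_bra (hx : D.InhomGeneric xs n) {s : ℂ} (hs : D.Reg s) (a b : Fin n) :
    Commute (D.op xs n 1 0 (xs a) s) (D.op xs n 1 0 (xs b) s) := by
  rcases eq_or_ne a b with rfl | hab
  · exact Commute.refl _
  · exact op_one_zero_comm hs (hx a b hab).2

lemma InhomGeneric.comm_ket (hx : D.InhomGeneric xs n) {s : ℂ} (hs : D.Reg s) (a b : Fin n) :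
    Commute (D.op xs n 1 0 (xs a - D.η) s) (D.op xs n 1 0 (xs b - D.η) s) := by
  rcases eq_or_ne a b with rfl | hab
  · exact Commute.refl _
  · refine op_one_zero_comm hs ?_
    rw [sub_sub_sub_cancel_right]
    exact (hx a b hab).2

lemma sepKet_one (s : ℂ) : D.sepKet xs n s (fun _ => 1) = Pi.single (fun _ => 1) 1 := by
  exact (congrArg (· *ᵥ _) orderedProd_zero).trans (Matrix.one_mulVec _)

lemma sepBra_zero (s : ℂ) : D.sepBra xs n s (fun _ => 0) = Pi.single (fun _ => 0) 1 := by
  exact (congrArg (_ ᵥ* ·) orderedProd_zero).trans (Matrix.vecMul_one _)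

section

variable (hx : D.InhomGeneric xs n) {s : ℂ} (hs : D.Reg s)
include hx hs

lemma op_one_zero_mulVec_sepKet {h : Fin n → Fin 2} {a : Fin n} (ha : h a = 1) :
    D.op xs n 1 0 (xs a - D.η) s *ᵥ D.sepKet xs n s h = D.sepKet xs n s (Function.update h a 0) := by
  rw [sepKet, sepKet, Matrix.mulVec_mulVec,
    mul_orderedProd (f := fun a : Fin n => D.op xs n 1 0 (xs a - D.η) s) (hx.comm_ket hs) a]
  congr 2
  funext k
  by_cases hk : k = a
  · subst hk; simp [ha]
  · simp [hk]

lemma sepBra_vecMul_op_one_zero {h : Fin n → Fin 2} {a : Fin n} (ha : h a = 0) :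
    D.sepBra xs n s h ᵥ* D.op xs n 1 0 (xs a) s = D.sepBra xs n s (Function.update h a 1) := by
  rw [sepBra, sepBra, Matrix.vecMul_vecMul,
    orderedProd_mul (f := fun a : Fin n => D.op xs n 1 0 (xs a) s) (hx.comm_bra hs) a]
  congr 2
  funext k
  by_cases hk : k = a
  · subst hk; simp [ha]
  · simp [hk]

lemma sepKet_eq_mulVec {h : Fin n → Fin 2} {a : Fin n} (ha : h a = 0) :
    D.sepKet xs n s h =
      D.op xs n 1 0 (xs a - D.η) s *ᵥ D.sepKet xs n s (Function.update h a 1) := by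
  rw [op_one_zero_mulVec_sepKet hx hs (Function.update_self ..), Function.update_idem, ← ha,
    Function.update_eq_self]

lemma sepBra_eq_vecMul {h : Fin n → Fin 2} {a : Fin n} (ha : h a = 1) :
    D.sepBra xs n s h =
      D.sepBra xs n s (Function.update h a 0) ᵥ* D.op xs n 1 0 (xs a) s := by
  rw [sepBra_vecMul_op_one_zero hx hs (Function.update_self ..), Function.update_idem, ← ha,
    Function.update_eq_self]

/-- When h a = 0 the vector contains the factor C(ξ_a - η), and C(ξ_a)C(ξ_a - η) = 0. -/
lemma op_one_zero_mulVec_sepKet_eq_zero {h : Fin n → Fin 2} {a : Fin n} (ha : h a = 0) :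
    D.op xs n 1 0 (xs a) s *ᵥ D.sepKet xs n s h = 0 := by
  rw [sepKet_eq_mulVec hx hs ha, Matrix.mulVec_mulVec,
    op_mul_op_creation hs a.isLt rfl 1 0 0 (by simp), Matrix.zero_mulVec]

lemma downs_of_sepKet_ne_zero (h : Fin n → Fin 2) :
    ∀ h'', D.sepKet xs n s h h'' ≠ 0 → downs h'' = downs h := by
  induction h using config_induction_down with
  | h1 =>
    intro h'' hne
    rw [sepKet_one] at hne
    by_cases he : h'' = fun _ => 1
    · rw [he]
    · exact absurd (Pi.single_eq_of_ne he _) hne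
  | step h a ha ih =>
    intro h'' hne
    rw [← op_one_zero_mulVec_sepKet hx hs ha] at hne
    obtain ⟨h', -, h'ne⟩ := Finset.exists_ne_zero_of_sum_ne_zero hne
    have e1 := op_downs (left_ne_zero_of_mul h'ne)
    have e2 := ih h' (right_ne_zero_of_mul h'ne)
    rw [downs_update, ha]
    simp at e1 ⊢
    omega

lemma downs_of_sepBra_ne_zero (h : Fin n → Fin 2) :
    ∀ h'', D.sepBra xs n s h h'' ≠ 0 → downs h'' = downs h := by
  induction h using config_induction_up with
  | h0 =>
    intro h'' hne
    rw [sepBra_zero] at hne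
    by_cases he : h'' = fun _ => 0
    · rw [he]
    · exact absurd (Pi.single_eq_of_ne he _) hne
  | step h a ha ih =>
    intro h'' hne
    rw [← sepBra_vecMul_op_one_zero hx hs ha] at hne
    obtain ⟨h', -, h'ne⟩ := Finset.exists_ne_zero_of_sum_ne_zero hne
    have e1 := op_downs (right_ne_zero_of_mul h'ne)
    have e2 := ih h' (left_ne_zero_of_mul h'ne)
    rw [downs_update, ha]
    simp at e1 ⊢
    omega

/-- If every down label of h is a down label of k, the supports differ in their number of down
spins. Otherwise some site has h a = 1 and k a = 0, and the factor C(ξ_a) of the covector kills the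
vector. -/
lemma sepBra_dotProduct_sepKet_of_ne {h k : Fin n → Fin 2} (hne : h ≠ k) :
    D.sepBra xs n s h ⬝ᵥ D.sepKet xs n s k = 0 := by
  by_cases hle : ∀ a, h a = 1 → k a = 1
  · by_contra hn
    obtain ⟨g, -, hg⟩ := Finset.exists_ne_zero_of_sum_ne_zero hn
    have e1 := downs_of_sepBra_ne_zero hx hs h g (left_ne_zero_of_mul hg)
    have e2 := downs_of_sepKet_ne_zero hx hs k g (right_ne_zero_of_mul hg)
    have := downs_lt_of_le_of_ne hle hne
    omega
  · push Not at hle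
    obtain ⟨a, ha, hk⟩ := hle
    rw [sepBra_eq_vecMul hx hs ha, ← Matrix.dotProduct_mulVec,
      op_one_zero_mulVec_sepKet_eq_zero hx hs (fin_two_eq_zero_of_ne hk), dotProduct_zero]

end

lemma chain_one_one (u t : ℂ) : ∀ n, D.chain xs u t n 1 1 (fun _ => 1) (fun _ => 1) =
    ∏ m : Fin n, D.th (u - xs m + D.η)
  | 0 => by simp [chain_zero]
  | n + 1 => by
    rw [chain_succ, Fin.sum_univ_two, wt_1101, wt_1111, zero_mul, zero_add, Fin.prod_univ_castSucc,
      mul_comm]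
    exact congrArg (· * _) (chain_one_one u t n)

lemma op_mulVec_single (i j : Fin 2) (u s : ℂ) (h h'' : Fin n → Fin 2) :
    (D.op xs n i j u s *ᵥ Pi.single h 1) h'' = D.op xs n i j u s h'' h := by
  rw [Matrix.mulVec_single_one]
  rfl

/-- On the all-down vector D(u) acts by ∏ th(u - ξ_m + η), which vanishes at u = ξ_a - η, and the
exchange relation carries this through the operators C. The shift `s - D.η` appears because the
diagonal entry D changes the sector. -/
lemma op_one_one_mulVec_sepKet (hx : D.InhomGeneric xs n) (h : Fin n → Fin 2) :
    ∀ {s : ℂ}, D.Reg s → ∀ {a : Fin n}, h a = 1 →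
      D.op xs n 1 1 (xs a - D.η) s *ᵥ D.sepKet xs n (s - D.η) h = 0 := by
  induction h using config_induction_down with
  | h1 =>
    intro s hs a _
    rw [sepKet_one]
    funext h''
    rw [op_mulVec_single, Pi.zero_apply]
    by_contra hne
    have e1 := op_downs hne
    rw [downs_one] at e1
    have e2 := eq_one_of_downs_eq (add_left_cancel e1)
    subst e2
    rw [op_apply, chain_one_one] at hne
    refine hne (Finset.prod_eq_zero (Finset.mem_univ a) ?_)
    rw [show xs a - D.η - xs a + D.η = 0 by ring, D.th_zero]
  | step h c hc ih =>
    intro s hs a ha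
    have hca : c ≠ a := by
      rintro rfl
      simp at ha
    rw [Function.update_of_ne hca.symm] at ha
    have hs' : D.Reg (s - D.η) := by
      have := hs.add (-1)
      rwa [show s + D.η * ((-1 : ℤ) : ℂ) = s - D.η by push_cast; ring] at this
    rw [← op_one_zero_mulVec_sepKet hx hs' hc]
    refine op_one_one_mulVec_op_one_zero hs ?_ (ih hs hc) (ih hs ha)
    rw [sub_sub_sub_cancel_right]
    exact (hx c a hca).1

variable (hx : D.InhomGeneric xs n) {s : ℂ} (hs : D.Reg s)
include hx hs

/-- B would add a down spin to the all-down vector, hence kills it. Each further factor C is crossed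
with the help of the vanishing of D, now in the sector shifted by η. -/
lemma op_zero_one_mulVec_sepKet_eq_zero {h : Fin n → Fin 2} {a : Fin n} (ha : h a = 1) :
    D.op xs n 0 1 (xs a - D.η) s *ᵥ D.sepKet xs n s h = 0 := by
  induction h using config_induction_down with
  | h1 =>
    rw [sepKet_one]
    funext h''
    rw [op_mulVec_single, Pi.zero_apply]
    by_contra hne
    have e1 := op_downs hne
    rw [downs_one] at e1
    have := downs_le h''
    simp at e1
    omega
  | step h c hc ih =>
    have hca : c ≠ a := by
      rintro rfl
      simp at ha
    rw [Function.update_of_ne hca.symm] at ha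
    have hs' : D.Reg (s + D.η) := by
      have := hs.add 1
      rwa [show s + D.η * ((1 : ℤ) : ℂ) = s + D.η by push_cast; ring] at this
    have key := fun a ha => op_one_one_mulVec_sepKet hx h hs' (a := a) ha
    rw [add_sub_cancel_right] at key
    rw [← op_one_zero_mulVec_sepKet hx hs hc]
    refine op_zero_one_mulVec_op_one_zero hs ?_ (ih ha) (key c hc) (key a ha)
    rw [sub_sub_sub_cancel_right]
    exact (hx c a hca).1

/-- With C(ξ_a - η) split off from the vector, the quantum determinant relation leaves a scalar,
since its other term contains B(ξ_a - η) acting on a vector with label 1 at a. -/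
lemma op_zero_one_mulVec_sepKet {h : Fin n → Fin 2} {a : Fin n} (ha : h a = 0) {Q : ℂ}
    (hQ : D.op xs n 0 1 (xs a) s * D.op xs n 1 0 (xs a - D.η) s +
      D.op xs n 1 0 (xs a) s * D.op xs n 0 1 (xs a - D.η) s = Q • 1) :
    D.op xs n 0 1 (xs a) s *ᵥ D.sepKet xs n s h =
      Q • D.sepKet xs n s (Function.update h a 1) := by
  rw [sepKet_eq_mulVec hx hs ha, Matrix.mulVec_mulVec, eq_sub_of_add_eq hQ, Matrix.sub_mulVec,
    ← Matrix.mulVec_mulVec _ (D.op xs n 1 0 (xs a) s),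
    op_zero_one_mulVec_sepKet_eq_zero hx hs (Function.update_self ..), Matrix.mulVec_zero, sub_zero,
    Matrix.smul_mulVec, Matrix.one_mulVec]

end Weights

open Matrix

/-! ### Determinants -/

section determinants

variable {n : Type*} [Fintype n] [DecidableEq n]

/-- Cramer's rule for the value of a linear form at the solution of a linear system. -/
lemma dotProduct_mul_det {A : Matrix n n ℂ} {c g : n → ℂ} (h : A *ᵥ c = g) (r : n → ℂ) :
    (r ⬝ᵥ c) * A.det = ∑ b, g b * (A.updateRow b r).det := by
  have h1 := Matrix.mulVec_cramer Aᵀ r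
  have h2 : c ⬝ᵥ (Aᵀ *ᵥ Matrix.cramer Aᵀ r) = ∑ b, g b * (A.updateRow b r).det := by
    rw [Matrix.dotProduct_mulVec, Matrix.vecMul_transpose, h]
    simp only [dotProduct, Matrix.cramer_transpose_apply]
  rw [← h2, h1, dotProduct_smul, Matrix.det_transpose, dotProduct_comm, smul_eq_mul, mul_comm]

/-- The determinant of a matrix whose rows are linear combinations. -/
lemma det_sum_rows {ι : Type*} [Fintype ι] [DecidableEq ι] (w : n → ι → ℂ) (r : n → ι → n → ℂ) :
    (Matrix.of fun a => ∑ k, w a k • r a k).det =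
      ∑ h : n → ι, (∏ a, w a (h a)) * (Matrix.of fun a => r a (h a)).det := by
  refine ((Matrix.detRowAlternating (R := ℂ) (n := n)).toMultilinearMap.map_sum
    fun a k => w a k • r a k).trans (Finset.sum_congr rfl fun h _ => ?_)
  rw [MultilinearMap.map_smul_univ]
  rfl

/-- Swapping row b with the border row makes the matrix block triangular. -/
lemma det_bordered_single (F : Matrix n n ℂ) (r : n → ℂ) (b : n) :
    (Matrix.fromBlocks F (Matrix.of fun a (_ : Fin 1) => (Pi.single b 1 : n → ℂ) a)
      (Matrix.of fun _ => r) 0).det = -(F.updateRow b r).det := by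
  have key := Matrix.det_permute (Equiv.swap (Sum.inl b) (Sum.inr (0 : Fin 1)))
    (Matrix.fromBlocks F (Matrix.of fun a (_ : Fin 1) => (Pi.single b 1 : n → ℂ) a)
      (Matrix.of fun _ => r) 0)
  rw [Equiv.Perm.sign_swap Sum.inl_ne_inr] at key
  have h2 : (Matrix.fromBlocks F (Matrix.of fun a (_ : Fin 1) => (Pi.single b 1 : n → ℂ) a)
      (Matrix.of fun _ => r) 0).submatrix (Equiv.swap (Sum.inl b) (Sum.inr (0 : Fin 1))) id =
      Matrix.fromBlocks (F.updateRow b r) 0 (Matrix.of fun _ => F b) 1 := by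
    ext (a | a) (c | c)
    · by_cases hab : a = b
      · subst hab; simp
      · have : Equiv.swap (Sum.inl b) (Sum.inr (0 : Fin 1)) (Sum.inl a) = Sum.inl a :=
          Equiv.swap_apply_of_ne_of_ne (by simpa using hab) (by simp)
        simp [this, hab]
    · by_cases hab : a = b
      · subst hab; simp
      · have : Equiv.swap (Sum.inl b) (Sum.inr (0 : Fin 1)) (Sum.inl a) = Sum.inl a :=
          Equiv.swap_apply_of_ne_of_ne (by simpa using hab) (by simp)
        simp [this, hab]
    · rw [Subsingleton.elim a 0]; simp
    · rw [Subsingleton.elim a 0, Subsingleton.elim c 0]; simp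
  rw [h2, Matrix.det_fromBlocks_zero₁₂, Matrix.det_one, mul_one] at key
  rw [key]
  simp

/-- The determinant of a bordered matrix. -/
lemma det_bordered (F : Matrix n n ℂ) (c r : n → ℂ) :
    (Matrix.fromBlocks F (Matrix.of fun a (_ : Fin 1) => c a) (Matrix.of fun _ => r) 0).det =
      -∑ b, c b * (F.updateRow b r).det := by
  set M : (n → ℂ) → Matrix (n ⊕ Fin 1) (n ⊕ Fin 1) ℂ := fun c =>
    Matrix.fromBlocks F (Matrix.of fun a (_ : Fin 1) => c a) (Matrix.of fun _ => r) 0 with hM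
  have hupd : ∀ c, M c = (M 0).updateCol (Sum.inr 0) (Sum.elim c 0) := by
    intro c
    ext (a | a) (b | b)
    · simp [hM]
    · rw [Subsingleton.elim b 0]; simp [hM]
    · simp [hM]
    · rw [Subsingleton.elim b 0]; simp [hM]
  have hc : (Sum.elim c 0 : n ⊕ Fin 1 → ℂ) =
      ∑ b, c b • (Sum.elim (Pi.single b 1) 0 : n ⊕ Fin 1 → ℂ) := by
    ext (a | a)
    · simp [Finset.sum_apply, Pi.single_apply]
    · simp [Finset.sum_apply]
  change (M c).det = _
  -- By Cramer's rule the determinant is linear in its last column, which reduces it to columns with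
  -- a single nonzero entry.
  rw [hupd, hc, ← Matrix.cramer_apply, map_sum, Finset.sum_apply, ← Finset.sum_neg_distrib]
  refine Finset.sum_congr rfl fun b _ => ?_
  rw [map_smul, Pi.smul_apply, Matrix.cramer_apply, ← hupd, smul_eq_mul,
    show (M (Pi.single b 1)).det = _ from det_bordered_single F r b, mul_neg]

end determinants

/-- A function on spin configurations which is multiplied by a constant when a spin is lowered. -/
lemma eq_mul_prod_of_update {n : ℕ} {f : (Fin n → Fin 2) → ℂ} {r : Fin n → ℂ}
    (hf : ∀ h a, h a = 0 → f (Function.update h a 1) = r a * f h) (h : Fin n → Fin 2) :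
    f h = f (fun _ => 0) * ∏ a, r a ^ (h a : ℕ) := by
  induction h using config_induction_up with
  | h0 => simp
  | step h a ha ih =>
    rw [hf h a ha, ih, ← Finset.mul_prod_erase _ _ (Finset.mem_univ a),
      ← Finset.mul_prod_erase _ (fun b => r b ^ (Function.update h a 1 b : ℕ)) (Finset.mem_univ a),
      Function.update_self, ha]
    have hprod : ∏ b ∈ Finset.univ.erase a, r b ^ (Function.update h a 1 b : ℕ) =
        ∏ b ∈ Finset.univ.erase a, r b ^ (h b : ℕ) := Finset.prod_congr rfl fun b hb => by
      rw [Function.update_of_ne (Finset.ne_of_mem_erase hb)]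
    rw [hprod]
    simp only [Fin.val_zero, Fin.val_one, pow_zero, pow_one]
    ring

/-! ### Interpolation by theta functions of order N, and invertibility of Θ -/

namespace Model

variable {N : ℕ} (P : Model N)

/-- The row of basis theta functions. -/
def vth (u : ℂ) : Fin N → ℂ := fun j => vartheta N P.ω j (u - P.xibar 0)

lemma Thmat_apply (h : Fin N → Fin 2) (a : Fin N) : P.Thmat 0 h a = P.vth (P.xi a (h a)) := rfl

lemma Thmat_update (h : Fin N → Fin 2) (a : Fin N) (z : Fin 2) :
    P.Thmat 0 (Function.update h a z) = (P.Thmat 0 h).updateRow a (P.vth (P.xi a z)) := by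
  funext b
  by_cases hb : b = a
  · subst hb
    rw [Matrix.updateRow_self, Thmat_apply, Function.update_self]
  · rw [Matrix.updateRow_ne hb, Thmat_apply, Thmat_apply, Function.update_of_ne hb]

lemma xi_zero (a : Fin N) : P.xi a 0 = P.ξ a := by simp [xi]

lemma xi_one (a : Fin N) : P.xi a 1 = P.ξ a - P.η := by simp [xi]

/-- Interpolation of a combination of the basis theta functions. -/
lemma interpolation {f : ℂ → ℂ} {c : Fin N → ℂ} (hf : ∀ u, f u = P.vth u ⬝ᵥ c)
    (h : Fin N → Fin 2) (u : ℂ) : f u * (P.Thmat 0 h).det =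
      ∑ b, f (P.xi b (h b)) * ((P.Thmat 0 h).updateRow b (P.vth u)).det := by
  rw [hf u]
  refine dotProduct_mul_det (funext fun a => ?_) (P.vth u)
  rw [hf]
  rfl

variable {P} (hP : P.Generic)
include hP

lemma Generic.theta_sub_ne_zero {a b : Fin N} (hab : a ≠ b) :
    theta P.ω (P.ξ a - P.ξ b) ≠ 0 ∧ theta P.ω (P.ξ a - P.ξ b + P.η) ≠ 0 ∧
      theta P.ω (P.ξ a - P.ξ b - P.η) ≠ 0 :=
  ⟨theta_ne_zero hP.im_pos (hP.inhom a b hab).2.1, theta_ne_zero hP.im_pos (hP.inhom a b hab).2.2,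
    theta_ne_zero hP.im_pos (hP.inhom a b hab).1⟩

lemma isThetaFn_prod (ys : Fin N → ℂ) (l : List (Fin N)) :
    IsThetaFn P.ω l.length (l.map ys).sum fun u => (l.map fun m => theta P.ω (u - ys m)).prod := by
  induction l with
  | nil => simpa using IsThetaFn.one P.ω
  | cons a l ih =>
    convert ih.mul_theta hP.im_pos (ys a) using 1
    · simp
    · simp [add_comm]
    · funext u
      simp [mul_comm]

variable [NeZero N]

lemma Generic.inhomGeneric : (P.weights hP.im_pos).InhomGeneric P.seq N := fun a b hab => by
  rw [seq_val, seq_val]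
  exact ⟨(hP.theta_sub_ne_zero hab).1, (hP.theta_sub_ne_zero hab).2.1⟩

/-- For each i there is a function in the span of the ϑ_j vanishing at all nodes except the i-th:
the product of θ(u - y_m) over m ≠ i times one factor θ(u - x). Pairing it with a left null vector w
shows w_i = 0. Its value at y_i is nonzero because y_i - x = -(t_0 + η · downs h) is not in the
lattice. -/
lemma Generic.det_Thmat_ne_zero (h : Fin N → Fin 2) : (P.Thmat 0 h).det ≠ 0 := by
  intro h0
  obtain ⟨w, hw, hw0⟩ := Matrix.exists_vecMul_eq_zero_iff.mpr h0
  refine hw (funext fun i => ?_)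
  set l := (List.finRange N).erase i with hl
  have hlen : l.length + 1 = N := by
    rw [hl, List.length_erase_of_mem (List.mem_finRange i), List.length_finRange]
    have := i.pos
    omega
  have hmem : ∀ m, m ∈ l ↔ m ≠ i := fun m => by
    rw [hl, (List.nodup_finRange N).mem_erase_iff]
    simp
  set ys : Fin N → ℂ := fun m => P.xi m (h m) with hys
  -- The last zero is forced: the norm of the product has to be ∑ξ + t_0.
  set x := ∑ a, P.ξ a + P.t0 - (l.map ys).sum with hx
  have hf := (isThetaFn_prod hP ys l).mul_theta hP.im_pos x
  rw [hlen, hx, add_sub_cancel] at hf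
  obtain ⟨c, hc⟩ := hf.exists_eq_sum_vartheta
  rw [← xibar_zero] at hc
  have hval : ∀ m, P.Thmat 0 h m ⬝ᵥ c =
      (l.map fun m' => theta P.ω (ys m - ys m')).prod * theta P.ω (ys m - x) := by
    intro m
    rw [hc, dotProduct]
    exact Finset.sum_congr rfl fun j _ => mul_comm _ _
  have hsum : ∑ m, w m * (P.Thmat 0 h m ⬝ᵥ c) = 0 := by
    have : (w ᵥ* P.Thmat 0 h) ⬝ᵥ c = 0 := by rw [hw0, zero_dotProduct]
    rw [← Matrix.dotProduct_mulVec] at this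
    exact this
  rw [Finset.sum_eq_single i] at hsum
  · refine (mul_eq_zero.mp hsum).resolve_right ?_
    rw [hval]
    refine mul_ne_zero ?_ ?_
    · refine List.prod_ne_zero fun hz => ?_
      obtain ⟨m, hm, hz⟩ := List.mem_map.mp hz
      have hmi := (hmem m).mp hm
      obtain ⟨h1, h2, h3⟩ := hP.theta_sub_ne_zero hmi.symm
      simp only [hys, xi] at hz
      rcases Fin.exists_fin_two.mp ⟨h i, rfl⟩ with hi | hi <;>
        rcases Fin.exists_fin_two.mp ⟨h m, rfl⟩ with hm | hm <;>
        rw [hi, hm] at hz <;> simp only [Fin.val_zero, Fin.val_one, Nat.cast_zero, Nat.cast_one,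
          mul_zero, mul_one, sub_zero, sub_sub_sub_cancel_right] at hz
      · exact h1 hz
      · exact h2 (by rw [← hz]; ring_nf)
      · exact h3 (by rw [← hz]; ring_nf)
      · exact h1 hz
    · have hsum2 : (l.map ys).sum = ∑ a, ys a - ys i := by
        have := (List.perm_cons_erase (List.mem_finRange i)).map ys |>.sum_eq
        rw [List.map_cons, List.sum_cons, ← hl] at this
        rw [← List.sum_ofFn, List.ofFn_eq_map, this]
        ring
      have hsum3 : ∑ a, ys a = ∑ a, P.ξ a - P.η * downs h := by
        simp only [hys, xi, Finset.sum_sub_distrib, downs]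
        push_cast
        rw [Finset.mul_sum]
      rw [hx, hsum2, hsum3, show ys i - (∑ a, P.ξ a + P.t0 - (∑ a, P.ξ a - P.η * downs h - ys i)) =
        -(P.t0 + downs h * P.η) by ring, theta_neg, neg_ne_zero]
      exact theta_ne_zero hP.im_pos (hP.height_notMem _)
  · intro m _ hmi
    rw [hval, List.prod_eq_zero, zero_mul, mul_zero]
    exact List.mem_map.mpr ⟨m, (hmem m).mpr hmi, by rw [sub_self, theta_zero]⟩
  · simp

end Model

open Matrix

namespace Model

variable {N : ℕ} [NeZero N] {P : Model N} (hP : P.Generic)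

/-! ### The sector of the eigenvalue `xπ + yπω` -/

/-- The operator `𝓒(u)` on the sector. -/
def Generic.C (u : ℂ) : Matrix (Fin N → Fin 2) (Fin N → Fin 2) ℂ :=
  (P.weights hP.im_pos).op P.seq N 1 0 u P.t0

/-- The operator `𝓑(u)` on the sector. -/
def Generic.B (u : ℂ) : Matrix (Fin N → Fin 2) (Fin N → Fin 2) ℂ :=
  (P.weights hP.im_pos).op P.seq N 0 1 u P.t0

/-- The vectors of the separated basis of the sector, up to normalization. -/
def Generic.K (h : Fin N → Fin 2) : (Fin N → Fin 2) → ℂ :=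
  (P.weights hP.im_pos).sepKet P.seq N P.t0 h

/-- The covectors of the separated basis of the sector, up to normalization. -/
def Generic.L (h : Fin N → Fin 2) : (Fin N → Fin 2) → ℂ :=
  (P.weights hP.im_pos).sepBra P.seq N P.t0 h

lemma Generic.C_mulVec_K {h : Fin N → Fin 2} {a : Fin N} (ha : h a = 1) :
    hP.C (P.ξ a - P.η) *ᵥ hP.K h = hP.K (Function.update h a 0) := by
  have := Weights.op_one_zero_mulVec_sepKet hP.inhomGeneric hP.reg_t0 ha
  rwa [seq_val] at this

lemma Generic.C_mulVec_K_eq_zero {h : Fin N → Fin 2} {a : Fin N} (ha : h a = 0) :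
    hP.C (P.ξ a) *ᵥ hP.K h = 0 := by
  have := Weights.op_one_zero_mulVec_sepKet_eq_zero hP.inhomGeneric hP.reg_t0 ha
  rwa [seq_val] at this

lemma Generic.B_mulVec_K_eq_zero {h : Fin N → Fin 2} {a : Fin N} (ha : h a = 1) :
    hP.B (P.ξ a - P.η) *ᵥ hP.K h = 0 := by
  have := Weights.op_zero_one_mulVec_sepKet_eq_zero hP.inhomGeneric hP.reg_t0 ha
  rwa [seq_val] at this

lemma Generic.L_vecMul_C {h : Fin N → Fin 2} {a : Fin N} (ha : h a = 0) :
    hP.L h ᵥ* hP.C (P.ξ a) = hP.L (Function.update h a 1) := by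
  have := Weights.sepBra_vecMul_op_one_zero hP.inhomGeneric hP.reg_t0 ha
  rwa [seq_val] at this

lemma Generic.L_dotProduct_K_of_ne {h k : Fin N → Fin 2} (hne : h ≠ k) :
    hP.L h ⬝ᵥ hP.K k = 0 :=
  Weights.sepBra_dotProduct_sepKet_of_ne hP.inhomGeneric hP.reg_t0 hne

lemma Generic.C_mul_C (a : Fin N) : hP.C (P.ξ a) * hP.C (P.ξ a - P.η) = 0 :=
  Weights.op_mul_op_creation hP.reg_t0 a.isLt (P.seq_val a) 1 0 0 (by simp)

lemma Generic.B_mul_B (a : Fin N) : hP.B (P.ξ a) * hP.B (P.ξ a - P.η) = 0 :=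
  Weights.op_mul_op_creation hP.reg_t0 a.isLt (P.seq_val a) 0 1 1 (by simp)

omit [NeZero N] in
lemma qdet_eq_prod (u : ℂ) : P.qdet u =
    ∏ k : Fin N, theta P.ω (u - P.ξ k + P.η) * theta P.ω (u - P.ξ k - P.η) := by
  rw [qdet, cd, ca, ca, ← Finset.prod_mul_distrib]
  refine Finset.prod_congr rfl fun k _ => ?_
  rw [wa, wa, th, th]
  ring_nf

-- The heights t_0 + mη and t_0 + (N - m)η add up to xπ + yπω, so by quasi-periodicity their ph
-- values differ by a sign independent of m. This makes the quantum determinant a scalar on the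
-- sector.
omit [NeZero N] in
lemma weights_ph_div_ph (m : ℤ) : -((P.weights hP.im_pos).ph (P.t0 + P.η * m) /
    (P.weights hP.im_pos).ph (P.t0 + P.η * (N - m))) = P.sgn := by
  have hne := hP.reg_t0 m
  rw [weights_eta] at hne
  set t := P.t0 + P.η * m with ht
  have h2 : P.t0 + P.η * (N - m) = -t + P.xc * Real.pi + P.yc * (Real.pi * P.ω) := by
    rw [ht, t0]
    ring
  rw [h2]
  have hpi : exp (I * Real.pi) = -1 := by rw [mul_comm, exp_pi_mul_I]
  have hx : theta P.ω (-t + P.xc * Real.pi) = -(-1) ^ (P.x : ℕ) * theta P.ω t := by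
    rw [xc]
    rcases Fin.exists_fin_two.mp ⟨P.x, rfl⟩ with h | h <;> rw [h]
    · simp [theta_neg]
    · simp [theta_add_pi, theta_neg]
  suffices h : (P.weights hP.im_pos).ph t = -P.sgn * (P.weights hP.im_pos).ph
      (-t + P.xc * Real.pi + P.yc * (Real.pi * P.ω)) by
    have hne2 : (P.weights hP.im_pos).ph (-t + P.xc * Real.pi + P.yc * (Real.pi * P.ω)) ≠ 0 := by
      intro h0
      rw [h0, mul_zero] at h
      exact hne h
    rw [h, mul_div_assoc, div_self hne2]
    ring
  have hs : ((-1 : ℂ) ^ (P.x : ℕ)) * (-1) ^ (P.x : ℕ) = 1 := by rw [← mul_pow]; simp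
  rw [weights_ph, weights_ph, sgn, yc]
  rcases Fin.exists_fin_two.mp ⟨P.y, rfl⟩ with hy | hy <;> rw [hy]
  · simp only [Fin.val_zero, Nat.cast_zero, mul_zero, zero_mul, exp_zero, one_mul, add_zero, hx]
    linear_combination -theta P.ω t * hs
  · simp only [Fin.val_one, Nat.cast_one, one_mul, mul_one]
    rw [theta_add_pi_mul, hx]
    have e : exp (I * (-t + P.xc * Real.pi + Real.pi * P.ω)) *
        exp (-(2 * I * (-t + P.xc * Real.pi)) - I * Real.pi * P.ω) =
        exp (I * t) * (-1) ^ (P.x : ℕ) := by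
      rw [← exp_add, show I * (-t + P.xc * Real.pi + Real.pi * P.ω) +
        (-(2 * I * (-t + P.xc * Real.pi)) - I * Real.pi * P.ω) = I * t - P.xc * (I * Real.pi) by
          ring, exp_sub, xc, exp_nat_mul, hpi, div_eq_mul_inv, ← inv_pow]
      norm_num
    have hs2 : (-1 : ℂ) ^ ((P.x : ℕ) + 1 + (P.x : ℕ)) = -1 := by
      rw [pow_add, pow_succ]
      linear_combination -hs
    rw [hs2]
    linear_combination -(-1) ^ (P.x : ℕ) * theta P.ω t * e - exp (I * t) * theta P.ω t * hs

lemma Generic.B_mul_C_add_C_mul_B (a : Fin N) :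
    hP.B (P.ξ a) * hP.C (P.ξ a - P.η) + hP.C (P.ξ a) * hP.B (P.ξ a - P.η) =
      (P.sgn * P.qdet (P.ξ a)) • (1 : Matrix (Fin N → Fin 2) (Fin N → Fin 2) ℂ) := by
  refine (Weights.op_mul_op_quantum_det hP.reg_t0 a.isLt (P.seq_val a)).trans ?_
  rw [← Matrix.diagonal_one, ← Matrix.diagonal_smul]
  refine congrArg Matrix.diagonal (funext fun h => ?_)
  rw [Pi.smul_apply, smul_eq_mul, mul_one, qdet_eq_prod, ← weights_ph_div_ph hP (downs h)]
  simp only [weights_th, weights_eta, seq_val]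
  ring

lemma Generic.B_mulVec_K {h : Fin N → Fin 2} {a : Fin N} (ha : h a = 0) :
    hP.B (P.ξ a) *ᵥ hP.K h = (P.sgn * P.qdet (P.ξ a)) • hP.K (Function.update h a 1) := by
  have := Weights.op_zero_one_mulVec_sepKet (Q := P.sgn * P.qdet (P.ξ a)) hP.inhomGeneric
    hP.reg_t0 ha
  rw [seq_val] at this
  exact this (hP.B_mul_C_add_C_mul_B a)

omit [NeZero N] in
lemma sgn_ne_zero : P.sgn ≠ 0 := pow_ne_zero _ (by norm_num)

omit [NeZero N] in
lemma sgn_mul_sgn : P.sgn * P.sgn = 1 := by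
  rw [sgn, ← mul_pow]
  simp

omit [NeZero N] in
include hP in
lemma Generic.theta_eta_ne_zero : theta P.ω P.η ≠ 0 := theta_ne_zero hP.im_pos hP.eta_notMem

omit [NeZero N] in
lemma ca_xi (a : Fin N) : P.ca (P.ξ a) = ∏ b, theta P.ω (P.ξ a - P.ξ b + P.η) := rfl

omit [NeZero N] in
lemma cd_xi (a : Fin N) : P.cd (P.ξ a - P.η) = ∏ b, theta P.ω (P.ξ a - P.ξ b - P.η) := by
  rw [cd, ca]
  refine Finset.prod_congr rfl fun k _ => ?_
  rw [wa, th]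
  ring_nf

omit [NeZero N] in
include hP in
lemma Generic.ca_ne_zero (a : Fin N) : P.ca (P.ξ a) ≠ 0 := by
  rw [ca_xi]
  refine Finset.prod_ne_zero_iff.mpr fun b _ => ?_
  rcases eq_or_ne a b with rfl | hab
  · simpa using hP.theta_eta_ne_zero
  · exact (hP.theta_sub_ne_zero hab).2.1

omit [NeZero N] in
include hP in
lemma Generic.cd_ne_zero (a : Fin N) : P.cd (P.ξ a - P.η) ≠ 0 := by
  rw [cd_xi]
  refine Finset.prod_ne_zero_iff.mpr fun b _ => ?_
  rcases eq_or_ne a b with rfl | hab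
  · rw [sub_self, zero_sub, theta_neg]
    exact neg_ne_zero.mpr hP.theta_eta_ne_zero
  · exact (hP.theta_sub_ne_zero hab).2.2

omit [NeZero N] in
include hP in
lemma Generic.sgn_mul_qdet_ne_zero (a : Fin N) : P.sgn * P.qdet (P.ξ a) ≠ 0 :=
  mul_ne_zero sgn_ne_zero (mul_ne_zero (hP.ca_ne_zero a) (hP.cd_ne_zero a))

/-! ### Interpolation of the matrix elements -/

omit [NeZero N] in
lemma exists_eq_vth_dotProduct {M : ℂ → Matrix (Fin N → Fin 2) (Fin N → Fin 2) ℂ}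
    (hM : ∀ h' h, ∃ b : Fin N → ℂ, ∀ u, exp (I * P.yc * u) * M u h' h =
      ∑ j : Fin N, b j * vartheta N P.ω j (u - P.xibar 0)) (φ v : (Fin N → Fin 2) → ℂ) :
    ∃ c : Fin N → ℂ, ∀ u, exp (I * P.yc * u) * (φ ⬝ᵥ M u *ᵥ v) = P.vth u ⬝ᵥ c := by
  choose b hb using hM
  refine ⟨∑ h', ∑ h, (φ h' * v h) • b h' h, fun u => ?_⟩
  simp only [dotProduct_sum, dotProduct_smul]
  simp only [dotProduct, Matrix.mulVec, Finset.mul_sum]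
  refine Finset.sum_congr rfl fun h' _ => Finset.sum_congr rfl fun h _ => ?_
  rw [show exp (I * P.yc * u) * (φ h' * (M u h' h * v h)) =
    φ h' * v h * (exp (I * P.yc * u) * M u h' h) by ring, hb, smul_eq_mul]
  exact congrArg _ (Finset.sum_congr rfl fun j _ => mul_comm _ _)

omit [NeZero N] in
lemma height_condition (h' : Fin N → Fin 2) :
    P.t0 + P.η * downs h' + P.η * totalSpin h' / 2 = P.t0 + N * P.η / 2 := by
  rw [totalSpin_eq_downs]
  push_cast
  ring

lemma Generic.C_interpolation (φ v : (Fin N → Fin 2) → ℂ) (h : Fin N → Fin 2) (u : ℂ) :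
    exp (I * P.yc * u) * (φ ⬝ᵥ hP.C u *ᵥ v) * (P.Thmat 0 h).det =
      ∑ b, exp (I * P.yc * P.xi b (h b)) * (φ ⬝ᵥ hP.C (P.xi b (h b)) *ᵥ v) *
        ((P.Thmat 0 h).updateRow b (P.vth u)).det := by
  obtain ⟨c, hc⟩ := exists_eq_vth_dotProduct (M := hP.C)
    (fun h' h => P.exists_chain_one_zero hP.im_pos _ h' h (height_condition h')) φ v
  exact P.interpolation hc h u

lemma Generic.B_interpolation (φ v : (Fin N → Fin 2) → ℂ) (h : Fin N → Fin 2) (u : ℂ) :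
    exp (I * P.yc * u) * (φ ⬝ᵥ hP.B u *ᵥ v) * (P.Thmat 0 h).det =
      ∑ b, exp (I * P.yc * P.xi b (h b)) * (φ ⬝ᵥ hP.B (P.xi b (h b)) *ᵥ v) *
        ((P.Thmat 0 h).updateRow b (P.vth u)).det := by
  obtain ⟨c, hc⟩ := exists_eq_vth_dotProduct (M := hP.B)
    (fun h' h => P.exists_chain_zero_one hP.im_pos _ h' h (height_condition h')) φ v
  exact P.interpolation hc h u

/-- The nodes are matched to h: at ξ_b^{(h_b)} the matrix C raises the label b of K h if h b = 1 and
kills K h otherwise. The same nodes serve for B with the two cases exchanged. -/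
lemma Generic.C_K_interpolation (φ : (Fin N → Fin 2) → ℂ) (h : Fin N → Fin 2) (u : ℂ) :
    exp (I * P.yc * u) * (φ ⬝ᵥ hP.C u *ᵥ hP.K h) * (P.Thmat 0 h).det =
      ∑ b, if h b = 1 then exp (I * P.yc * (P.ξ b - P.η)) *
        (φ ⬝ᵥ hP.K (Function.update h b 0)) *
          ((P.Thmat 0 h).updateRow b (P.vth u)).det else 0 := by
  rw [hP.C_interpolation φ (hP.K h) h u]
  refine Finset.sum_congr rfl fun b _ => ?_
  split_ifs with hb
  · rw [hb, xi_one, hP.C_mulVec_K hb]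
  · have hb0 := fin_two_eq_zero_of_ne hb
    rw [hb0, xi_zero, hP.C_mulVec_K_eq_zero hb0, dotProduct_zero, mul_zero, zero_mul]

lemma Generic.B_K_interpolation (φ : (Fin N → Fin 2) → ℂ) (h : Fin N → Fin 2) (u : ℂ) :
    exp (I * P.yc * u) * (φ ⬝ᵥ hP.B u *ᵥ hP.K h) * (P.Thmat 0 h).det =
      ∑ b, if h b = 0 then exp (I * P.yc * P.ξ b) * (P.sgn * P.qdet (P.ξ b) *
        (φ ⬝ᵥ hP.K (Function.update h b 1))) *
          ((P.Thmat 0 h).updateRow b (P.vth u)).det else 0 := by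
  rw [hP.B_interpolation φ (hP.K h) h u]
  refine Finset.sum_congr rfl fun b _ => ?_
  split_ifs with hb
  · rw [hb, xi_zero, hP.B_mulVec_K hb, dotProduct_smul, smul_eq_mul]
  · have hb1 := fin_two_eq_one_of_ne hb
    rw [hb1, xi_one, hP.B_mulVec_K_eq_zero hb1, dotProduct_zero, mul_zero, zero_mul]

/-! ### The pairing of the separated bases -/

/-- The pairing of the vectors of the separated bases. -/
def Generic.pairing (h : Fin N → Fin 2) : ℂ := hP.L h ⬝ᵥ hP.K h

/-- Raising a label is undone, up to a nonzero quantum determinant, by B(ξ_a). -/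
lemma Generic.K_ne_zero (h : Fin N → Fin 2) : hP.K h ≠ 0 := by
  induction h using config_induction_down with
  | h1 =>
    intro h0
    have := congrFun h0 fun _ => 1
    rw [Generic.K, Weights.sepKet_one, Pi.single_eq_same] at this
    exact one_ne_zero this
  | step h a ha ih =>
    intro h0
    have := hP.B_mulVec_K (h := Function.update h a 0) (a := a) (Function.update_self ..)
    rw [h0, Matrix.mulVec_zero, Function.update_idem, ← ha, Function.update_eq_self] at this
    exact smul_ne_zero (hP.sgn_mul_qdet_ne_zero a) ih this.symm

/-- K 0 is nonzero and supported on configurations without down spins, that is, on the all-up one,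
which is dual to L 0. -/
lemma Generic.pairing_zero_ne_zero : hP.pairing (fun _ => 0) ≠ 0 := by
  have hK := hP.K_ne_zero fun _ => 0
  obtain ⟨h'', hne⟩ := Function.ne_iff.mp hK
  have hd := Weights.downs_of_sepKet_ne_zero hP.inhomGeneric hP.reg_t0 _ h'' hne
  have h0 : h'' = fun _ => 0 := by
    by_contra hn
    have := downs_lt_of_le_of_ne (h := fun _ => 0) (k := h'') (fun _ h => absurd h (by simp))
      (Ne.symm hn)
    omega
  subst h0
  rw [Generic.pairing, Generic.L, Weights.sepBra_zero, single_dotProduct, one_mul]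
  exact hne

/-- The element of C(ξ_a) between L h and K with label a lowered is computed twice: acting to the
left it is the new pairing, while interpolation to the right leaves by orthogonality only the term b
= a, which contains the old pairing. -/
lemma Generic.pairing_update {h : Fin N → Fin 2} {a : Fin N} (ha : h a = 0) :
    hP.pairing (Function.update h a 1) * (P.Thmat 0 (Function.update h a 1)).det =
      exp (-(I * P.yc * P.η)) * (hP.pairing h * (P.Thmat 0 h).det) := by
  have key := hP.C_K_interpolation (hP.L h) (Function.update h a 1) (P.ξ a)
  have hL : hP.L h ⬝ᵥ hP.C (P.ξ a) *ᵥ hP.K (Function.update h a 1) =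
      hP.pairing (Function.update h a 1) := by
    rw [Matrix.dotProduct_mulVec, hP.L_vecMul_C ha, Generic.pairing]
  rw [hL, Finset.sum_eq_single a] at key
  · have hu : Function.update h a 0 = h := by rw [← ha, Function.update_eq_self]
    rw [Function.update_self, if_pos rfl, Function.update_idem, hu, P.Thmat_update h a 1,
      Matrix.updateRow_idem, ← P.Thmat_update h a 1, ← P.xi_zero a, ← P.Thmat_update h a 0, hu] at key
    rw [P.xi_zero, mul_sub, sub_eq_add_neg, exp_add] at key
    refine mul_left_cancel₀ (exp_ne_zero (I * P.yc * P.ξ a)) ?_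
    change _ = _ * (_ * ((hP.L h ⬝ᵥ hP.K h) * _))
    linear_combination key
  · intro b _ hba
    split_ifs with hb
    · rw [hP.L_dotProduct_K_of_ne, mul_zero, zero_mul]
      intro heq
      have := congrFun heq a
      rw [Function.update_of_ne hba.symm, Function.update_self, ha] at this
      exact zero_ne_one this
    · rfl
  · simp

/-- The constant `⟨0|0⟩ det Θ^{(0)}`. -/
def Generic.pairingDet : ℂ := hP.pairing (fun _ => 0) * (P.Thmat 0 fun _ => 0).det

lemma Generic.pairingDet_ne_zero : hP.pairingDet ≠ 0 :=
  mul_ne_zero hP.pairing_zero_ne_zero (hP.det_Thmat_ne_zero _)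

lemma Generic.pairing_mul_det (h : Fin N → Fin 2) :
    hP.pairing h * (P.Thmat 0 h).det =
      hP.pairingDet * ∏ a, exp (-(I * P.yc * P.η)) ^ (h a : ℕ) :=
  eq_mul_prod_of_update (f := fun h => hP.pairing h * (P.Thmat 0 h).det)
    (fun _ _ ha => hP.pairing_update ha) h

lemma Generic.pairing_ne_zero (h : Fin N → Fin 2) : hP.pairing h ≠ 0 := by
  have := hP.pairing_mul_det h
  intro h0
  rw [h0, zero_mul] at this
  refine mul_ne_zero hP.pairingDet_ne_zero ?_ this.symm
  exact Finset.prod_ne_zero_iff.mpr fun a _ => pow_ne_zero _ (exp_ne_zero _)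

/-- The inverse pairing is the weight in the resolution of the identity; it is the source of det
Θ^{(h)} in the separate states. -/
lemma Generic.inv_pairing (h : Fin N → Fin 2) : (hP.pairing h)⁻¹ =
    hP.pairingDet⁻¹ * (∏ a, exp (I * P.yc * P.η) ^ (h a : ℕ)) * (P.Thmat 0 h).det := by
  have h1 := hP.pairing_mul_det h
  have h2 : (∏ a, exp (-(I * P.yc * P.η)) ^ (h a : ℕ)) *
      (∏ a, exp (I * P.yc * P.η) ^ (h a : ℕ)) = 1 := by
    rw [← Finset.prod_mul_distrib]
    refine Finset.prod_eq_one fun a _ => ?_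
    rw [← mul_pow, ← exp_add, neg_add_cancel, exp_zero, one_pow]
  refine inv_eq_of_mul_eq_one_right ?_
  have := hP.pairingDet_ne_zero
  rw [show hP.pairing h * (hP.pairingDet⁻¹ * (∏ a, exp (I * P.yc * P.η) ^ (h a : ℕ)) *
    (P.Thmat 0 h).det) = hP.pairingDet⁻¹ * (∏ a, exp (I * P.yc * P.η) ^ (h a : ℕ)) *
    (hP.pairing h * (P.Thmat 0 h).det) by ring, h1]
  field_simp
  linear_combination h2

end Model

open Matrix

namespace Model

variable {N : ℕ} [NeZero N] {P : Model N} (hP : P.Generic)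

/-! ### Completeness of the separated bases -/

/-- Biorthogonality gives a one-sided inverse of a square matrix, hence a two-sided one. -/
lemma Generic.sum_K_mul_L (h'' h' : Fin N → Fin 2) :
    ∑ h, hP.K h h'' * ((hP.pairing h)⁻¹ * hP.L h h') =
      (1 : Matrix (Fin N → Fin 2) (Fin N → Fin 2) ℂ) h'' h' := by
  have h1 : (Matrix.of fun h h' => (hP.pairing h)⁻¹ * hP.L h h') *
      (Matrix.of fun h'' h => hP.K h h'') = 1 := by
    ext h k
    rw [Matrix.mul_apply]
    simp only [Matrix.of_apply, mul_assoc, ← Finset.mul_sum]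
    change (hP.pairing h)⁻¹ * (hP.L h ⬝ᵥ hP.K k) = _
    rcases eq_or_ne h k with rfl | hne
    · rw [Matrix.one_apply_eq]
      exact inv_mul_cancel₀ (hP.pairing_ne_zero h)
    · rw [hP.L_dotProduct_K_of_ne hne, mul_zero, Matrix.one_apply_ne hne]
  rw [← mul_eq_one_comm.mp h1]
  rfl

lemma Generic.eq_sum_K (v : (Fin N → Fin 2) → ℂ) :
    v = ∑ h, ((hP.pairing h)⁻¹ * (hP.L h ⬝ᵥ v)) • hP.K h := by
  funext h''
  rw [Finset.sum_apply]
  simp only [Pi.smul_apply, smul_eq_mul, dotProduct, Finset.mul_sum, Finset.sum_mul]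
  rw [Finset.sum_comm]
  have : ∀ h', ∑ h, (hP.pairing h)⁻¹ * (hP.L h h' * v h') * hP.K h h'' =
      (1 : Matrix (Fin N → Fin 2) (Fin N → Fin 2) ℂ) h'' h' * v h' := fun h' => by
    rw [← hP.sum_K_mul_L, Finset.sum_mul]
    exact Finset.sum_congr rfl fun h _ => by ring
  rw [Finset.sum_congr rfl fun h' _ => this h']
  exact (congrFun (Matrix.one_mulVec v) h'').symm

lemma Generic.eq_sum_L (φ : (Fin N → Fin 2) → ℂ) :
    φ = ∑ h, ((hP.pairing h)⁻¹ * (φ ⬝ᵥ hP.K h)) • hP.L h := by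
  funext h'
  rw [Finset.sum_apply]
  simp only [Pi.smul_apply, smul_eq_mul, dotProduct, Finset.mul_sum, Finset.sum_mul]
  rw [Finset.sum_comm]
  have : ∀ h'', ∑ h, (hP.pairing h)⁻¹ * (φ h'' * hP.K h h'') * hP.L h h' =
      φ h'' * (1 : Matrix (Fin N → Fin 2) (Fin N → Fin 2) ℂ) h'' h' := fun h'' => by
    rw [← hP.sum_K_mul_L, Finset.mul_sum]
    exact Finset.sum_congr rfl fun h _ => by ring
  rw [Finset.sum_congr rfl fun h' _ => this h']
  exact (congrFun (Matrix.vecMul_one φ) h').symm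

/-- Tested against every K k. If k a = 0, B(ξ_a) sets that label to 1 and orthogonality applies. If
k a = 1, interpolation changes only labels at other sites, so the label at a still differs from h a
= 0. -/
lemma Generic.L_vecMul_B_eq_zero {h : Fin N → Fin 2} {a : Fin N} (ha : h a = 0) :
    hP.L h ᵥ* hP.B (P.ξ a) = 0 := by
  rw [hP.eq_sum_L (hP.L h ᵥ* hP.B (P.ξ a))]
  refine Finset.sum_eq_zero fun k _ => ?_
  have hz : hP.L h ⬝ᵥ hP.B (P.ξ a) *ᵥ hP.K k = 0 := by
    by_cases hk : k a = 0
    · rw [hP.B_mulVec_K hk, dotProduct_smul, hP.L_dotProduct_K_of_ne, smul_zero]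
      intro heq
      rw [heq, Function.update_self] at ha
      exact one_ne_zero ha
    · have key := hP.B_K_interpolation (hP.L h) k (P.ξ a)
      rw [Finset.sum_eq_zero] at key
      · exact (mul_eq_zero.mp ((mul_eq_zero.mp key).resolve_right
          (hP.det_Thmat_ne_zero k))).resolve_left (exp_ne_zero _)
      · intro b _
        split_ifs with hb
        · rw [hP.L_dotProduct_K_of_ne, mul_zero, mul_zero, zero_mul]
          intro heq
          have hab : a ≠ b := by
            rintro rfl
            exact hk hb
          rw [heq, Function.update_of_ne hab] at ha
          exact hk ha
        · rfl
  rw [← Matrix.dotProduct_mulVec, hz, mul_zero, zero_smul]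

/-! ### Eigenstates of the antiperiodic transfer matrix -/

/-- The antiperiodic transfer matrix on the sector. -/
def Generic.T (κ u : ℂ) : Matrix (Fin N → Fin 2) (Fin N → Fin 2) ℂ := κ⁻¹ • hP.B u + κ • hP.C u

variable {κ : ℂ} (hκ : κ ≠ 0) {t : ℂ → ℂ}
include hκ

/-- Only the mixed products survive, and in them the twist cancels. -/
lemma Generic.T_mul_T (a : Fin N) : hP.T κ (P.ξ a) * hP.T κ (P.ξ a - P.η) =
    (P.sgn * P.qdet (P.ξ a)) • (1 : Matrix (Fin N → Fin 2) (Fin N → Fin 2) ℂ) := by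
  rw [← hP.B_mul_C_add_C_mul_B a, Generic.T, Generic.T, add_mul, mul_add, mul_add]
  simp only [smul_mul_assoc, mul_smul_comm, hP.B_mul_B, hP.C_mul_C, smul_zero, zero_add, add_zero,
    smul_smul, inv_mul_cancel₀ hκ, mul_inv_cancel₀ hκ, one_smul]

section left

variable {φ : (Fin N → Fin 2) → ℂ} (hφ : ∀ u, φ ᵥ* hP.T κ u = t u • φ)
include hφ

lemma Generic.left_quantum_det (hne : φ ≠ 0) (a : Fin N) :
    t (P.ξ a) * t (P.ξ a - P.η) = P.sgn * P.qdet (P.ξ a) := by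
  have h1 : φ ᵥ* (hP.T κ (P.ξ a) * hP.T κ (P.ξ a - P.η)) =
      (t (P.ξ a) * t (P.ξ a - P.η)) • φ := by
    rw [← Matrix.vecMul_vecMul, hφ, Matrix.smul_vecMul, hφ, smul_smul]
  rw [hP.T_mul_T hκ, Matrix.vecMul_smul, Matrix.vecMul_one] at h1
  exact (smul_left_injective ℂ hne h1).symm

/-- On a vector with label 1 at a, B(ξ_a - η) vanishes, so T(ξ_a - η) reduces to κC(ξ_a - η), which
flips the label; this is a first-order recursion at each site separately. -/
lemma Generic.left_dotProduct_K (hne : φ ≠ 0) (h : Fin N → Fin 2) :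
    φ ⬝ᵥ hP.K h = (φ ⬝ᵥ hP.K fun _ => 0) * ∏ a, (κ / t (P.ξ a - P.η)) ^ (h a : ℕ) := by
  refine eq_mul_prod_of_update (f := fun h => φ ⬝ᵥ hP.K h) (fun h a ha => ?_) h
  have ht : t (P.ξ a - P.η) ≠ 0 := by
    intro h0
    have := hP.left_quantum_det hκ hφ hne a
    rw [h0, mul_zero] at this
    exact hP.sgn_mul_qdet_ne_zero a this.symm
  have key : φ ⬝ᵥ hP.T κ (P.ξ a - P.η) *ᵥ hP.K (Function.update h a 1) =
      t (P.ξ a - P.η) * (φ ⬝ᵥ hP.K (Function.update h a 1)) := by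
    rw [Matrix.dotProduct_mulVec, hφ, smul_dotProduct, smul_eq_mul]
  rw [Generic.T, Matrix.add_mulVec, Matrix.smul_mulVec, Matrix.smul_mulVec,
    hP.B_mulVec_K_eq_zero (Function.update_self ..), hP.C_mulVec_K (Function.update_self ..),
    smul_zero, zero_add, Function.update_idem, dotProduct_smul, smul_eq_mul,
    show Function.update h a 0 = h by rw [← ha, Function.update_eq_self]] at key
  rw [div_mul_eq_mul_div, key, mul_div_cancel_left₀ _ ht]

lemma Generic.left_ne_zero (hne : φ ≠ 0) : (φ ⬝ᵥ hP.K fun _ => 0) ≠ 0 := by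
  intro h0
  refine hne ?_
  rw [hP.eq_sum_L φ]
  refine Finset.sum_eq_zero fun h _ => ?_
  rw [hP.left_dotProduct_K hκ hφ hne, h0, zero_mul, mul_zero, zero_smul]

end left

section right

variable {v : (Fin N → Fin 2) → ℂ} (hv : ∀ u, hP.T κ u *ᵥ v = t u • v)
include hv

lemma Generic.right_quantum_det (hne : v ≠ 0) (a : Fin N) :
    t (P.ξ a) * t (P.ξ a - P.η) = P.sgn * P.qdet (P.ξ a) := by
  have h1 : (hP.T κ (P.ξ a) * hP.T κ (P.ξ a - P.η)) *ᵥ v =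
      (t (P.ξ a - P.η) * t (P.ξ a)) • v := by
    rw [← Matrix.mulVec_mulVec, hv, Matrix.mulVec_smul, hv, smul_smul]
  rw [hP.T_mul_T hκ, Matrix.smul_mulVec, Matrix.one_mulVec] at h1
  rw [mul_comm]
  exact (smul_left_injective ℂ hne h1).symm

/-- The dual recursion: a covector with label 0 at a is killed by B(ξ_a), so T(ξ_a) reduces to
κC(ξ_a). -/
lemma Generic.L_dotProduct_right (h : Fin N → Fin 2) :
    hP.L h ⬝ᵥ v = (hP.L (fun _ => 0) ⬝ᵥ v) * ∏ a, (t (P.ξ a) / κ) ^ (h a : ℕ) := by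
  refine eq_mul_prod_of_update (f := fun h => hP.L h ⬝ᵥ v) (fun h a ha => ?_) h
  have key : (hP.L h ᵥ* hP.T κ (P.ξ a)) ⬝ᵥ v = t (P.ξ a) * (hP.L h ⬝ᵥ v) := by
    rw [← Matrix.dotProduct_mulVec, hv, dotProduct_smul, smul_eq_mul]
  rw [Generic.T, Matrix.vecMul_add, Matrix.vecMul_smul, Matrix.vecMul_smul,
    hP.L_vecMul_B_eq_zero ha, hP.L_vecMul_C ha, smul_zero, zero_add, smul_dotProduct,
    smul_eq_mul] at key
  rw [div_mul_eq_mul_div, ← key, mul_div_cancel_left₀ _ hκ]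

lemma Generic.right_ne_zero (hne : v ≠ 0) : hP.L (fun _ => 0) ⬝ᵥ v ≠ 0 := by
  intro h0
  refine hne ?_
  rw [hP.eq_sum_K v]
  refine Finset.sum_eq_zero fun h _ => ?_
  rw [hP.L_dotProduct_right hκ hv, h0, zero_mul, mul_zero, zero_smul]

-- The eigenvalue at ξ_a - η is replaced by T(ξ_a - η) next to v. Since CC = BB = 0, only a mixed
-- product remains, and in it the left factor may be completed to T(ξ_a). This trades ξ_a for ξ_a -
-- η and C for B.
omit hκ in
lemma Generic.B_mulVec_right (a : Fin N) :
    t (P.ξ a - P.η) • (κ • hP.C (P.ξ a) *ᵥ v) =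
      hP.T κ (P.ξ a) *ᵥ (κ⁻¹ • hP.B (P.ξ a - P.η) *ᵥ v) ∧
    t (P.ξ a - P.η) • (κ⁻¹ • hP.B (P.ξ a) *ᵥ v) =
      hP.T κ (P.ξ a) *ᵥ (κ • hP.C (P.ξ a - P.η) *ᵥ v) := by
  have h1 : ∀ M : Matrix (Fin N → Fin 2) (Fin N → Fin 2) ℂ, t (P.ξ a - P.η) • (M *ᵥ v) =
      (M * hP.T κ (P.ξ a - P.η)) *ᵥ v := fun M => by
    rw [← Matrix.mulVec_mulVec, hv, Matrix.mulVec_smul]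
  simp only [← Matrix.smul_mulVec, h1, Matrix.mulVec_mulVec]
  rw [Generic.T, Generic.T, add_mul, mul_add, add_mul, mul_add]
  simp only [smul_mul_assoc, mul_smul_comm, hP.B_mul_B, hP.C_mul_C, smul_zero, zero_add, add_zero]
  exact ⟨trivial, trivial⟩

end right

end Model

open Matrix

/-- A replaced row is encoded by concentrating the weights of row b on the single index k₀. The
resulting restriction h b = k₀ is the one found in the interpolation formulas. -/
lemma det_updateRow_sum_rows {n ι : Type*} [Fintype n] [DecidableEq n] [Fintype ι] [DecidableEq ι]
    (w : n → ι → ℂ) (r : n → ι → n → ℂ) (b : n) (k₀ : ι) (x : n → ℂ) :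
    ((Matrix.of fun a => ∑ k, w a k • r a k).updateRow b x).det =
      ∑ h : n → ι, if h b = k₀ then (∏ a ∈ Finset.univ.erase b, w a (h a)) *
        ((Matrix.of fun a => r a (h a)).updateRow b x).det else 0 := by
  have h1 : (Matrix.of fun a => ∑ k, w a k • r a k).updateRow b x =
      Matrix.of fun a => ∑ k, Function.update w b (Pi.single k₀ 1) a k •
        Function.update r b (fun _ => x) a k := by
    ext a j
    by_cases hab : a = b
    · subst hab
      simp [Pi.single_apply, Finset.sum_apply, ite_apply]
    · simp [hab]
  rw [h1, det_sum_rows]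
  refine Finset.sum_congr rfl fun h _ => ?_
  have h2 : (Matrix.of fun a => Function.update r b (fun _ => x) a (h a)) =
      (Matrix.of fun a => r a (h a)).updateRow b x := by
    ext a j
    by_cases hab : a = b
    · subst hab; simp
    · simp [hab]
  have h3 : ∏ a ∈ Finset.univ.erase b, Function.update w b (Pi.single k₀ 1) a (h a) =
      ∏ a ∈ Finset.univ.erase b, w a (h a) := Finset.prod_congr rfl fun a ha => by
    rw [Function.update_of_ne (Finset.ne_of_mem_erase ha)]
  rw [h2, ← Finset.mul_prod_erase _ _ (Finset.mem_univ b), h3, Function.update_self,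
    Pi.single_apply]
  split_ifs <;> simp

lemma prod_update_config {n : ℕ} (χ : Fin n → Fin 2 → ℂ) (h : Fin n → Fin 2) (b : Fin n)
    (z : Fin 2) : ∏ a, χ a (Function.update h b z a) =
      χ b z * ∏ a ∈ Finset.univ.erase b, χ a (h a) := by
  rw [← Finset.mul_prod_erase _ _ (Finset.mem_univ b), Function.update_self]
  exact congrArg _ (Finset.prod_congr rfl fun a ha => by
    rw [Function.update_of_ne (Finset.ne_of_mem_erase ha)])

namespace Model

variable {N : ℕ} [NeZero N] {P : Model N} (hP : P.Generic)

/-! ### Matrix elements between separate states -/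

section elements

variable {φ v : (Fin N → Fin 2) → ℂ} {X Z : ℂ} {χ ζ : Fin N → Fin 2 → ℂ}
  (hx : ∀ h, φ ⬝ᵥ hP.K h = X * ∏ a, χ a (h a))
  (hv : v = ∑ h, (Z * (∏ a, ζ a (h a)) * (P.Thmat 0 h).det) • hP.K h) (hXZ : X * Z = 1)
include hx hv hXZ

/-- The factor det Θ^{(h)} of the separate vector is the one that interpolation requires, leaving
determinants with row b replaced; multilinearity resums them over h. The label b goes from 1 in v to
0 in the overlap, whence χ b 0 * ζ b 1. -/
lemma Generic.C_element (u : ℂ) : exp (I * P.yc * u) * (φ ⬝ᵥ hP.C u *ᵥ v) =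
    ∑ b, exp (I * P.yc * (P.ξ b - P.η)) * (χ b 0 * ζ b 1) *
      ((Matrix.of fun a => ∑ k, (χ a k * ζ a k) • P.vth (P.xi a k)).updateRow b (P.vth u)).det := by
  simp only [det_updateRow_sum_rows _ _ _ (1 : Fin 2)]
  conv_lhs => rw [hv]
  rw [Matrix.mulVec_sum, dotProduct_sum, Finset.mul_sum]
  simp only [Matrix.mulVec_smul, dotProduct_smul, smul_eq_mul, Finset.mul_sum]
  rw [Finset.sum_comm]
  refine Finset.sum_congr rfl fun h _ => ?_
  rw [show exp (I * P.yc * u) * (Z * (∏ a, ζ a (h a)) * (P.Thmat 0 h).det *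
    (φ ⬝ᵥ hP.C u *ᵥ hP.K h)) = Z * (∏ a, ζ a (h a)) *
      (exp (I * P.yc * u) * (φ ⬝ᵥ hP.C u *ᵥ hP.K h) * (P.Thmat 0 h).det) by ring,
    hP.C_K_interpolation, Finset.mul_sum]
  refine Finset.sum_congr rfl fun b _ => ?_
  split_ifs with hb
  · rw [hx, prod_update_config, ← Finset.mul_prod_erase _ _ (Finset.mem_univ b), hb,
      Finset.prod_mul_distrib]
    change _ = _ * (_ * ((P.Thmat 0 h).updateRow b (P.vth u)).det)
    linear_combination (∏ a ∈ Finset.univ.erase b, ζ a (h a)) *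
      (∏ a ∈ Finset.univ.erase b, χ a (h a)) * exp (I * P.yc * (P.ξ b - P.η)) * χ b 0 * ζ b 1 *
      ((P.Thmat 0 h).updateRow b (P.vth u)).det * hXZ
  · ring

lemma Generic.B_element (u : ℂ) : exp (I * P.yc * u) * (φ ⬝ᵥ hP.B u *ᵥ v) =
    ∑ b, exp (I * P.yc * P.ξ b) * (P.sgn * P.qdet (P.ξ b) * (χ b 1 * ζ b 0)) *
      ((Matrix.of fun a => ∑ k, (χ a k * ζ a k) • P.vth (P.xi a k)).updateRow b (P.vth u)).det := by
  simp only [det_updateRow_sum_rows _ _ _ (0 : Fin 2)]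
  conv_lhs => rw [hv]
  rw [Matrix.mulVec_sum, dotProduct_sum, Finset.mul_sum]
  simp only [Matrix.mulVec_smul, dotProduct_smul, smul_eq_mul, Finset.mul_sum]
  rw [Finset.sum_comm]
  refine Finset.sum_congr rfl fun h _ => ?_
  rw [show exp (I * P.yc * u) * (Z * (∏ a, ζ a (h a)) * (P.Thmat 0 h).det *
    (φ ⬝ᵥ hP.B u *ᵥ hP.K h)) = Z * (∏ a, ζ a (h a)) *
      (exp (I * P.yc * u) * (φ ⬝ᵥ hP.B u *ᵥ hP.K h) * (P.Thmat 0 h).det) by ring,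
    hP.B_K_interpolation, Finset.mul_sum]
  refine Finset.sum_congr rfl fun b _ => ?_
  split_ifs with hb
  · rw [hx, prod_update_config, ← Finset.mul_prod_erase _ _ (Finset.mem_univ b), hb,
      Finset.prod_mul_distrib]
    change _ = _ * (_ * ((P.Thmat 0 h).updateRow b (P.vth u)).det)
    linear_combination (∏ a ∈ Finset.univ.erase b, ζ a (h a)) * (P.sgn * P.qdet (P.ξ b)) *
      (∏ a ∈ Finset.univ.erase b, χ a (h a)) * exp (I * P.yc * P.ξ b) * χ b 1 * ζ b 0 *
      ((P.Thmat 0 h).updateRow b (P.vth u)).det * hXZ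
  · ring

end elements

-- Expansion along the border, in the form in which the matrix elements of B and C appear.
omit [NeZero N] in
lemma det_Smat (q q' : Fin N → Fin 2 → ℂ) (u : ℂ) : exp (I * P.yc * u) * (P.Smat q q' u).det =
    ∑ b, exp (I * P.yc * P.ξ b) * P.caxy (P.ξ b) * q b 0 * q' b 1 *
      ((P.Fmat q q').updateRow b (P.vth u)).det := by
  have h1 := det_bordered (P.Fmat q q')
    (fun a => exp (I * P.yc * P.ξ a) * P.caxy (P.ξ a) * q a 0 * q' a 1)
    (-exp (-(I * P.yc * u)) • P.vth u)
  have h2 : (Matrix.of fun (_ : Fin 1) (b : Fin N) =>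
      -(exp (-(I * P.yc * u)) * vartheta N P.ω (b : ℕ) (u - P.xibar 0))) =
      Matrix.of fun _ => (-exp (-(I * P.yc * u)) • P.vth u) := by
    ext i j
    simp [vth]
  have h3 : exp (I * P.yc * u) * exp (-(I * P.yc * u)) = 1 := by
    rw [← exp_add, add_neg_cancel, exp_zero]
  rw [Smat, h2, h1, ← Finset.sum_neg_distrib, Finset.mul_sum]
  refine Finset.sum_congr rfl fun b _ => ?_
  rw [Matrix.det_updateRow_smul]
  linear_combination exp (I * P.yc * P.ξ b) * P.caxy (P.ξ b) * q b 0 * q' b 1 *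
      ((P.Fmat q q').updateRow b (P.vth u)).det * h3

omit [NeZero N] in
lemma Fmat_comm (q q' : Fin N → Fin 2 → ℂ) : P.Fmat q q' = P.Fmat q' q := by
  ext a b
  simp only [Fmat, Matrix.of_apply]
  exact Finset.sum_congr rfl fun h _ => by ring

/-- The coefficients of a separate covector. -/
def leftCoeff (P : Model N) (κ : ℂ) (q : Fin N → Fin 2 → ℂ) (a : Fin N) (k : Fin 2) : ℂ :=
  (κ / P.cd (P.ξ a - P.η)) ^ (k : ℕ) * q a k

/-- The coefficients of a separate vector. -/
def rightCoeff (P : Model N) (κ : ℂ) (q : Fin N → Fin 2 → ℂ) (a : Fin N) (k : Fin 2) : ℂ :=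
  (κ⁻¹ * exp (I * P.yc * P.η) * P.caxy (P.ξ a)) ^ (k : ℕ) * q a k

section separate

variable {κ : ℂ} (hκ : κ ≠ 0) {q q' : Fin N → Fin 2 → ℂ}
include hκ

omit [NeZero N] in
include hP in
lemma Generic.Fmat_eq : P.Fmat q q' =
    Matrix.of fun a => ∑ k, (P.leftCoeff κ q a k * P.rightCoeff κ q' a k) • P.vth (P.xi a k) := by
  ext a b
  have hd := hP.cd_ne_zero a
  rw [Matrix.of_apply, Finset.sum_apply]
  simp only [Fmat, Matrix.of_apply, leftCoeff, rightCoeff, Fin.sum_univ_two, Fin.val_zero,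
    Fin.val_one, pow_zero, pow_one, one_mul, Pi.smul_apply, smul_eq_mul, vth]
  field_simp

variable {φ v : (Fin N → Fin 2) → ℂ} {X Z : ℂ}
  (hx : ∀ h, φ ⬝ᵥ hP.K h = X * ∏ a, P.leftCoeff κ q a (h a))
  (hv : v = ∑ h, (Z * (∏ a, P.rightCoeff κ q' a (h a)) * (P.Thmat 0 h).det) • hP.K h)
  (hXZ : X * Z = 1)
include hx hv hXZ

lemma Generic.C_element_eq_det (u : ℂ) : φ ⬝ᵥ κ • hP.C u *ᵥ v = (P.Smat q q' u).det := by
  refine mul_left_cancel₀ (exp_ne_zero (I * P.yc * u)) ?_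
  rw [det_Smat, dotProduct_smul, smul_eq_mul, mul_left_comm, hP.C_element hx hv hXZ, hP.Fmat_eq hκ,
    Finset.mul_sum]
  refine Finset.sum_congr rfl fun b _ => ?_
  rw [← mul_assoc]
  congr 1
  have e : exp (I * P.yc * P.ξ b) = exp (I * P.yc * (P.ξ b - P.η)) * exp (I * P.yc * P.η) := by
    rw [← exp_add]
    ring_nf
  simp only [leftCoeff, rightCoeff, Fin.val_zero, Fin.val_one, pow_zero, pow_one, e]
  field_simp

/-- B lowers a label where C raises one, so q and q' exchange roles. The factor 1/d of the left
coefficient cancels the factor d(ξ_b - η) of the quantum determinant. -/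
lemma Generic.B_element_eq_det (u : ℂ) : φ ⬝ᵥ κ⁻¹ • hP.B u *ᵥ v = (P.Smat q' q u).det := by
  refine mul_left_cancel₀ (exp_ne_zero (I * P.yc * u)) ?_
  rw [det_Smat, dotProduct_smul, smul_eq_mul, mul_left_comm, hP.B_element hx hv hXZ, Fmat_comm,
    hP.Fmat_eq hκ, Finset.mul_sum]
  refine Finset.sum_congr rfl fun b _ => ?_
  rw [← mul_assoc]
  congr 1
  have hd := hP.cd_ne_zero b
  simp only [leftCoeff, rightCoeff, Fin.val_zero, Fin.val_one, pow_zero, pow_one, qdet, caxy]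
  field_simp

end separate

/-! ### The eigenstates are separate states -/

-- The two prescriptions for the ratio of the coefficients agree precisely because of the quantum
-- determinant relation for t.
omit [NeZero N] in
lemma IsCoeff.of_quantum_det {t : ℂ → ℂ} {g : Fin N → ℂ} (hg : ∀ a, g a ≠ 0)
    (ht : ∀ a, t (P.ξ a) * t (P.ξ a - P.η) = P.sgn * P.qdet (P.ξ a)) (hP : P.Generic) :
    P.IsCoeff t fun a k => g a * (P.cd (P.ξ a - P.η) / t (P.ξ a - P.η)) ^ (k : ℕ) := by
  have h0 : ∀ a, t (P.ξ a) ≠ 0 ∧ t (P.ξ a - P.η) ≠ 0 := fun a => by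
    have := hP.sgn_mul_qdet_ne_zero a
    rw [← ht] at this
    exact ⟨left_ne_zero_of_mul this, right_ne_zero_of_mul this⟩
  refine ⟨fun a => by simpa using hg a, fun a => ?_, fun a => ?_⟩
  · have := hg a
    simp only [Fin.val_zero, Fin.val_one, pow_zero, pow_one, mul_one]
    field_simp
  · have h1 := hg a
    have h2 := (h0 a).2
    have h3 : P.caxy (P.ξ a) ≠ 0 := mul_ne_zero sgn_ne_zero (hP.ca_ne_zero a)
    simp only [Fin.val_zero, Fin.val_one, pow_zero, pow_one, mul_one]
    rw [mul_div_cancel_left₀ _ h1, div_eq_div_iff h2 h3, ht, caxy, qdet]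
    ring

/-- The coefficients q_a^{(0)} are free up to being nonzero, and their product absorbs the
normalization of an eigenstate. -/
lemma exists_prod_eq {y : ℂ} (hy : y ≠ 0) : ∃ g : Fin N → ℂ, (∀ a, g a ≠ 0) ∧ ∏ a, g a = y := by
  refine ⟨Function.update (fun _ => 1) 0 y, fun a => ?_, ?_⟩
  · by_cases ha : a = 0
    · subst ha; simpa using hy
    · simp [ha]
  · rw [Finset.prod_update_of_mem (Finset.mem_univ _)]
    simp

variable {κ : ℂ} (hκ : κ ≠ 0) {t : ℂ → ℂ} {Y : ℂ} (hY : Y ≠ 0)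
include hκ hY

lemma Generic.exists_left_coeff {φ : (Fin N → Fin 2) → ℂ} (hφ : ∀ u, φ ᵥ* hP.T κ u = t u • φ)
    (hne : φ ≠ 0) : ∃ q, P.IsCoeff t q ∧
      φ = ∑ h, (Y * (∏ a, exp (I * P.yc * P.η) ^ (h a : ℕ) * P.leftCoeff κ q a (h a)) *
        (P.Thmat 0 h).det) • hP.L h := by
  have hM := hP.pairingDet_ne_zero
  obtain ⟨g, hg, hg'⟩ := exists_prod_eq (N := N) (y := (φ ⬝ᵥ hP.K fun _ => 0) / hP.pairingDet / Y)
    (div_ne_zero (div_ne_zero (hP.left_ne_zero hκ hφ hne) hM) hY)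
  refine ⟨_, IsCoeff.of_quantum_det hg (hP.left_quantum_det hκ hφ hne) hP, ?_⟩
  conv_lhs => rw [hP.eq_sum_L φ]
  refine Finset.sum_congr rfl fun h _ => ?_
  congr 1
  rw [hP.inv_pairing, hP.left_dotProduct_K hκ hφ hne]
  have h1 : ∏ a, exp (I * P.yc * P.η) ^ (h a : ℕ) * P.leftCoeff κ (fun a k => g a *
      (P.cd (P.ξ a - P.η) / t (P.ξ a - P.η)) ^ (k : ℕ)) a (h a) =
      (∏ a, exp (I * P.yc * P.η) ^ (h a : ℕ)) * ((∏ a, g a) *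
        ∏ a, (κ / t (P.ξ a - P.η)) ^ (h a : ℕ)) := by
    rw [Finset.prod_mul_distrib, ← Finset.prod_mul_distrib (f := g)]
    congr 1
    refine Finset.prod_congr rfl fun a _ => ?_
    have hd := hP.cd_ne_zero a
    rw [leftCoeff, mul_left_comm, ← mul_pow]
    congr 2
    field_simp
  rw [h1, hg']
  field_simp

/-- The recursion produces t(ξ_a)/κ at each site, and the quantum determinant relation converts
t(ξ_a) into a_xy(ξ_a)d(ξ_a - η)/t(ξ_a - η). -/
lemma Generic.exists_right_coeff {v : (Fin N → Fin 2) → ℂ} (hv : ∀ u, hP.T κ u *ᵥ v = t u • v)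
    (hne : v ≠ 0) : ∃ q, P.IsCoeff t q ∧
      v = ∑ h, (Y * (∏ a, P.rightCoeff κ q a (h a)) * (P.Thmat 0 h).det) • hP.K h := by
  have hM := hP.pairingDet_ne_zero
  obtain ⟨g, hg, hg'⟩ := exists_prod_eq (N := N) (y := (hP.L (fun _ => 0) ⬝ᵥ v) / hP.pairingDet / Y)
    (div_ne_zero (div_ne_zero (hP.right_ne_zero hκ hv hne) hM) hY)
  have hq := hP.right_quantum_det hκ hv hne
  refine ⟨_, IsCoeff.of_quantum_det hg hq hP, ?_⟩
  conv_lhs => rw [hP.eq_sum_K v]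
  refine Finset.sum_congr rfl fun h _ => ?_
  congr 1
  rw [hP.inv_pairing, hP.L_dotProduct_right hκ hv]
  have h1 : ∏ a, P.rightCoeff κ (fun a k => g a *
      (P.cd (P.ξ a - P.η) / t (P.ξ a - P.η)) ^ (k : ℕ)) a (h a) =
      (∏ a, exp (I * P.yc * P.η) ^ (h a : ℕ)) * ((∏ a, g a) *
        ∏ a, (t (P.ξ a) / κ) ^ (h a : ℕ)) := by
    rw [← Finset.prod_mul_distrib, ← Finset.prod_mul_distrib]
    refine Finset.prod_congr rfl fun a _ => ?_
    have ht : t (P.ξ a - P.η) ≠ 0 := by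
      have := hP.sgn_mul_qdet_ne_zero a
      rw [← hq] at this
      exact right_ne_zero_of_mul this
    rw [rightCoeff, mul_left_comm, ← mul_pow, mul_left_comm, ← mul_pow]
    congr 2
    have := hq a
    rw [qdet] at this
    rw [caxy, mul_div_assoc', eq_comm]
    field_simp
    linear_combination this
  rw [h1, hg']
  field_simp

end Model

open Matrix

/-! ### Reconstruction of the local spin projectors -/

/-- The projector on the configurations with a given spin at a given site. -/
def proj {n : ℕ} (a : Fin n) (i : Fin 2) (v : (Fin n → Fin 2) → ℂ) : (Fin n → Fin 2) → ℂ :=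
  fun h => if h a = i then v h else 0

lemma proj_smul {n : ℕ} (a : Fin n) (i : Fin 2) (c : ℂ) (v : (Fin n → Fin 2) → ℂ) :
    proj a i (c • v) = c • proj a i v := by
  funext h
  simp [proj]

namespace Weights

variable (D : Weights) (xs : ℕ → ℂ) (n : ℕ)

/-- The antiperiodic transfer matrix on a sector. -/
def transferMat (κ u s : ℂ) : Matrix (Fin n → Fin 2) (Fin n → Fin 2) ℂ :=
  κ⁻¹ • D.op xs n 0 1 u s + κ • D.op xs n 1 0 u s

/-- The two terms of the antiperiodic transfer matrix. -/
def halfTransfer (κ : ℂ) (i : Fin 2) (u s : ℂ) : Matrix (Fin n → Fin 2) (Fin n → Fin 2) ℂ :=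
  if i = 0 then κ • D.op xs n 1 0 u s else κ⁻¹ • D.op xs n 0 1 u s

/-- The matrix which moves the first site to the end of the chain. -/
def rot (s : ℂ) : Matrix (Fin (n + 1) → Fin 2) (Fin (n + 1) → Fin 2) ℂ :=
  Matrix.of fun h' h => D.chain (fun m => xs (m + 1)) (xs 0) (s + D.η * downs h') n
    (h' (Fin.last n)) (h 0) (Fin.init h') (Fin.tail h)

/-- The map which moves the last site to the beginning of the chain, with a flipped spin. -/
def flip (κ : ℂ) (w : (Fin (n + 1) → Fin 2) → ℂ) : (Fin (n + 1) → Fin 2) → ℂ :=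
  fun h => D.th D.η * (if h 0 = 0 then κ else κ⁻¹) * w (Fin.snoc (Fin.tail h) (Fin.rev (h 0)))

variable {D xs n}

lemma rot_apply {s : ℂ} {h' h : Fin (n + 1) → Fin 2} : D.rot xs n s h' h =
    D.chain (fun m => xs (m + 1)) (xs 0) (s + D.η * downs h') n
      (h' (Fin.last n)) (h 0) (Fin.init h') (Fin.tail h) := rfl

lemma downs_init (h : Fin (n + 1) → Fin 2) :
    downs h = downs (Fin.init h) + ((h (Fin.last n) : ℕ) : ℤ) :=
  Fin.sum_univ_castSucc _

lemma downs_tail (h : Fin (n + 1) → Fin 2) :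
    downs h = ((h 0 : ℕ) : ℤ) + downs (Fin.tail h) :=
  Fin.sum_univ_succ _

lemma rot_downs {s : ℂ} {h' h : Fin (n + 1) → Fin 2} (hne : D.rot xs n s h' h ≠ 0) :
    downs h' = downs h := by
  have := chain_downs hne
  rw [downs_init h', downs_tail h]
  omega

lemma chain_succ_tail (u t : ℂ) (i j : Fin 2) (h' h : Fin (n + 1) → Fin 2) :
    D.chain xs u t (n + 1) i j h' h =
      ∑ k, D.chain (fun m => xs (m + 1)) u (t + D.η * spin (h' 0)) n i k (Fin.tail h')
        (Fin.tail h) * D.wt (u - xs 0) t k (h' 0) j (h 0) := by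
  conv_lhs => rw [← Fin.cons_self_tail h', ← Fin.cons_self_tail h]
  exact D.chain_cons xs u t n i j _ _ _ _

/-- `rot` is the monodromy matrix of the other sites at xs 0, with the moved site in the role of the
auxiliary space. The R-matrix of the exchange relation is then the weight at that site, placed last
on one side and first on the other; periodicity identifies the inhomogeneities. -/
lemma op_mul_rot {s : ℂ} (hs : D.Reg s) (hper : xs (n + 1) = xs 0) {i j : Fin 2}
    (hij : ((i : ℕ) : ℂ) + ((j : ℕ) : ℂ) = 1) (u : ℂ) :
    D.op (fun m => xs (m + 1)) (n + 1) i j u s * D.rot xs n s =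
      D.rot xs n s * D.op xs (n + 1) i j u s := by
  ext h'' h
  set t := s + D.η * downs h'' with ht
  have key := D.chain₂_exchange (fun m => xs (m + 1)) u (xs 0) t (hs.add _) n i (h'' (Fin.last n)) j
    (h 0) (Fin.init h'') (Fin.tail h)
  have lhs : (D.op (fun m => xs (m + 1)) (n + 1) i j u s * D.rot xs n s) h'' h =
      ∑ h' : Fin (n + 1) → Fin 2, (∑ k, D.wt (u - xs 0) (t + D.η * totalSpin (Fin.init h'')) i (h'' (Fin.last n)) k
        (h' (Fin.last n)) * D.chain (fun m => xs (m + 1)) u t n k j (Fin.init h'') (Fin.init h')) *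
        D.chain (fun m => xs (m + 1)) (xs 0) (t + D.η * spin j) n (h' (Fin.last n)) (h 0)
          (Fin.init h') (Fin.tail h) := by
    rw [Matrix.mul_apply]
    refine Finset.sum_congr rfl fun h' _ => ?_
    by_cases hne : D.op (fun m => xs (m + 1)) (n + 1) i j u s h'' h' = 0
    · rw [hne, zero_mul]
      rw [op_apply, chain_succ, hper] at hne
      rw [hne, zero_mul]
    · have hc : (((i : ℕ) : ℤ) : ℂ) + downs h'' = ((j : ℕ) : ℤ) + downs h' := by
        exact_mod_cast op_downs hne
      rw [op_apply, chain_succ, hper, rot_apply]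
      congr 2
      rw [ht, spin]
      push_cast at hc ⊢
      linear_combination -D.η * hc + D.η * hij
  have rhs : (D.rot xs n s * D.op xs (n + 1) i j u s) h'' h =
      ∑ h' : Fin (n + 1) → Fin 2, D.chain (fun m => xs (m + 1)) (xs 0) t n (h'' (Fin.last n)) (h' 0) (Fin.init h'')
        (Fin.tail h') * ∑ k, D.chain (fun m => xs (m + 1)) u (t + D.η * spin (h' 0)) n i k
          (Fin.tail h') (Fin.tail h) * D.wt (u - xs 0) t k (h' 0) j (h 0) := by
    rw [Matrix.mul_apply]
    refine Finset.sum_congr rfl fun h' _ => ?_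
    by_cases hne : D.rot xs n s h'' h' = 0
    · rw [hne, zero_mul]
      rw [rot_apply] at hne
      rw [hne, zero_mul]
    · rw [op_apply, ← rot_downs hne, chain_succ_tail, rot_apply]
  rw [lhs, rhs, sum_snoc, sum_cons]
  simp only [Fin.snoc_last, Fin.init_snoc, Fin.cons_zero, Fin.tail_cons]
  have e1 : ∀ k l, D.wt (u - xs 0) (t + D.η * totalSpin (Fin.init h'')) i (h'' (Fin.last n)) k l *
      D.chain₂ (fun m => xs (m + 1)) u (xs 0) t n k l j (h 0) (Fin.init h'') (Fin.tail h) =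
      ∑ g', D.wt (u - xs 0) (t + D.η * totalSpin (Fin.init h'')) i (h'' (Fin.last n)) k l *
        D.chain (fun m => xs (m + 1)) u t n k j (Fin.init h'') g' *
        D.chain (fun m => xs (m + 1)) (xs 0) (t + D.η * spin j) n l (h 0) g' (Fin.tail h) :=
    fun k l => by
      rw [chain₂, Finset.mul_sum]
      exact Finset.sum_congr rfl fun g' _ => (mul_assoc _ _ _).symm
  have e2 : ∀ k l, D.chain₂ (fun m => xs (m + 1)) (xs 0) u t n (h'' (Fin.last n)) i l k
      (Fin.init h'') (Fin.tail h) * D.wt (u - xs 0) t k l j (h 0) =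
      ∑ g', D.chain (fun m => xs (m + 1)) (xs 0) t n (h'' (Fin.last n)) l (Fin.init h'') g' *
        (D.chain (fun m => xs (m + 1)) u (t + D.η * spin l) n i k g' (Fin.tail h) *
          D.wt (u - xs 0) t k l j (h 0)) := fun k l => by
      rw [chain₂, Finset.sum_mul]
      exact Finset.sum_congr rfl fun g' _ => mul_assoc _ _ _
  simp only [e1, e2] at key
  simp only [Finset.sum_mul, Finset.mul_sum]
  exact ((Finset.sum_congr rfl fun z _ => Finset.sum_comm).trans Finset.sum_comm).trans
    (key.trans ((Finset.sum_congr rfl fun z _ => Finset.sum_comm).trans Finset.sum_comm).symm)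

lemma wt_zero (t : ℂ) (ht : D.ph t ≠ 0) : ∀ k l j x : Fin 2,
    D.wt 0 t k l j x = if k = x ∧ l = j then D.th D.η else 0 := by
  simp only [Fin.forall_fin_two]
  constructorm* _ ∧ _ <;>
    simp [wt_0000, wt_0001, wt_0010, wt_0011, wt_0100, wt_0101, wt_0110, wt_0111, wt_1000, wt_1001,
      wt_1010, wt_1011, wt_1100, wt_1101, wt_1110, wt_1111, D.th_zero, ht]

/-- At u = xs 0 the first weight is th η times a permutation: the incoming auxiliary label becomes
the spin of the first site, and its former spin enters the rest of the chain. -/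
lemma op_first {s : ℂ} (hs : D.Reg s) {i j : Fin 2} (hij : i = Fin.rev j)
    (v : (Fin (n + 1) → Fin 2) → ℂ) (h : Fin (n + 1) → Fin 2) :
    (D.op xs (n + 1) i j (xs 0) s *ᵥ v) h = if h 0 = j then
      D.th D.η * (D.rot xs n s *ᵥ v) (Fin.snoc (Fin.tail h) i) else 0 := by
  have h1 : ∀ h', D.op xs (n + 1) i j (xs 0) s h h' = if h 0 = j then
      D.th D.η * D.rot xs n s (Fin.snoc (Fin.tail h) i) h' else 0 := by
    intro h'
    rw [op_apply, chain_succ_tail, sub_self]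
    simp only [wt_zero _ (hs (downs h))]
    split_ifs with hj
    · simp only [hj, and_true, mul_ite, mul_zero, Finset.sum_ite_eq', Finset.mem_univ, if_true]
      rw [rot_apply, Fin.snoc_last, Fin.init_snoc, downs_init (Fin.snoc _ _), Fin.init_snoc,
        Fin.snoc_last, downs_tail h, hj, mul_comm]
      congr 2
      -- The heights agree since j + spin j = 1 - j, the label of i.
      rw [hij, Fin.val_rev, spin]
      have := j.isLt
      rw [show (2 - ((j : ℕ) + 1)) = 1 - (j : ℕ) by omega]
      rw [Nat.cast_sub (by omega)]
      push_cast
      ring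
    · simp [hj]
  simp only [Matrix.mulVec, dotProduct, h1]
  split_ifs
  · rw [Finset.mul_sum]
    exact Finset.sum_congr rfl fun h' _ => mul_assoc _ _ _
  · simp

lemma transferMat_first {s : ℂ} (hs : D.Reg s) (κ : ℂ) (v : (Fin (n + 1) → Fin 2) → ℂ) :
    D.transferMat xs (n + 1) κ (xs 0) s *ᵥ v = D.flip n κ (D.rot xs n s *ᵥ v) := by
  funext h
  rw [transferMat, Matrix.add_mulVec, Matrix.smul_mulVec, Matrix.smul_mulVec, Pi.add_apply,
    Pi.smul_apply, Pi.smul_apply, op_first hs (i := 0) (j := 1) rfl,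
    op_first hs (i := 1) (j := 0) rfl, flip, smul_eq_mul, smul_eq_mul]
  rcases Fin.exists_fin_two.mp ⟨h 0, rfl⟩ with h0 | h0 <;> rw [h0]
  · rw [if_neg zero_ne_one, if_pos rfl, if_pos rfl, show Fin.rev (0 : Fin 2) = 1 from rfl]
    ring
  · rw [if_neg one_ne_zero, if_pos rfl, if_neg one_ne_zero, show Fin.rev (1 : Fin 2) = 0 from rfl]
    ring

/-- The two terms of T(xs 0) produce opposite spins at the first site, so each is that operator
followed by a projector. -/
lemma halfTransfer_first {s : ℂ} (hs : D.Reg s) (κ : ℂ) (i : Fin 2)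
    (v : (Fin (n + 1) → Fin 2) → ℂ) :
    D.halfTransfer xs (n + 1) κ i (xs 0) s *ᵥ v =
      proj 0 i (D.transferMat xs (n + 1) κ (xs 0) s *ᵥ v) := by
  funext h
  have h01 := op_first (xs := xs) hs (i := 0) (j := 1) rfl v h
  have h10 := op_first (xs := xs) hs (i := 1) (j := 0) rfl v h
  rw [halfTransfer, transferMat, proj, Matrix.add_mulVec, Matrix.smul_mulVec, Matrix.smul_mulVec,
    Pi.add_apply, Pi.smul_apply, Pi.smul_apply]
  rcases Fin.exists_fin_two.mp ⟨i, rfl⟩ with hi | hi <;>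
    rcases Fin.exists_fin_two.mp ⟨h 0, rfl⟩ with h0 | h0 <;>
    simp [hi, h0, Matrix.smul_mulVec, h01, h10]

lemma transferMat_mul_rot {s : ℂ} (hs : D.Reg s) (hper : xs (n + 1) = xs 0) (κ u : ℂ) :
    D.transferMat (fun m => xs (m + 1)) (n + 1) κ u s * D.rot xs n s =
      D.rot xs n s * D.transferMat xs (n + 1) κ u s := by
  rw [transferMat, transferMat, add_mul, mul_add, smul_mul_assoc, smul_mul_assoc, mul_smul_comm,
    mul_smul_comm, op_mul_rot hs hper (by simp), op_mul_rot hs hper (by simp)]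

lemma halfTransfer_mul_rot {s : ℂ} (hs : D.Reg s) (hper : xs (n + 1) = xs 0) (κ u : ℂ)
    (i : Fin 2) : D.halfTransfer (fun m => xs (m + 1)) (n + 1) κ i u s * D.rot xs n s =
      D.rot xs n s * D.halfTransfer xs (n + 1) κ i u s := by
  rw [halfTransfer, halfTransfer]
  split_ifs
  · rw [smul_mul_assoc, mul_smul_comm, op_mul_rot hs hper (by simp)]
  · rw [smul_mul_assoc, mul_smul_comm, op_mul_rot hs hper (by simp)]

lemma list_prod_mul_rot {s : ℂ} (hs : D.Reg s) (hper : xs (n + 1) = xs 0) (κ : ℂ) (l : List ℂ) :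
    (l.map fun u => D.transferMat (fun m => xs (m + 1)) (n + 1) κ u s).prod * D.rot xs n s =
      D.rot xs n s * (l.map fun u => D.transferMat xs (n + 1) κ u s).prod := by
  induction l with
  | nil => simp
  | cons u l ih =>
    rw [List.map_cons, List.map_cons, List.prod_cons, List.prod_cons, mul_assoc, ih, ← mul_assoc,
      transferMat_mul_rot hs hper, mul_assoc]

lemma flip_smul (κ c : ℂ) (w : (Fin (n + 1) → Fin 2) → ℂ) :
    D.flip n κ (c • w) = c • D.flip n κ w := by
  funext h
  simp only [flip, Pi.smul_apply, smul_eq_mul]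
  ring

lemma flip_proj (κ : ℂ) (i : Fin 2) (m : Fin n) (w : (Fin (n + 1) → Fin 2) → ℂ) :
    D.flip n κ (proj m.castSucc i w) = proj m.succ i (D.flip n κ w) := by
  funext h
  simp only [flip, proj, Fin.snoc_castSucc, Fin.tail]
  split_ifs <;> simp

/-- The local spin projectors, acting on an eigenvector, in terms of the transfer matrix. -/
lemma prod_smul_proj {s : ℂ} (hs : D.Reg s) {κ : ℂ} (i : Fin 2) {t : ℂ → ℂ} :
    ∀ (m : ℕ) (hm : m < n + 1) (xs : ℕ → ℂ), (∀ k, xs (k + (n + 1)) = xs k) →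
      ∀ v : (Fin (n + 1) → Fin 2) → ℂ, (∀ u, D.transferMat xs (n + 1) κ u s *ᵥ v = t u • v) →
      (∏ b ∈ Finset.range (m + 1), t (xs b)) • proj ⟨m, hm⟩ i v =
        (((List.range m).map xs).map fun u => D.transferMat xs (n + 1) κ u s).prod *ᵥ
          (D.halfTransfer xs (n + 1) κ i (xs m) s *ᵥ v)
  | 0, hm, xs, hper, v, hv => by
    rw [halfTransfer_first hs, hv, proj_smul]
    simp
  | m + 1, hm, xs, hper, v, hv => by
    have hp : xs (n + 1) = xs 0 := by simpa using hper 0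
    have hm' : m < n := by omega
    -- Site m + 1 of the chain is site m of the rotated chain, for which the rotated vector is again
    -- an eigenvector with the same eigenvalue function.
    have IH := prod_smul_proj hs (κ := κ) i m (by omega) (fun k => xs (k + 1))
      (fun k => by rw [← hper (k + 1)]; congr 1; omega) (D.rot xs n s *ᵥ v) fun u => by
        rw [Matrix.mulVec_mulVec, transferMat_mul_rot hs hp, ← Matrix.mulVec_mulVec, hv,
          Matrix.mulVec_smul]
    have h1 : t (xs 0) • proj ⟨m + 1, hm⟩ i v =
        D.flip n κ (proj ⟨m, by omega⟩ i (D.rot xs n s *ᵥ v)) := by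
      rw [← proj_smul, ← hv, transferMat_first hs]
      exact (flip_proj κ i ⟨m, hm'⟩ _).symm
    -- The rotation is carried leftwards through all transfer matrices until it meets the flip, and
    -- the two together form T(xs 0), the leftmost factor.
    rw [Finset.prod_range_succ', mul_smul, h1, ← flip_smul, IH, Matrix.mulVec_mulVec,
      Matrix.mulVec_mulVec, mul_assoc, halfTransfer_mul_rot hs hp, ← mul_assoc,
      list_prod_mul_rot hs hp, mul_assoc, ← Matrix.mulVec_mulVec, ← transferMat_first hs,
      Matrix.mulVec_mulVec, Matrix.mulVec_mulVec, ← mul_assoc, List.range_succ_eq_map,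
      List.map_cons, List.map_cons, List.prod_cons, List.map_map, List.map_map, List.map_map]
    rfl

end Weights

open Matrix

namespace Model

variable {N : ℕ}

/-! ### The action of the monodromy matrix on the dynamical-spin basis -/

/-- The configuration which agrees with `g` on the first `m` sites and with `h` on the others. -/
def glue (m : ℕ) (g : Fin m → Fin 2) (h : Fin N → Fin 2) : Fin N → Fin 2 :=
  fun b => if hb : (b : ℕ) < m then g ⟨b, hb⟩ else h b

lemma glue_zero (g : Fin 0 → Fin 2) (h : Fin N → Fin 2) : glue 0 g h = h := by
  funext b
  simp [glue]

lemma glue_self (g h : Fin N → Fin 2) : glue N g h = g := by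
  funext b
  simp [glue]

lemma update_glue {m : ℕ} (hm : m < N) (g : Fin m → Fin 2) (h : Fin N → Fin 2) (z : Fin 2) :
    Function.update (glue m g h) ⟨m, hm⟩ z = glue (m + 1) (Fin.snoc g z) h := by
  funext b
  by_cases hb : b = ⟨m, hm⟩
  · subst hb
    rw [Function.update_self]
    simp [glue, Fin.snoc]
  · have hb' : (b : ℕ) ≠ m := fun e => hb (Fin.ext e)
    rw [Function.update_of_ne hb]
    by_cases hlt : (b : ℕ) < m
    · simp [glue, Fin.snoc, hlt, Nat.lt_succ_of_lt hlt]
    · simp [glue, hlt, show ¬ (b : ℕ) < m + 1 by omega]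

lemma glue_apply_self {m : ℕ} (hm : m < N) (g : Fin m → Fin 2) (h : Fin N → Fin 2) :
    glue m g h ⟨m, hm⟩ = h ⟨m, hm⟩ := by
  simp [glue]

lemma sum_spin_glue {m : ℕ} (hm : m < N) (g : Fin m → Fin 2) (h : Fin N → Fin 2) :
    ∑ b ∈ Finset.Iio (⟨m, hm⟩ : Fin N), (spin (glue m g h b) : ℂ) = totalSpin g := by
  rw [totalSpin, Int.cast_sum]
  refine Finset.sum_bij' (fun b hb => ⟨(b : ℕ), by simpa [Fin.lt_def] using hb⟩)
    (fun b _ => ⟨(b : ℕ), b.isLt.trans hm⟩) ?_ ?_ ?_ ?_ ?_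
  · simp
  · simp [Fin.lt_def]
  · simp
  · simp
  · intro b hb
    have hlt : (b : ℕ) < m := by simpa [Fin.lt_def] using hb
    simp [glue, hlt]

variable (P : Model N)

lemma Rop_single (hω : 0 < P.ω.im) (n : Fin N) (u : ℂ) (k : Fin 2) (h : Fin N → Fin 2) (a : ℤ) :
    P.Rop n u (Finsupp.single (k, h, a) 1) = ∑ i, ∑ z', (P.weights hω).wt u
      (P.height a + P.η * ∑ b ∈ Finset.Iio n, (spin (h b) : ℂ)) i z' k (h n) •
        Finsupp.single (i, Function.update h n z', a) (1 : ℂ) := by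
  rw [Rop, Finsupp.linearCombination_single, one_smul, Fintype.sum_prod_type]
  refine Finset.sum_congr rfl fun i _ => Finset.sum_congr rfl fun z' _ => ?_
  rw [R_eq_wt P hω, Finsupp.smul_single, smul_eq_mul, mul_one]

lemma shiftOp_single (j : Fin 2) (h : Fin N → Fin 2) (a : ℤ) :
    shiftOp N (Finsupp.single (j, h, a) 1) = Finsupp.single (j, h, a + spin j) 1 := by
  rw [shiftOp, Finsupp.linearCombination_single, one_smul]

variable [NeZero N]

/-- When the operator of site m acts, the earlier sites already carry outgoing spins, which is why
the heights in `chain` involve the outgoing configuration. -/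
lemma partial_monodromy_single (hω : 0 < P.ω.im) (u : ℂ) (j : Fin 2) (h : Fin N → Fin 2) (a : ℤ) :
    ∀ (m : ℕ) (hm : m ≤ N),
      ((((List.finRange N).take m).reverse.map fun n => P.Rop n (u - P.ξ n)).prod)
        (Finsupp.single (j, h, a) 1) =
      ∑ k, ∑ g : Fin m → Fin 2, (P.weights hω).chain P.seq u (P.height a) m k j g
        (fun b => h (Fin.castLE hm b)) • Finsupp.single (k, glue m g h, a) (1 : ℂ)
  | 0, hm => by
    simp [Weights.chain_zero, glue_zero]
  | m + 1, hm => by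
    have hlt : m < N := hm
    have htake : (List.finRange N).take (m + 1) = (List.finRange N).take m ++ [⟨m, hlt⟩] := by
      rw [List.take_succ_eq_append_getElem (by simpa using hlt)]
      simp
    rw [htake, List.reverse_append, List.reverse_singleton, List.singleton_append, List.map_cons,
      List.prod_cons, Module.End.mul_apply, partial_monodromy_single hω u j h a m hlt.le]
    simp only [map_sum, map_smul, P.Rop_single hω, update_glue hlt, glue_apply_self hlt,
      sum_spin_glue hlt, Weights.sum_snoc, Weights.chain_succ, Fin.snoc_last, Fin.init_snoc,
      Finset.sum_smul, Finset.smul_sum, smul_smul]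
    have hseq : P.seq m = P.ξ ⟨m, hlt⟩ := P.seq_val ⟨m, hlt⟩
    rw [hseq, Finset.sum_congr rfl fun k _ => Finset.sum_comm.trans
      (Finset.sum_congr rfl fun i _ => Finset.sum_comm), Finset.sum_comm]
    refine Finset.sum_congr rfl fun i _ => ?_
    rw [Finset.sum_comm]
    refine Finset.sum_congr rfl fun z' _ => ?_
    rw [Finset.sum_comm]
    refine Finset.sum_congr rfl fun g _ => Finset.sum_congr rfl fun k _ => ?_
    exact congrArg (· • _) (mul_comm _ _)

lemma entry_single (hω : 0 < P.ω.im) (u : ℂ) (i j : Fin 2) (h : Fin N → Fin 2) (a : ℤ) :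
    P.entry i j u (Finsupp.single (h, a) 1) =
      ∑ h', (P.weights hω).chain P.seq u (P.height (a + spin j)) N i j h' h •
        Finsupp.single (h', a + spin j) (1 : ℂ) := by
  have key := P.partial_monodromy_single hω u j h (a + spin j) N le_rfl
  rw [List.take_of_length_le (by simp)] at key
  rw [entry, LinearMap.comp_apply, LinearMap.comp_apply, Finsupp.linearCombination_single, one_smul,
    monodromy, Module.End.mul_apply, shiftOp_single, key]
  simp only [map_sum, map_smul, Finsupp.linearCombination_single, one_smul, glue_self]
  rw [Finset.sum_eq_single i]
  · simp only [if_true]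
    rfl
  · intro k _ hk
    simp [hk]
  · simp

/-! ### The sector of the eigenvalue `xπ + yπω` in the representation space -/

/-- The dynamical-spin basis vectors of the sector. -/
def secBasis (h : Fin N → Fin 2) : Ket N := Finsupp.single (h, -downs h) 1

/-- The vector of the sector with given components. -/
def secKet : ((Fin N → Fin 2) → ℂ) →ₗ[ℂ] Ket N := Fintype.linearCombination ℂ secBasis

/-- The covector of the sector with given components. -/
def secBra : ((Fin N → Fin 2) → ℂ) →ₗ[ℂ] Bra N :=
  Fintype.linearCombination ℂ fun h => (Finsupp.lapply (h, -downs h) : Bra N)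

omit [NeZero N] in
lemma secKet_apply (v : (Fin N → Fin 2) → ℂ) : secKet v = ∑ h, v h • secBasis h := rfl

omit [NeZero N] in
lemma secBra_apply_single (φ : (Fin N → Fin 2) → ℂ) (h : Fin N → Fin 2) (a : ℤ) :
    secBra φ (Finsupp.single (h, a) 1) = if a = -downs h then φ h else 0 := by
  rw [secBra, Fintype.linearCombination_apply, LinearMap.sum_apply, Finset.sum_eq_single h]
  · simp [Finsupp.single_apply]
  · intro h' _ hne
    simp [hne.symm]
  · simp

omit [NeZero N] in
lemma secKet_apply_label (v : (Fin N → Fin 2) → ℂ) (h : Fin N → Fin 2) (a : ℤ) :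
    secKet v (h, a) = if a = -downs h then v h else 0 := by
  rw [secKet_apply, Finsupp.finsetSum_apply, Finset.sum_eq_single h]
  · simp [secBasis, Finsupp.single_apply, eq_comm]
  · intro h' _ hne
    simp [secBasis, hne]
  · simp

omit [NeZero N] in
lemma secBra_secKet (φ v : (Fin N → Fin 2) → ℂ) : secBra φ (secKet v) = φ ⬝ᵥ v := by
  rw [secKet_apply, map_sum, dotProduct]
  refine Finset.sum_congr rfl fun h _ => ?_
  rw [map_smul, secBasis, secBra_apply_single, if_pos rfl, smul_eq_mul, mul_comm]

omit [NeZero N] in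
lemma secKet_injective : Function.Injective (secKet : ((Fin N → Fin 2) → ℂ) →ₗ[ℂ] Ket N) := by
  intro v w hvw
  funext h
  have := DFunLike.congr_fun hvw (h, -downs h)
  rwa [secKet_apply_label, secKet_apply_label, if_pos rfl, if_pos rfl] at this

omit [NeZero N] in
lemma secBra_injective : Function.Injective (secBra : ((Fin N → Fin 2) → ℂ) →ₗ[ℂ] Bra N) := by
  intro v w hvw
  funext h
  have := DFunLike.congr_fun hvw (Finsupp.single (h, -downs h) 1)
  rwa [secBra_apply_single, secBra_apply_single, if_pos rfl, if_pos rfl] at this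

omit [NeZero N] in
lemma bra_ext {ψ ψ' : Bra N}
    (h : ∀ g a, ψ (Finsupp.single (g, a) 1) = ψ' (Finsupp.single (g, a) 1)) : ψ = ψ' :=
  Finsupp.lhom_ext' fun c => LinearMap.ext_ring (h c.1 c.2)

omit [NeZero N] in
lemma height_neg_downs (h : Fin N → Fin 2) : P.height (-downs h) = P.t0 + P.η * downs h := by
  rw [height]
  push_cast
  ring

/-- An off-diagonal entry flips the auxiliary spin, and the shift of the height label by T_τ equals
minus the change in the number of down spins; so the sector is preserved. -/
lemma entry_secBasis (hω : 0 < P.ω.im) (u : ℂ) {i j : Fin 2} (hij : i = Fin.rev j)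
    (h : Fin N → Fin 2) : P.entry i j u (secBasis h) =
      ∑ h', (P.weights hω).op P.seq N i j u P.t0 h' h • secBasis h' := by
  rw [secBasis, P.entry_single hω]
  refine Finset.sum_congr rfl fun h' _ => ?_
  -- The two sides use heights that coincide only for spin-conserving pairs; a nonzero value on
  -- either side provides conservation.
  by_cases hne : (P.weights hω).chain P.seq u (P.height (-downs h + spin j)) N i j h' h = 0
  · by_cases hne2 : (P.weights hω).op P.seq N i j u P.t0 h' h = 0
    · rw [hne, hne2, zero_smul, zero_smul]
    · have hc := Weights.op_downs hne2
      rw [hij, Fin.val_rev] at hc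
      rw [show -downs h + spin j = -downs h' by rw [spin]; omega] at hne ⊢
      rw [hne, Weights.op_apply, weights_eta, ← height_neg_downs, hne, zero_smul, zero_smul]
  · have hc := Weights.chain_downs hne
    rw [hij, Fin.val_rev] at hc
    rw [show -downs h + spin j = -downs h' by rw [spin]; omega, Weights.op_apply, weights_eta,
      ← height_neg_downs, secBasis]

lemma entry_secKet (hω : 0 < P.ω.im) (u : ℂ) {i j : Fin 2} (hij : i = Fin.rev j)
    (v : (Fin N → Fin 2) → ℂ) : P.entry i j u (secKet v) =
      secKet ((P.weights hω).op P.seq N i j u P.t0 *ᵥ v) := by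
  rw [secKet_apply, secKet_apply, map_sum]
  simp only [map_smul, P.entry_secBasis hω u hij, Matrix.mulVec, dotProduct, Finset.sum_smul,
    Finset.smul_sum, smul_smul]
  rw [Finset.sum_comm]
  exact Finset.sum_congr rfl fun h' _ => Finset.sum_congr rfl fun h _ => by rw [mul_comm]

lemma secBra_entry (hω : 0 < P.ω.im) (u : ℂ) {i j : Fin 2} (hij : i = Fin.rev j)
    (φ : (Fin N → Fin 2) → ℂ) : secBra φ ∘ₗ P.entry i j u =
      secBra (φ ᵥ* (P.weights hω).op P.seq N i j u P.t0) := by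
  refine bra_ext fun h a => ?_
  rw [LinearMap.comp_apply, secBra_apply_single]
  split_ifs with ha
  · subst ha
    change secBra φ (P.entry i j u (secBasis h)) = _
    rw [P.entry_secBasis hω u hij, map_sum, Matrix.vecMul, dotProduct]
    refine Finset.sum_congr rfl fun h' _ => ?_
    rw [map_smul, secBasis, secBra_apply_single, if_pos rfl, smul_eq_mul, mul_comm]
  · rw [P.entry_single hω, map_sum]
    refine Finset.sum_eq_zero fun h' _ => ?_
    rw [map_smul, secBra_apply_single, smul_eq_mul]
    split_ifs with hd
    · by_contra hne
      have hc := Weights.chain_downs (left_ne_zero_of_mul hne)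
      rw [hij, Fin.val_rev] at hc
      rw [spin] at hd
      omega
    · rw [mul_zero]

-- The deviation from the sector eigenvalue is -2η(a + downs h); as η ≠ 0, the sector consists of
-- the labels a = -downs h.
omit [NeZero N] in
lemma Stau_single (h : Fin N → Fin 2) (a : ℤ) : P.Stau (Finsupp.single (h, a) 1) =
    (P.StauValue 0 - 2 * P.η * (a + downs h)) • Finsupp.single (h, a) (1 : ℂ) := by
  rw [Stau, LinearMap.add_apply, LinearMap.smul_apply, LinearMap.smul_apply, spinOp, tauOp,
    Finsupp.linearCombination_single, Finsupp.linearCombination_single, one_smul, one_smul,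
    Finsupp.smul_single, Finsupp.smul_single, ← Finsupp.single_add, Finsupp.smul_single]
  congr 1
  simp only [smul_eq_mul, StauValue, height, totalSpin_eq_downs, t0]
  push_cast
  ring

omit [NeZero N] in
lemma eta_ne_zero (hP : P.Generic) : P.η ≠ 0 := fun h => hP.eta_notMem ⟨0, 0, by simp [h]⟩

omit [NeZero N] in
lemma exists_eq_secBra (hP : P.Generic) {ψ : Bra N} (hψ : ψ ∈ P.braSector 0) :
    ∃ φ, ψ = secBra φ := by
  refine ⟨fun h => ψ (secBasis h), bra_ext fun h a => ?_⟩
  rw [secBra_apply_single]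
  split_ifs with ha
  · rw [ha]
    rfl
  · have h1 := DFunLike.congr_fun (Module.End.mem_eigenspace_iff.mp hψ) (Finsupp.single (h, a) 1)
    rw [LinearMap.dualMap_apply, Stau_single, map_smul, LinearMap.smul_apply, ← sub_eq_zero,
      ← sub_smul, smul_eq_mul, sub_sub_cancel_left] at h1
    refine (mul_eq_zero.mp h1).resolve_left ?_
    refine neg_ne_zero.mpr (mul_ne_zero (mul_ne_zero two_ne_zero (P.eta_ne_zero hP)) ?_)
    intro h0
    have : a + downs h = 0 := by exact_mod_cast h0
    omega

omit [NeZero N] in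
lemma Stau_apply (ψ : Ket N) (h : Fin N → Fin 2) (a : ℤ) : P.Stau ψ (h, a) =
    (P.StauValue 0 - 2 * P.η * (a + downs h)) * ψ (h, a) := by
  induction ψ using Finsupp.induction_linear with
  | zero => simp
  | add f g hf hg => rw [map_add, Finsupp.add_apply, hf, hg, Finsupp.add_apply]; ring
  | single c x =>
    rw [← mul_one x, ← smul_eq_mul, ← Finsupp.smul_single, map_smul]
    rcases c with ⟨h', a'⟩
    rw [Stau_single]
    simp only [Finsupp.smul_apply, smul_eq_mul, Finsupp.single_apply]
    split_ifs with hc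
    · rw [Prod.mk.injEq] at hc
      rw [hc.1, hc.2]
      ring
    · ring

omit [NeZero N] in
lemma exists_eq_secKet (hP : P.Generic) {ψ : Ket N} (hψ : ψ ∈ P.ketSector 0) :
    ∃ v, ψ = secKet v := by
  refine ⟨fun h => ψ (h, -downs h), Finsupp.ext fun ⟨h, a⟩ => ?_⟩
  rw [secKet_apply_label]
  split_ifs with ha
  · rw [ha]
  · have h1 := DFunLike.congr_fun (Module.End.mem_eigenspace_iff.mp hψ) (h, a)
    rw [Stau_apply, Finsupp.smul_apply, smul_eq_mul, ← sub_eq_zero, ← sub_mul,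
      sub_sub_cancel_left] at h1
    refine (mul_eq_zero.mp h1).resolve_left ?_
    refine neg_ne_zero.mpr (mul_ne_zero (mul_ne_zero two_ne_zero (P.eta_ne_zero hP)) ?_)
    intro h0
    have : a + downs h = 0 := by exact_mod_cast h0
    omega

omit [NeZero N] in
lemma E_secKet (n : Fin N) (i : Fin 2) (v : (Fin N → Fin 2) → ℂ) :
    E n i i (secKet v) = secKet (proj n i v) := by
  rw [secKet_apply, secKet_apply, map_sum]
  refine Finset.sum_congr rfl fun h _ => ?_
  rw [map_smul, secBasis, E, Finsupp.linearCombination_single, one_smul, proj]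
  dsimp only
  split_ifs with hi
  · rw [← hi, Function.update_eq_self]
  · rw [smul_zero, zero_smul]

end Model

open Matrix

/-! ### From operators on the full space to matrices on the sector -/

lemma list_prod_smul_pow {ι A : Type*} [Ring A] [Algebra ℂ A] (c : ι → ℂ) (M : ι → A) (e : ι → ℕ)
    (l : List ι) : (l.map fun k => (c k • M k) ^ e k).prod =
      (l.map fun k => c k ^ e k).prod • (l.map fun k => M k ^ e k).prod := by
  induction l with
  | nil => simp
  | cons k l ih =>
    rw [List.map_cons, List.prod_cons, ih, smul_pow, smul_mul_smul_comm]
    rfl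

lemma orderedProd_smul {n : ℕ} {A : Type*} [Ring A] [Algebra ℂ A] (c : Fin n → ℂ) (M : Fin n → A)
    (e : Fin n → ℕ) : orderedProd (fun k => c k • M k) e = (∏ k, c k ^ e k) • orderedProd M e := by
  rw [orderedProd, list_prod_smul_pow, Fin.prod_univ_def, orderedProd]

namespace Model

variable {N : ℕ}

lemma pow_secKet {f : Module.End ℂ (Ket N)} {M : Matrix (Fin N → Fin 2) (Fin N → Fin 2) ℂ}
    (hf : ∀ v, f (secKet v) = secKet (M *ᵥ v)) (e : ℕ) (v : (Fin N → Fin 2) → ℂ) :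
    (f ^ e) (secKet v) = secKet (M ^ e *ᵥ v) := by
  induction e generalizing v with
  | zero => simp
  | succ e ih => rw [pow_succ, Module.End.mul_apply, hf, ih, pow_succ, Matrix.mulVec_mulVec]

lemma orderedProd_secKet {f : Fin N → Module.End ℂ (Ket N)}
    {M : Fin N → Matrix (Fin N → Fin 2) (Fin N → Fin 2) ℂ}
    (hf : ∀ k v, f k (secKet v) = secKet (M k *ᵥ v)) (e : Fin N → ℕ) (v : (Fin N → Fin 2) → ℂ) :
    orderedProd f e (secKet v) = secKet (orderedProd M e *ᵥ v) := by
  rw [orderedProd, orderedProd]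
  induction List.finRange N with
  | nil => simp
  | cons k l ih =>
    rw [List.map_cons, List.prod_cons, Module.End.mul_apply, ih, pow_secKet (hf k),
      Matrix.mulVec_mulVec, List.map_cons, List.prod_cons]

lemma secBra_pow {f : Module.End ℂ (Ket N)} {M : Matrix (Fin N → Fin 2) (Fin N → Fin 2) ℂ}
    (hf : ∀ φ, secBra φ ∘ₗ f = secBra (φ ᵥ* M)) (e : ℕ) (φ : (Fin N → Fin 2) → ℂ) :
    secBra φ ∘ₗ f ^ e = secBra (φ ᵥ* M ^ e) := by
  induction e generalizing φ with
  | zero => simp [Module.End.one_eq_id]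
  | succ e ih =>
    rw [pow_succ', Module.End.mul_eq_comp, ← LinearMap.comp_assoc, hf, ih, pow_succ',
      Matrix.vecMul_vecMul]

lemma secBra_orderedProd {f : Fin N → Module.End ℂ (Ket N)}
    {M : Fin N → Matrix (Fin N → Fin 2) (Fin N → Fin 2) ℂ}
    (hf : ∀ k φ, secBra φ ∘ₗ f k = secBra (φ ᵥ* M k)) (e : Fin N → ℕ) (φ : (Fin N → Fin 2) → ℂ) :
    secBra φ ∘ₗ orderedProd f e = secBra (φ ᵥ* orderedProd M e) := by
  rw [orderedProd, orderedProd]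
  induction List.finRange N generalizing φ with
  | nil => simp [Module.End.one_eq_id]
  | cons k l ih =>
    rw [List.map_cons, List.prod_cons, Module.End.mul_eq_comp, ← LinearMap.comp_assoc,
      secBra_pow (hf k), ih, Matrix.vecMul_vecMul, List.map_cons, List.prod_cons]

variable [NeZero N] {P : Model N} (hP : P.Generic)

/-! ### The separated bases and the eigenstates in the sector -/

lemma Generic.opB_secKet (u : ℂ) (v : (Fin N → Fin 2) → ℂ) :
    P.opB u (secKet v) = secKet (hP.B u *ᵥ v) :=
  P.entry_secKet hP.im_pos u (i := 0) (j := 1) (by decide) v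

lemma Generic.opC_secKet (u : ℂ) (v : (Fin N → Fin 2) → ℂ) :
    P.opC u (secKet v) = secKet (hP.C u *ᵥ v) :=
  P.entry_secKet hP.im_pos u (i := 1) (j := 0) (by decide) v

lemma Generic.secBra_opB (u : ℂ) (φ : (Fin N → Fin 2) → ℂ) :
    secBra φ ∘ₗ P.opB u = secBra (φ ᵥ* hP.B u) :=
  P.secBra_entry hP.im_pos u (i := 0) (j := 1) (by decide) φ

lemma Generic.secBra_opC (u : ℂ) (φ : (Fin N → Fin 2) → ℂ) :
    secBra φ ∘ₗ P.opC u = secBra (φ ᵥ* hP.C u) :=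
  P.secBra_entry hP.im_pos u (i := 1) (j := 0) (by decide) φ

lemma Generic.transfer_secKet (κ u : ℂ) (v : (Fin N → Fin 2) → ℂ) :
    P.transfer κ u (secKet v) = secKet (hP.T κ u *ᵥ v) := by
  rw [transfer, LinearMap.add_apply, LinearMap.smul_apply, LinearMap.smul_apply, hP.opB_secKet,
    hP.opC_secKet, Generic.T, Matrix.add_mulVec, Matrix.smul_mulVec, Matrix.smul_mulVec, map_add,
    map_smul, map_smul]

lemma Generic.secBra_transfer (κ u : ℂ) (φ : (Fin N → Fin 2) → ℂ) :
    secBra φ ∘ₗ P.transfer κ u = secBra (φ ᵥ* hP.T κ u) := by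
  rw [transfer, LinearMap.comp_add, LinearMap.comp_smul, LinearMap.comp_smul, hP.secBra_opB,
    hP.secBra_opC, Generic.T, Matrix.vecMul_add, Matrix.vecMul_smul, Matrix.vecMul_smul, map_add,
    map_smul, map_smul]

include hP in
lemma Generic.exists_left_eigenvector {κ : ℂ} {t : ℂ → ℂ} {ψ : Bra N}
    (hψ : P.IsLeftEigenstate κ t ψ) :
    ∃ φ, ψ = secBra φ ∧ φ ≠ 0 ∧ ∀ u, φ ᵥ* hP.T κ u = t u • φ := by
  obtain ⟨φ, rfl⟩ := P.exists_eq_secBra hP hψ.mem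
  refine ⟨φ, rfl, fun h0 => hψ.ne_zero (by rw [h0, map_zero]), fun u => secBra_injective ?_⟩
  rw [← hP.secBra_transfer, hψ.eigen, map_smul]

include hP in
lemma Generic.exists_right_eigenvector {κ : ℂ} {t : ℂ → ℂ} {ψ : Ket N}
    (hψ : P.IsRightEigenstate κ t ψ) :
    ∃ v, ψ = secKet v ∧ v ≠ 0 ∧ ∀ u, hP.T κ u *ᵥ v = t u • v := by
  obtain ⟨v, rfl⟩ := P.exists_eq_secKet hP hψ.mem
  refine ⟨v, rfl, fun h0 => hψ.ne_zero (by rw [h0, map_zero]), fun u => secKet_injective ?_⟩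
  rw [← hP.transfer_secKet, hψ.eigen, map_smul]

omit [NeZero N] in
lemma heightLabel_zero (h : Fin N → Fin 2) : heightLabel 0 h = -downs h := by
  rw [heightLabel, sub_zero, downs]

lemma Generic.leftState_eq (c : ℂ) (h : Fin N → Fin 2) : P.leftState c 0 h =
    secBra ((1 / c * ∏ a, (1 / P.cd (P.ξ a - P.η)) ^ (h a : ℕ)) • hP.L h) := by
  have h1 : (Finsupp.lapply ((fun _ => 0), heightLabel 0 fun _ : Fin N => 0) : Bra N) =
      secBra (Pi.single (fun _ => 0) 1) := by
    rw [heightLabel_zero, secBra, Fintype.linearCombination_apply_single, one_smul]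
  rw [leftState, h1, ← map_smul]
  refine (secBra_orderedProd (M := fun k => (1 / P.cd (P.ξ k - P.η)) • hP.C (P.ξ k)) ?_ _ _).trans ?_
  · intro k φ
    rw [LinearMap.comp_smul, hP.secBra_opC, Matrix.vecMul_smul, map_smul]
  · rw [orderedProd_smul, Matrix.smul_vecMul, Matrix.vecMul_smul, smul_smul, Generic.L,
      Weights.sepBra]
    simp only [seq_val]
    rfl

lemma Generic.rightState_eq (c : ℂ) (h : Fin N → Fin 2) : P.rightState c 0 h =
    secKet ((1 / c * ∏ a, (1 / P.cd (P.ξ a - P.η)) ^ (1 - (h a : ℕ))) • hP.K h) := by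
  have h1 : (Finsupp.single ((fun _ => 1), heightLabel 0 fun _ : Fin N => 1) (1 / c) : Ket N) =
      secKet ((1 / c) • Pi.single (fun _ => 1) 1) := by
    rw [heightLabel_zero, map_smul, secKet, Fintype.linearCombination_apply_single, one_smul,
      secBasis, Finsupp.smul_single, smul_eq_mul, mul_one]
  rw [rightState, h1]
  refine (orderedProd_secKet (M := fun k => (1 / P.cd (P.ξ k - P.η)) • hP.C (P.ξ k - P.η))
    ?_ _ _).trans ?_
  · intro k φ
    rw [LinearMap.smul_apply, hP.opC_secKet, Matrix.smul_mulVec, map_smul]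
  · rw [orderedProd_smul, Matrix.mulVec_smul, Matrix.smul_mulVec, smul_smul, Generic.K,
      Weights.sepKet]
    simp only [seq_val]
    rfl

/-- The factor e^{iyηN} undoes the N one-site factors relating the pairings at 0 and 1, so the
prescribed normalization depends on the constant `pairingDet` only and is nonzero. -/
lemma Generic.normSq_eq : P.normSq = hP.pairingDet / ∏ a, P.cd (P.ξ a - P.η) := by
  have h1 := hP.pairing_mul_det fun _ => 1
  have h2 : (∏ _a : Fin N, exp (-(I * P.yc * P.η)) ^ ((1 : Fin 2) : ℕ)) *
      exp (I * P.yc * P.η * N) = 1 := by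
    rw [Finset.prod_const, Finset.card_univ, Fintype.card_fin, Fin.val_one, pow_one, ← exp_nat_mul,
      ← exp_add, show (N : ℂ) * -(I * P.yc * P.η) + I * P.yc * P.η * N = 0 by ring, exp_zero]
  rw [normSq, hP.leftState_eq, hP.rightState_eq, secBra_secKet, smul_dotProduct, dotProduct_smul]
  change _ • _ • hP.pairing _ * _ * _ = _
  simp only [Fin.val_one, pow_one, Nat.sub_self, pow_zero, Finset.prod_const_one, div_one, one_mul,
    smul_eq_mul, one_div, Finset.prod_inv_distrib]
  simp only [Fin.val_one, pow_one] at h1 h2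
  rw [div_eq_inv_mul]
  linear_combination (∏ a, P.cd (P.ξ a - P.η))⁻¹ * exp (I * P.yc * P.η * N) * h1 +
    (∏ a, P.cd (P.ξ a - P.η))⁻¹ * hP.pairingDet * h2

lemma Generic.leftSeparate_eq (κ c : ℂ) (q : Fin N → Fin 2 → ℂ) : P.leftSeparate κ c q =
    secBra (∑ h, (1 / c * (∏ a, exp (I * P.yc * P.η) ^ (h a : ℕ) * P.leftCoeff κ q a (h a)) *
      (P.Thmat 0 h).det) • hP.L h) := by
  rw [leftSeparate, map_sum]
  refine Finset.sum_congr rfl fun h _ => ?_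
  rw [hP.leftState_eq, ← map_smul, smul_smul]
  congr 2
  have : (∏ a, exp (I * P.yc * P.η) ^ (h a : ℕ) * P.leftCoeff κ q a (h a)) =
      (∏ a, (κ * exp (I * P.yc * P.η)) ^ (h a : ℕ) * q a (h a)) *
        ∏ a, (1 / P.cd (P.ξ a - P.η)) ^ (h a : ℕ) := by
    rw [← Finset.prod_mul_distrib]
    refine Finset.prod_congr rfl fun a _ => ?_
    rw [leftCoeff, div_pow, div_pow, mul_pow, one_pow]
    ring
  rw [this]
  ring

lemma Generic.rightSeparate_eq (κ c : ℂ) (q : Fin N → Fin 2 → ℂ) : P.rightSeparate κ c q =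
    secKet (∑ h, (1 / (c * ∏ a, P.cd (P.ξ a - P.η)) * (∏ a, P.rightCoeff κ q a (h a)) *
      (P.Thmat 0 h).det) • hP.K h) := by
  rw [rightSeparate, map_sum]
  refine Finset.sum_congr rfl fun h _ => ?_
  rw [hP.rightState_eq, ← map_smul, smul_smul]
  congr 2
  -- The powers 1 - h of 1/d are 1/d times d^h: this removes the denominator d in the coefficients
  -- and leaves the overall factor ∏ 1/d.
  have : (∏ a, (κ⁻¹ * exp (I * P.yc * P.η) * (P.caxy (P.ξ a) / P.cd (P.ξ a - P.η))) ^ (h a : ℕ) *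
      q a (h a)) * (∏ a, (1 / P.cd (P.ξ a - P.η)) ^ (1 - (h a : ℕ))) =
      (∏ a, P.cd (P.ξ a - P.η))⁻¹ * ∏ a, P.rightCoeff κ q a (h a) := by
    rw [← Finset.prod_inv_distrib, ← Finset.prod_mul_distrib, ← Finset.prod_mul_distrib]
    refine Finset.prod_congr rfl fun a _ => ?_
    rw [rightCoeff]
    rcases Fin.exists_fin_two.mp ⟨h a, rfl⟩ with h0 | h0 <;> rw [h0] <;> simp
    · ring
    · ring
  rw [show 1 / (c * ∏ a, P.cd (P.ξ a - P.η)) * (∏ a, P.rightCoeff κ q a (h a)) =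
    1 / c * ((∏ a, P.cd (P.ξ a - P.η))⁻¹ * ∏ a, P.rightCoeff κ q a (h a)) by
      rw [one_div, mul_inv]; ring, ← this]
  ring

lemma Generic.left_dotProduct_K_of_eq {c κ : ℂ} {q : Fin N → Fin 2 → ℂ} {φ : (Fin N → Fin 2) → ℂ}
    (hφ : φ = ∑ h, (1 / c * (∏ a, exp (I * P.yc * P.η) ^ (h a : ℕ) * P.leftCoeff κ q a (h a)) *
      (P.Thmat 0 h).det) • hP.L h) (h : Fin N → Fin 2) :
    φ ⬝ᵥ hP.K h = hP.pairingDet / c * ∏ a, P.leftCoeff κ q a (h a) := by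
  rw [hφ, sum_dotProduct, Finset.sum_eq_single h]
  · have h1 := hP.pairing_mul_det h
    have h2 : (∏ a, exp (I * P.yc * P.η) ^ (h a : ℕ)) *
        ∏ a, exp (-(I * P.yc * P.η)) ^ (h a : ℕ) = 1 := by
      rw [← Finset.prod_mul_distrib]
      refine Finset.prod_eq_one fun a _ => ?_
      rw [← mul_pow, ← exp_add, add_neg_cancel, exp_zero, one_pow]
    rw [smul_dotProduct, smul_eq_mul, Finset.prod_mul_distrib]
    change _ * hP.pairing h = _
    linear_combination 1 / c * (∏ a, exp (I * P.yc * P.η) ^ (h a : ℕ)) *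
      (∏ a, P.leftCoeff κ q a (h a)) * h1 +
      1 / c * (∏ a, P.leftCoeff κ q a (h a)) * hP.pairingDet * h2
  · intro k _ hk
    rw [smul_dotProduct, hP.L_dotProduct_K_of_ne hk, smul_zero]
  · simp

/-! ### Matrix elements of the local spin projectors -/

lemma dotProduct_list_prod_mulVec {n : Type*} [Fintype n] [DecidableEq n] {M : ℂ → Matrix n n ℂ}
    {t : ℂ → ℂ} {φ : n → ℂ} (hφ : ∀ u, φ ᵥ* M u = t u • φ) (l : List ℂ) (v : n → ℂ) :
    φ ⬝ᵥ (l.map M).prod *ᵥ v = (l.map t).prod * (φ ⬝ᵥ v) := by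
  induction l with
  | nil => simp
  | cons u l ih =>
    rw [List.map_cons, List.prod_cons, ← Matrix.mulVec_mulVec, Matrix.dotProduct_mulVec, hφ,
      smul_dotProduct, ih, smul_eq_mul, List.map_cons, List.prod_cons, mul_assoc]

lemma prod_seq_Iio (f : ℂ → ℂ) (n : Fin N) :
    ∏ b ∈ Finset.range n, f (P.seq b) = ∏ b ∈ Finset.Iio n, f (P.ξ b) := by
  rw [← Nat.Iio_eq_range, ← Fin.map_valEmbedding_Iio, Finset.prod_map]
  exact Finset.prod_congr rfl fun b _ => congrArg f (P.seq_val b)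

lemma prod_seq_Iic (f : ℂ → ℂ) (n : Fin N) :
    ∏ b ∈ Finset.range (n + 1), f (P.seq b) = ∏ b ∈ Finset.Iic n, f (P.ξ b) := by
  rw [Nat.range_succ_eq_Iic, ← Fin.map_valEmbedding_Iic, Finset.prod_map]
  exact Finset.prod_congr rfl fun b _ => congrArg f (P.seq_val b)

section

variable {κ : ℂ} {t t' : ℂ → ℂ} {φ v : (Fin N → Fin 2) → ℂ}
  (hφ : ∀ u, φ ᵥ* hP.T κ u = t u • φ) (hv : ∀ u, hP.T κ u *ᵥ v = t' u • v)
include hφ hv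

/-- The transfer matrices at ξ_b, b < n, act on the left eigenvector and give the product of the
t(ξ_b); the half transfer matrix at ξ_n remains. -/
lemma Generic.prod_mul_proj (n : Fin N) (i : Fin 2) :
    (∏ b ∈ Finset.Iic n, t' (P.ξ b)) * (φ ⬝ᵥ proj n i v) = (∏ b ∈ Finset.Iio n, t (P.ξ b)) *
      (φ ⬝ᵥ (P.weights hP.im_pos).halfTransfer P.seq N κ i (P.ξ n) P.t0 *ᵥ v) := by
  obtain ⟨N, rfl⟩ : ∃ m, N = m + 1 := Nat.exists_eq_succ_of_ne_zero (NeZero.ne N)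
  have h1 : φ ⬝ᵥ _ = φ ⬝ᵥ _ := congrArg _
    (Weights.prod_smul_proj hP.reg_t0 i n n.isLt P.seq P.seq_add v hv)
  rw [dotProduct_smul, smul_eq_mul, prod_seq_Iic] at h1
  refine h1.trans ?_
  refine (dotProduct_list_prod_mulVec hφ _ _).trans ?_
  rw [seq_val, ← prod_seq_Iio, List.map_map]
  rfl

omit hv in
lemma Generic.dotProduct_T (u : ℂ) (w : (Fin N → Fin 2) → ℂ) :
    φ ⬝ᵥ hP.T κ u *ᵥ w = t u * (φ ⬝ᵥ w) := by
  rw [Matrix.dotProduct_mulVec, hφ, smul_dotProduct, smul_eq_mul]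

variable (hκ : κ ≠ 0) (hne : v ≠ 0) (n : Fin N)
include hκ hne

omit hφ in
lemma Generic.right_eigenvalue_ne_zero (b : Fin N) : t' (P.ξ b) ≠ 0 := by
  have := hP.right_quantum_det hκ hv hne b
  intro h0
  rw [h0, zero_mul] at this
  exact hP.sgn_mul_qdet_ne_zero b this.symm

lemma Generic.proj_element (i : Fin 2) : φ ⬝ᵥ proj n i v =
    (∏ b ∈ Finset.Iio n, t (P.ξ b)) / (∏ b ∈ Finset.Iic n, t' (P.ξ b)) *
      (φ ⬝ᵥ (P.weights hP.im_pos).halfTransfer P.seq N κ i (P.ξ n) P.t0 *ᵥ v) := by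
  have h0 : ∏ b ∈ Finset.Iic n, t' (P.ξ b) ≠ 0 :=
    Finset.prod_ne_zero_iff.mpr fun b _ => hP.right_eigenvalue_ne_zero hv hκ hne b
  rw [div_mul_eq_mul_div, eq_div_iff h0, mul_comm, hP.prod_mul_proj hφ hv]

-- Replacing ξ_n by ξ_n - η costs t(ξ_n)/t'(ξ_n - η), which the quantum determinant relation for t'
-- turns into the second prefactor; ε² = 1 places the sign.
omit hφ in
lemma Generic.prefactor_mul {x y : ℂ} (hxy : t' (P.ξ n - P.η) * x = t (P.ξ n) * y) :
    (∏ b ∈ Finset.Iio n, t (P.ξ b)) / (∏ b ∈ Finset.Iic n, t' (P.ξ b)) * x =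
      P.sgn * ((∏ b ∈ Finset.Iic n, t (P.ξ b)) / (∏ b ∈ Finset.Iio n, t' (P.ξ b))) *
        (y / P.qdet (P.ξ n)) := by
  have h0 : ∀ b, t' (P.ξ b) ≠ 0 := hP.right_eigenvalue_ne_zero hv hκ hne
  have h1 : ∏ b ∈ Finset.Iio n, t' (P.ξ b) ≠ 0 := Finset.prod_ne_zero_iff.mpr fun b _ => h0 b
  have h2 := hP.right_quantum_det hκ hv hne n
  have h3 : P.qdet (P.ξ n) ≠ 0 := right_ne_zero_of_mul (hP.sgn_mul_qdet_ne_zero n)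
  have h4 := sgn_mul_sgn (P := P)
  have hI : Finset.Iic n = insert n (Finset.Iio n) := (Finset.Iio_insert n).symm
  rw [hI, Finset.prod_insert (by simp), Finset.prod_insert (by simp)]
  have := h0 n
  field_simp
  linear_combination (∏ b ∈ Finset.Iio n, t (P.ξ b)) * (-(x * P.qdet (P.ξ n)) * h4 -
    x * P.sgn * h2 + P.sgn * t' (P.ξ n) * hxy)

lemma Generic.proj_zero_element : φ ⬝ᵥ proj n 0 v =
    (∏ b ∈ Finset.Iio n, t (P.ξ b)) / (∏ b ∈ Finset.Iic n, t' (P.ξ b)) *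
      (φ ⬝ᵥ κ • hP.C (P.ξ n) *ᵥ v) ∧ φ ⬝ᵥ proj n 0 v =
    P.sgn * ((∏ b ∈ Finset.Iic n, t (P.ξ b)) / (∏ b ∈ Finset.Iio n, t' (P.ξ b))) *
      ((φ ⬝ᵥ κ⁻¹ • hP.B (P.ξ n - P.η) *ᵥ v) / P.qdet (P.ξ n)) := by
  have h1 := hP.proj_element hφ hv hκ hne n 0
  rw [Weights.halfTransfer, if_pos rfl, Matrix.smul_mulVec] at h1
  refine ⟨h1, h1.trans (hP.prefactor_mul hv hκ hne n ?_)⟩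
  have h2 : φ ⬝ᵥ _ = φ ⬝ᵥ _ := congrArg _ (hP.B_mulVec_right hv n).1
  rwa [hP.dotProduct_T hφ, dotProduct_smul, smul_eq_mul] at h2

lemma Generic.proj_one_element : φ ⬝ᵥ proj n 1 v =
    (∏ b ∈ Finset.Iio n, t (P.ξ b)) / (∏ b ∈ Finset.Iic n, t' (P.ξ b)) *
      (φ ⬝ᵥ κ⁻¹ • hP.B (P.ξ n) *ᵥ v) ∧ φ ⬝ᵥ proj n 1 v =
    P.sgn * ((∏ b ∈ Finset.Iic n, t (P.ξ b)) / (∏ b ∈ Finset.Iio n, t' (P.ξ b))) *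
      ((φ ⬝ᵥ κ • hP.C (P.ξ n - P.η) *ᵥ v) / P.qdet (P.ξ n)) := by
  have h1 := hP.proj_element hφ hv hκ hne n 1
  rw [Weights.halfTransfer, if_neg one_ne_zero, Matrix.smul_mulVec] at h1
  refine ⟨h1, h1.trans (hP.prefactor_mul hv hκ hne n ?_)⟩
  have h2 : φ ⬝ᵥ _ = φ ⬝ᵥ _ := congrArg _ (hP.B_mulVec_right hv n).2
  rwa [hP.dotProduct_T hφ, dotProduct_smul, smul_eq_mul] at h2

end

end Model

end DynSixVertex

end

/-! ### The eigenstates and the matrix elements of the local projectors -/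

theorem mainTheorem4 {N : ℕ} (P : DynSixVertex.Model N) (hP : P.Generic)
    (κ : ℂ) (hκ : κ ≠ 0) (c : ℂ) (hc : c ^ 2 = P.normSq)
    (t t' : ℂ → ℂ) (ψ : DynSixVertex.Bra N) (ψ' : DynSixVertex.Ket N)
    (hψ : P.IsLeftEigenstate κ t ψ) (hψ' : P.IsRightEigenstate κ t' ψ') (n : Fin N) :
    (∃ q, P.IsCoeff t q ∧ ψ = P.leftSeparate κ c q) ∧
    (∃ q', P.IsCoeff t' q' ∧ ψ' = P.rightSeparate κ c q') ∧
    ∀ q q' : Fin N → Fin 2 → ℂ, P.IsCoeff t q → P.IsCoeff t' q' →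
      ψ = P.leftSeparate κ c q → ψ' = P.rightSeparate κ c q' →
      ψ (DynSixVertex.Model.E n 0 0 ψ') =
          (∏ b ∈ Finset.Iio n, t (P.ξ b)) / (∏ b ∈ Finset.Iic n, t' (P.ξ b)) *
            (P.Smat q q' (P.ξ n)).det ∧
      ψ (DynSixVertex.Model.E n 0 0 ψ') =
          P.sgn * ((∏ b ∈ Finset.Iic n, t (P.ξ b)) / (∏ b ∈ Finset.Iio n, t' (P.ξ b))) *
            ((P.Smat q' q (P.ξ n - P.η)).det / P.qdet (P.ξ n)) ∧
      ψ (DynSixVertex.Model.E n 1 1 ψ') =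
          (∏ b ∈ Finset.Iio n, t (P.ξ b)) / (∏ b ∈ Finset.Iic n, t' (P.ξ b)) *
            (P.Smat q' q (P.ξ n)).det ∧
      ψ (DynSixVertex.Model.E n 1 1 ψ') =
          P.sgn * ((∏ b ∈ Finset.Iic n, t (P.ξ b)) / (∏ b ∈ Finset.Iio n, t' (P.ξ b))) *
            ((P.Smat q q' (P.ξ n - P.η)).det / P.qdet (P.ξ n)) := by
  have : NeZero N := ⟨n.pos.ne'⟩
  obtain ⟨φ, rfl, hφ0, hφ⟩ := hP.exists_left_eigenvector hψ
  obtain ⟨v, rfl, hv0, hv⟩ := hP.exists_right_eigenvector hψ'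
  have hM := hP.pairingDet_ne_zero
  have hd : ∏ a, P.cd (P.ξ a - P.η) ≠ 0 := Finset.prod_ne_zero_iff.mpr fun a _ => hP.cd_ne_zero a
  rw [hP.normSq_eq, eq_div_iff hd] at hc
  have hc0 : c ≠ 0 := by
    rintro rfl
    rw [zero_pow two_ne_zero, zero_mul] at hc
    exact hM hc.symm
  refine ⟨?_, ?_, fun q q' _ _ hφq hvq => ?_⟩
  · obtain ⟨q, hq, h⟩ := hP.exists_left_coeff hκ (one_div_ne_zero hc0) hφ hφ0
    exact ⟨q, hq, by rw [hP.leftSeparate_eq, ← h]⟩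
  · obtain ⟨q, hq, h⟩ := hP.exists_right_coeff hκ (one_div_ne_zero (mul_ne_zero hc0 hd)) hv hv0
    exact ⟨q, hq, by rw [hP.rightSeparate_eq, ← h]⟩
  · rw [hP.leftSeparate_eq] at hφq
    rw [hP.rightSeparate_eq] at hvq
    have hx := hP.left_dotProduct_K_of_eq (DynSixVertex.Model.secBra_injective hφq)
    have hv' := DynSixVertex.Model.secKet_injective hvq
    -- The normalization of the reference states enters only through c², so its sign is immaterial
    -- and the constants of the two separate states cancel.
    have hXZ : hP.pairingDet / c * (1 / (c * ∏ a, P.cd (P.ξ a - P.η))) = 1 := by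
      rw [← hc]
      field_simp
    rw [DynSixVertex.Model.E_secKet, DynSixVertex.Model.E_secKet,
      DynSixVertex.Model.secBra_secKet, DynSixVertex.Model.secBra_secKet,
      ← hP.C_element_eq_det hκ hx hv' hXZ, ← hP.C_element_eq_det hκ hx hv' hXZ,
      ← hP.B_element_eq_det hκ hx hv' hXZ, ← hP.B_element_eq_det hκ hx hv' hXZ]
    have h0 := hP.proj_zero_element hφ hv hκ hv0 n
    have h1 := hP.proj_one_element hφ hv hκ hv0 n
    exact ⟨h0.1, h0.2, h1.1, h1.2⟩
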